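/- Let $\Bbbk$ be an algebraically closed field of characteristic $0$ and let $H$ be a finite-dimensional Hopf algebra over $\Bbbk$ with comultiplication $\Delta$. Let $G(H)$ be the set of group-like elements of $H$. An element $x\in H$ is called a nontrivial skew-primitive if there are $g,h\in G(H)$ with $\Delta(x)=g\otimes x+x\otimes h$ and $x\notin\Bbbk(g-h)$. $H$ is called cosemisimple if it is the sum of its simple subcoalgebras. Suppose that $H$ is not cosemisimple, that $H$ has no nontrivial skew-primitives, that $|G(H)|=p$ is a prime number, and that $\dim H=tp$ with $t\ge 1$. Then: 1. if $p=2$, then $t\notin\{1,2,\dots,9,11,13,15\}$; 2. if $p=3$, then $t\notin\{1,2,\dots,13,15,16,19\}$; 3. if $p>3$, then $t\notin\{1,2,\dots,13,15,16,17,20\}$; moreover $t\ne 19$ if $p\ne 5$, and $t\ne 21$ if $p\ne 7$. -/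

import Mathlib

open scoped TensorProduct

namespace BlockSystem

variable {k C : Type*} [Field k] [AddCommGroup C] [Module k C] [Coalgebra k C]

/-- A subspace `D` of a coalgebra is a subcoalgebra if `Δ(D) ⊆ D ⊗ D`, where `D ⊗ D` is regarded
as a subspace of `C ⊗ C`. -/
def IsSubcoalgebra (D : Submodule k C) : Prop :=
  ∀ x ∈ D, Coalgebra.comul (R := k) x ∈ LinearMap.range (TensorProduct.map D.subtype D.subtype)

/-- A simple subcoalgebra: a nonzero subcoalgebra whose only subcoalgebras are `0` and itself. -/
structure IsSimpleSubcoalgebra (D : Submodule k C) : Prop where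
  isSubcoalgebra : IsSubcoalgebra D
  ne_bot : D ≠ ⊥
  eq_bot_or_eq : ∀ E : Submodule k C, E ≤ D → IsSubcoalgebra E → E = ⊥ ∨ E = D

variable (k C)

/-- The coradical: the sum (automatically direct) of all simple subcoalgebras. -/
def coradical : Submodule k C :=
  sSup {D : Submodule k C | IsSimpleSubcoalgebra D}

/-- A coalgebra is cosemisimple if it equals its coradical. -/
def IsCosemisimple : Prop :=
  coradical k C = ⊤

variable {C}

/-- `x` is a nontrivial skew-primitive: there are group-like elements `g`, `h` such that
`Δ(x) = g ⊗ x + x ⊗ h` and `x` is not a scalar multiple of `g - h`. -/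
def IsNontrivialSkewPrimitive (x : C) : Prop :=
  ∃ g h : C, IsGroupLikeElem k g ∧ IsGroupLikeElem k h ∧
    Coalgebra.comul (R := k) x = g ⊗ₜ[k] x + x ⊗ₜ[k] h ∧
    x ∉ Submodule.span k {g - h}

end BlockSystem

/-! Everything takes place in the dual algebra $A=H^*$ (`DualAlgebra`). Its simple modules, of
dimensions $d_i$, are the comodules of the simple subcoalgebras of $H$; the one-dimensional
("linear") ones are the group-like elements. With Cartan numbers $c_{ij}=\dim e_iAe_j$ one has $\dim
H=\sum d_id_jc_{ij}$ (`finrank_eq_sum_cartan`), and the hypotheses force this sum to be large or of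
a special shape.

Frobenius structure: evaluation at a nonzero left integral is a Frobenius form on $A$
(`exists_integral`, `integral_nondegenerate`). Its Nakayama automorphism permutes the blocks, keeps
dimensions, and gives $c_{ij}=c_{j,\nu i}$. Every nonzero submodule of the projective $P_j$ involves
one fixed simple module of dimension $d_j$, so $P_j$ is simple or has two constituents of dimension
$d_j$ (`cartan_eq_one_or_two_le`).

Skew-primitives: they are the extensions between linear modules, so here all such extensions split.
Hence no linear module sits directly below a linear top or directly above a linear socle; this
bounds the number of nonlinear constituents from below (`one_le_nonlinear`, `two_le_nonlinear`).

Cosemisimplicity: if the projective cover of the trivial module were simple, a Maschke argument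
would make $A$ semisimple and $H$ cosemisimple (`jacobson_eq_bot`,
`isCosemisimple_of_jacobson_eq_bot`).

Group action: $G(H)$ is cyclic of order $p$ and acts on the blocks by translation. The linear blocks
form one free orbit, and a fixed block has dimension divisible by $p$ (`dvd_d_of_perm_eq`), by a
trace computation.

`CartanData` records these facts. Division by $p$ gives $t=x+2q+\mathrm{wt}(V)+R$
(`exists_remainder`): $x$ counts the linear constituents of the projective cover of the trivial
module, $q$ is the dimension of its nonlinear part, $V$ is any nonlinear simple module, chosen among
those constituents in the counts, and $R$ comes from the other nonlinear orbits. A short case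
analysis, according to whether such a $V$ can be fixed by the group, excludes the listed $t$. -/

namespace BlockSystem

/-! ### Finite-dimensional algebras over an algebraically closed field -/

/-- A splitting of the semisimple quotient of a finite-dimensional algebra into matrix algebras,
with a lift of the diagonal matrix units to a complete system of orthogonal idempotents. -/
structure SplitSystem (k A : Type*) [Field k] [Ring A] [Algebra k A] where
  n : ℕ
  d : Fin n → ℕ
  d_pos : ∀ i, 0 < d i
  π : A →ₐ[k] Π i, Matrix (Fin (d i)) (Fin (d i)) k
  π_surj : Function.Surjective π
  π_eq_zero : ∀ x, π x = 0 ↔ x ∈ Ring.jacobson A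
  e : (Σ i, Fin (d i)) → A
  coi : CompleteOrthogonalIdempotents e
  π_e : ∀ s, π (e s) = Pi.single s.1 (Matrix.single s.2 s.2 1)

section

variable {k A : Type*} [Field k] [Ring A] [Algebra k A]

theorem isNilpotent_of_mem_jacobson [FiniteDimensional k A] {x : A} (hx : x ∈ Ring.jacobson A) :
    IsNilpotent x := by
  have : IsArtinianRing A := IsArtinianRing.of_finite k A
  obtain ⟨m, hm⟩ := IsSemiprimaryRing.isNilpotent (R := A)
  refine ⟨m, ?_⟩
  have h : x ^ m ∈ (Ring.jacobson A) ^ m := Ideal.pow_mem_pow hx m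
  rw [hm] at h
  simpa using h

/-- Wedderburn–Artin for the semisimple quotient by the radical; the diagonal matrix units lift
because the radical is nil. -/
theorem exists_splitSystem (k A : Type*) [Field k] [Ring A] [Algebra k A]
    [IsAlgClosed k] [FiniteDimensional k A] : Nonempty (SplitSystem k A) := by
  have : IsArtinianRing A := IsArtinianRing.of_finite k A
  have : IsSemisimpleRing (A ⧸ Ring.jacobson A) := IsSemiprimaryRing.isSemisimpleRing
  obtain ⟨n, d, hd, ⟨f⟩⟩ :=
    IsSemisimpleRing.exists_algEquiv_pi_matrix_of_isAlgClosed k (A ⧸ Ring.jacobson A)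
  let π : A →ₐ[k] Π i, Matrix (Fin (d i)) (Fin (d i)) k :=
    (f : _ →ₐ[k] _).comp (Ideal.Quotient.mkₐ k (Ring.jacobson A))
  have hs : Function.Surjective π := by
    intro y
    obtain ⟨x, hx⟩ := Ideal.Quotient.mkₐ_surjective k (Ring.jacobson A) (f.symm y)
    exact ⟨x, (congrArg f hx).trans (f.apply_symm_apply y)⟩
  have hk : ∀ x, π x = 0 ↔ x ∈ Ring.jacobson A := by
    intro x
    simp [π, Ideal.Quotient.eq_zero_iff_mem]
  let u : (Σ i, Fin (d i)) → Π i, Matrix (Fin (d i)) (Fin (d i)) k :=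
    fun s => Pi.single s.1 (Matrix.single s.2 s.2 1)
  have hu : CompleteOrthogonalIdempotents u := by
    classical
    refine ⟨OrthogonalIdempotents.iff_mul_eq.2 ?_, ?_⟩
    · rintro ⟨i, a⟩ ⟨j, b⟩
      by_cases hij : i = j
      · subst hij
        by_cases hab : a = b
        · subst hab; simp [u, ← Pi.single_mul]
        · simp [u, ← Pi.single_mul, hab]
      · have : (⟨i, a⟩ : Σ i, Fin (d i)) ≠ ⟨j, b⟩ := fun h => hij (congrArg Sigma.fst h)
        rw [if_neg this]
        funext l
        by_cases hl : l = i
        · subst hl; simp [u, Pi.single_eq_of_ne hij]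
        · simp [u, Pi.single_eq_of_ne hl]
    · rw [Fintype.sum_sigma]
      funext l
      rw [Finset.sum_apply, Finset.sum_eq_single l]
      · rw [Finset.sum_apply]
        simp only [u, Pi.single_eq_same, Pi.one_apply]
        ext a b
        rw [Matrix.sum_apply, Finset.sum_eq_single a (fun c _ hc => by simp [hc])
          (by simp)]
        simp [Matrix.single_apply, Matrix.one_apply]
      · intro i _ hi
        rw [Finset.sum_apply]
        simp [u, Pi.single_eq_of_ne hi.symm]
      · simp
  obtain ⟨e, he, he'⟩ := CompleteOrthogonalIdempotents.lift_of_isNilpotent_ker π.toRingHom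
    (fun x hx => isNilpotent_of_mem_jacobson (k := k) ((hk x).1 hx)) hu (fun s => hs _)
  exact ⟨⟨n, d, fun i => (hd i).pos, π, hs, hk, e, he, fun s => congrFun he' s⟩⟩

/-- The dimension of `f A g`. -/
noncomputable def cornerDim (k : Type*) {A : Type*} [Field k] [Ring A] [Algebra k A] (f g : A) : ℕ :=
  Module.finrank k (LinearMap.range (LinearMap.mulLeft k f ∘ₗ LinearMap.mulRight k g))

/-- In characteristic zero the rank of a projection is its trace, so ranks add up without any direct
sum decomposition. -/
theorem finrank_eq_sum_finrank_range [CharZero k] {V ι : Type*} [AddCommGroup V] [Module k V]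
    [FiniteDimensional k V] [Fintype ι] (P : ι → V →ₗ[k] V) (hP : ∀ i, P i ∘ₗ P i = P i)
    (hsum : ∑ i, P i = LinearMap.id) :
    Module.finrank k V = ∑ i, Module.finrank k (LinearMap.range (P i)) := by
  have h : ∀ i, LinearMap.trace k V (P i) = (Module.finrank k (LinearMap.range (P i)) : k) := by
    intro i
    refine LinearMap.IsProj.trace (p := LinearMap.range (P i)) ⟨fun x => ⟨x, rfl⟩, ?_⟩
    rintro _ ⟨y, rfl⟩
    exact LinearMap.congr_fun (hP i) y
  have := congrArg (LinearMap.trace k V) hsum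
  rw [map_sum, LinearMap.trace_id, Finset.sum_congr rfl fun i _ => h i] at this
  exact_mod_cast this.symm

theorem sum_cornerDim [CharZero k] [FiniteDimensional k A] {ι : Type*} [Fintype ι] {e : ι → A}
    (he : CompleteOrthogonalIdempotents e) :
    Module.finrank k A = ∑ s, ∑ t, cornerDim k (e s) (e t) := by
  rw [← Fintype.sum_prod_type']
  refine finrank_eq_sum_finrank_range
    (fun s : ι × ι => LinearMap.mulLeft k (e s.1) ∘ₗ LinearMap.mulRight k (e s.2)) ?_ ?_
  · rintro ⟨s, t⟩
    ext x
    have h1 := (he.idem s).eq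
    have h2 := (he.idem t).eq
    simp only [LinearMap.comp_apply, LinearMap.mulLeft_apply, LinearMap.mulRight_apply]
    rw [show e s * (e s * (x * e t) * e t) = (e s * e s) * x * (e t * e t) by noncomm_ring, h1, h2,
      mul_assoc]
  · ext x
    simp only [LinearMap.sum_apply, LinearMap.comp_apply, LinearMap.mulLeft_apply,
      LinearMap.mulRight_apply, LinearMap.id_apply]
    rw [Fintype.sum_prod_type]
    simp_rw [← Finset.mul_sum, he.complete, mul_one, ← Finset.sum_mul, he.complete, one_mul]

theorem cornerDim_map (τ : A ≃ₐ[k] A) (f g : A) : cornerDim k (τ f) (τ g) = cornerDim k f g := by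
  have : (LinearMap.mulLeft k (τ f) ∘ₗ LinearMap.mulRight k (τ g)) =
      τ.toLinearMap ∘ₗ (LinearMap.mulLeft k f ∘ₗ LinearMap.mulRight k g) ∘ₗ
        τ.symm.toLinearMap := by
    ext x; simp
  rw [cornerDim, this, LinearMap.range_comp, LinearMap.range_comp_of_range_eq_top]
  · exact (LinearEquiv.finrank_map_eq τ.toLinearEquiv _)
  · exact LinearMap.range_eq_top.2 τ.symm.surjective

/-- Multiplicity of the simple module attached to the idempotent `f` in a left ideal. -/
noncomputable def idealMult (k : Type*) {A : Type*} [Field k] [Ring A] [Algebra k A] (f : A)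
    (N : Submodule A A) : ℕ :=
  Module.finrank k ((N.restrictScalars k).map (LinearMap.mulLeft k f))

theorem idealMult_span (f g : A) : idealMult k f (Ideal.span {g}) = cornerDim k f g := by
  have : ((Ideal.span {g} : Submodule A A).restrictScalars k) =
      LinearMap.range (LinearMap.mulRight k g) := by
    ext x
    simp [Ideal.mem_span_singleton', LinearMap.mem_range]
  rw [idealMult, cornerDim, this, LinearMap.range_comp]

theorem idealMult_mono [FiniteDimensional k A] (f : A) {N N' : Submodule A A} (h : N ≤ N') :
    idealMult k f N ≤ idealMult k f N' :=
  Submodule.finrank_mono (Submodule.map_mono h)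

theorem idealMult_pos [FiniteDimensional k A] {f x : A} {N : Submodule A A} (hx : x ∈ N)
    (hfx : f * x ≠ 0) : 0 < idealMult k f N := by
  rw [idealMult, Module.finrank_pos_iff_exists_ne_zero]
  exact ⟨⟨f * x, x, hx, rfl⟩, fun h => hfx (congrArg Subtype.val h)⟩

theorem idealMult_lt [FiniteDimensional k A] {f x : A}
    {N N' : Submodule A A} (h : N ≤ N')
    (hx : x ∈ N') (hfx : f * x ∉ N) : idealMult k f N < idealMult k f N' := by
  refine Submodule.finrank_lt_finrank_of_lt (lt_of_le_of_ne (Submodule.map_mono h) fun heq => ?_)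
  have : f * x ∈ (N'.restrictScalars k).map (LinearMap.mulLeft k f) := ⟨x, hx, rfl⟩
  rw [← heq] at this
  obtain ⟨y, hy, hyx⟩ := this
  exact hfx (hyx ▸ N.smul_mem f hy)

theorem eq_zero_of_mem_jacobson_mul_eq [FiniteDimensional k A] {j x : A}
    (hj : j ∈ Ring.jacobson A) (h : j * x = x) : x = 0 := by
  obtain ⟨m, hm⟩ := isNilpotent_of_mem_jacobson (k := k) hj
  have : ∀ m : ℕ, j ^ m * x = x := by
    intro m
    induction m with
    | zero => simp
    | succ m ih => rw [pow_succ, mul_assoc, h, ih]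
  rw [← this m, hm, zero_mul]

theorem eq_zero_of_mul_mem_jacobson_eq [FiniteDimensional k A] {j x : A}
    (hj : j ∈ Ring.jacobson A) (h : x * j = x) : x = 0 := by
  obtain ⟨m, hm⟩ := isNilpotent_of_mem_jacobson (k := k) hj
  have : ∀ m : ℕ, x * j ^ m = x := by
    intro m
    induction m with
    | zero => simp
    | succ m ih => rw [pow_succ', ← mul_assoc, h, ih]
  rw [← this m, hm, mul_zero]

/-- Left multiplication by `g * y` is injective on `f N`: an element of the kernel is fixed by `f -
f * x * g * y * f`, which is nilpotent. Used in both directions, it makes multiplicities depend only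
on the block of the idempotent. -/
theorem idealMult_le_of_sub_mem [FiniteDimensional k A] {f g x y : A} (hf : IsIdempotentElem f)
    (h : f * x * g * y * f - f ∈ Ring.jacobson A) (N : Submodule A A) :
    idealMult k f N ≤ idealMult k g N := by
  let F : A →ₗ[k] A := LinearMap.mulLeft k (g * y)
  have hmap : ((N.restrictScalars k).map (LinearMap.mulLeft k f)).map F ≤
      (N.restrictScalars k).map (LinearMap.mulLeft k g) := by
    rintro _ ⟨_, ⟨z, hz, rfl⟩, rfl⟩
    refine ⟨y * (f * z), N.smul_mem y (N.smul_mem f hz), ?_⟩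
    simp [F]
  have hinj : Set.InjOn F ((N.restrictScalars k).map (LinearMap.mulLeft k f)) := by
    intro u hu v hv huv
    have : ∀ u ∈ ((N.restrictScalars k).map (LinearMap.mulLeft k f)), f * u = u := by
      rintro _ ⟨z, hz, rfl⟩
      simp [← mul_assoc, hf.eq]
    have hw : f * (u - v) = u - v := by rw [mul_sub, this u hu, this v hv]
    have h0 : g * y * (u - v) = 0 := by
      rw [mul_sub, sub_eq_zero]; exact huv
    have h1 : (f - f * x * g * y * f) * (u - v) = u - v := by
      rw [sub_mul, show f * x * g * y * f * (u - v) = f * x * (g * y * (f * (u - v))) by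
        noncomm_ring, hw, h0, mul_zero, sub_zero]
    have h2 : f - f * x * g * y * f ∈ Ring.jacobson A := by
      rw [← neg_sub]; exact neg_mem h
    exact sub_eq_zero.1 (eq_zero_of_mem_jacobson_mul_eq (k := k) h2 h1)
  rw [idealMult, ← LinearMap.finrank_range_of_inj (f := F.domRestrict _)
    (fun u v huv => Subtype.ext (hinj u.2 v.2 huv)), LinearMap.range_domRestrict]
  exact Submodule.finrank_mono hmap

theorem cornerDim_le_of_sub_mem_left [FiniteDimensional k A] {f g x y : A}
    (hf : IsIdempotentElem f) (h : f * x * g * y * f - f ∈ Ring.jacobson A) (z : A) :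
    cornerDim k f z ≤ cornerDim k g z := by
  rw [← idealMult_span, ← idealMult_span]
  exact idealMult_le_of_sub_mem hf h _

theorem cornerDim_le_of_sub_mem_right [FiniteDimensional k A] {f g x y : A}
    (hf : IsIdempotentElem f) (h : f * x * g * y * f - f ∈ Ring.jacobson A) (z : A) :
    cornerDim k z f ≤ cornerDim k z g := by
  let F : A →ₗ[k] A := LinearMap.mulRight k (x * g)
  set R := LinearMap.range (LinearMap.mulLeft k z ∘ₗ LinearMap.mulRight k f) with hR
  have hmap : R.map F ≤ LinearMap.range (LinearMap.mulLeft k z ∘ₗ LinearMap.mulRight k g) := by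
    rintro _ ⟨_, ⟨w, rfl⟩, rfl⟩
    exact ⟨w * f * x, by simp [F, mul_assoc]⟩
  have hinj : Function.Injective (F.domRestrict R) := by
    rintro ⟨u, u', hu⟩ ⟨v, v', hv⟩ huv
    have hw : (u - v) * f = u - v := by
      rw [sub_mul, ← hu, ← hv]; simp [mul_assoc, hf.eq]
    have h0 : (u - v) * (x * g) = 0 := by
      rw [sub_mul, sub_eq_zero]; exact huv
    have h1 : (u - v) * (f - f * x * g * y * f) = u - v := by
      rw [mul_sub, show (u - v) * (f * x * g * y * f) = ((u - v) * f) * (x * g) * (y * f) by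
        noncomm_ring, hw, h0, zero_mul, sub_zero]
    have h2 : f - f * x * g * y * f ∈ Ring.jacobson A := by
      rw [← neg_sub]; exact neg_mem h
    exact Subtype.ext (sub_eq_zero.1 (eq_zero_of_mul_mem_jacobson_eq (k := k) h2 h1))
  rw [cornerDim, ← hR, ← LinearMap.finrank_range_of_inj hinj, LinearMap.range_domRestrict]
  exact Submodule.finrank_mono hmap

end

end BlockSystem

/-! ### Primitive idempotents, Cartan numbers and the blocks -/

namespace BlockSystem

namespace SplitSystem

variable {k A : Type*} [Field k] [Ring A] [Algebra k A] (S : SplitSystem k A)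

/-- A primitive idempotent of the `i`-th block. -/
def E (i : Fin S.n) : A := S.e ⟨i, ⟨0, S.d_pos i⟩⟩

/-- `f` is a primitive idempotent belonging to the `l`-th block. -/
structure HasType (f : A) (l : Fin S.n) : Prop where
  idem : IsIdempotentElem f
  eq_zero : ∀ m, m ≠ l → S.π f m = 0
  ne_zero : S.π f l ≠ 0
  corner : ∀ a, ∃ c : k, S.π (f * a * f) l = c • S.π f l

theorem hasType_e (s : Σ i, Fin (S.d i)) : S.HasType (S.e s) s.1 where
  idem := S.coi.idem s
  eq_zero m hm := by rw [S.π_e, Pi.single_eq_of_ne hm]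
  ne_zero h := by
    rw [S.π_e, Pi.single_eq_same] at h
    simpa using congrFun (congrFun h s.2) s.2
  corner a := by
    refine ⟨S.π a s.1 s.2 s.2, ?_⟩
    rw [map_mul, map_mul, S.π_e, Pi.mul_apply, Pi.mul_apply, Pi.single_eq_same,
      Matrix.single_mul_mul_single]
    simp

theorem hasType_E (i : Fin S.n) : S.HasType (S.E i) i := S.hasType_e _

variable {S}

theorem exists_entry_ne_zero {n : ℕ} {F : Matrix (Fin n) (Fin n) k} (h : F ≠ 0) :
    ∃ a b, F a b ≠ 0 := by
  by_contra! hc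
  exact h (by ext a b; exact hc a b)

/-- Pick nonzero entries of the images of `f` and `g` and join them by lifted matrix units. The
product has a nonzero entry, and primitivity of `f` makes it a nonzero multiple of `f` modulo the
radical; rescaling `x` finishes. -/
theorem HasType.exists_sub_mem {f g : A} {l : Fin S.n} (hf : S.HasType f l)
    (hg : S.HasType g l) : ∃ x y, f * x * g * y * f - f ∈ Ring.jacobson A := by
  obtain ⟨a, b, hab⟩ := exists_entry_ne_zero hf.ne_zero
  obtain ⟨a', b', hab'⟩ := exists_entry_ne_zero hg.ne_zero
  obtain ⟨x, hx⟩ := S.π_surj (Pi.single l (Matrix.single b a' 1))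
  obtain ⟨y, hy⟩ := S.π_surj (Pi.single l (Matrix.single b' a 1))
  obtain ⟨c, hc⟩ := hf.corner (x * g * y)
  have h1 : S.π (f * (x * g * y) * f) l a b = S.π f l a b * S.π g l a' b' * S.π f l a b := by
    simp only [map_mul, Pi.mul_apply, hx, hy, Pi.single_eq_same]
    rw [Matrix.single_mul_mul_single, Matrix.mul_assoc, Matrix.mul_apply,
      Finset.sum_eq_single b]
    · simp [mul_assoc]
    · intro j _ hj; simp [Matrix.mul_apply, hj.symm]
    · simp
  have hc0 : c ≠ 0 := by
    rintro rfl
    rw [hc] at h1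
    simp at h1
    tauto
  refine ⟨c⁻¹ • x, y, (S.π_eq_zero _).1 ?_⟩
  rw [map_sub, sub_eq_zero]
  funext m
  by_cases hm : m = l
  · subst hm
    have : f * (c⁻¹ • x) * g * y * f = c⁻¹ • (f * (x * g * y) * f) := by
      simp [mul_assoc]
    rw [this, map_smul, Pi.smul_apply, hc, smul_smul, inv_mul_cancel₀ hc0, one_smul]
  · simp [hf.eq_zero m hm]

variable [FiniteDimensional k A]

theorem HasType.idealMult_eq {f g : A} {l : Fin S.n} (hf : S.HasType f l) (hg : S.HasType g l)
    (N : Submodule A A) : idealMult k f N = idealMult k g N := by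
  obtain ⟨x, y, h⟩ := hf.exists_sub_mem hg
  obtain ⟨x', y', h'⟩ := hg.exists_sub_mem hf
  exact le_antisymm (idealMult_le_of_sub_mem hf.idem h N) (idealMult_le_of_sub_mem hg.idem h' N)

theorem HasType.cornerDim_eq {f f' g g' : A} {l m : Fin S.n} (hf : S.HasType f l)
    (hf' : S.HasType f' l) (hg : S.HasType g m) (hg' : S.HasType g' m) :
    cornerDim k f g = cornerDim k f' g' := by
  obtain ⟨x, y, h⟩ := hf.exists_sub_mem hf'
  obtain ⟨x', y', h'⟩ := hf'.exists_sub_mem hf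
  obtain ⟨z, w, h₁⟩ := hg.exists_sub_mem hg'
  obtain ⟨z', w', h₁'⟩ := hg'.exists_sub_mem hg
  exact le_antisymm
    ((cornerDim_le_of_sub_mem_left hf.idem h g).trans
      (cornerDim_le_of_sub_mem_right hg.idem h₁ f'))
    ((cornerDim_le_of_sub_mem_left hf'.idem h' g').trans
      (cornerDim_le_of_sub_mem_right hg'.idem h₁' f))

variable (S)

/-- The Cartan numbers. -/
noncomputable def cartan (i j : Fin S.n) : ℕ := cornerDim k (S.E i) (S.E j)

theorem finrank_eq_sum_cartan [CharZero k] :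
    Module.finrank k A = ∑ i, ∑ j, S.d i * S.d j * S.cartan i j := by
  rw [sum_cornerDim (k := k) S.coi, Fintype.sum_sigma]
  refine Finset.sum_congr rfl fun i _ => ?_
  have : ∀ a : Fin (S.d i), ∑ t, cornerDim k (S.e ⟨i, a⟩) (S.e t) =
      ∑ j, S.d j * S.cartan i j := by
    intro a
    rw [Fintype.sum_sigma]
    refine Finset.sum_congr rfl fun j _ => ?_
    rw [Finset.sum_congr rfl fun b _ => (S.hasType_e ⟨i, a⟩).cornerDim_eq (S.hasType_E i)
      (S.hasType_e ⟨j, b⟩) (S.hasType_E j)]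
    simp [cartan]
  rw [Finset.sum_congr rfl fun a _ => this a]
  simp [Finset.mul_sum, mul_assoc]

/-! ### Surjections onto simple algebras and automorphisms -/

omit [FiniteDimensional k A] in
theorem π_sum_block (l : Fin S.n) : S.π (∑ a, S.e ⟨l, a⟩) = Pi.single l 1 := by
  rw [map_sum]
  funext m
  rw [Finset.sum_apply]
  by_cases h : m = l
  · subst h
    simp only [S.π_e, Pi.single_eq_same]
    ext a b
    rw [Matrix.sum_apply, Finset.sum_eq_single a (fun c _ hc => by simp [hc]) (by simp)]
    simp [Matrix.single_apply, Matrix.one_apply]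
  · simp [S.π_e, Pi.single_eq_of_ne h]

end SplitSystem

theorem exists_mem_map_eq_one {A B : Type*} [Ring A] [Ring B] [IsSimpleRing B] {q : A →+* B}
    (hq : Function.Surjective q) (I : TwoSidedIdeal A) {c : A} (hc : c ∈ I) (hqc : q c ≠ 0) :
    ∃ y ∈ I, q y = 1 := by
  let I' : TwoSidedIdeal B := TwoSidedIdeal.mk' (q '' I) ⟨0, I.zero_mem, map_zero q⟩
    (by rintro _ _ ⟨x, hx, rfl⟩ ⟨y, hy, rfl⟩; exact ⟨x + y, I.add_mem hx hy, map_add q x y⟩)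
    (by rintro _ ⟨x, hx, rfl⟩; exact ⟨-x, I.neg_mem hx, map_neg q x⟩)
    (by
      rintro b _ ⟨x, hx, rfl⟩
      obtain ⟨a, rfl⟩ := hq b
      exact ⟨a * x, I.mul_mem_left _ _ hx, map_mul q a x⟩)
    (by
      rintro _ b ⟨x, hx, rfl⟩
      obtain ⟨a, rfl⟩ := hq b
      exact ⟨x * a, I.mul_mem_right _ _ hx, map_mul q x a⟩)
  have hmem : ∀ b, b ∈ I' ↔ b ∈ q '' I := fun b => TwoSidedIdeal.mem_mk' ..
  have hone : (1 : B) ∈ I' := by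
    rcases eq_bot_or_eq_top I' with h | h
    · have : q c ∈ I' := (hmem _).2 ⟨c, hc, rfl⟩
      rw [h, TwoSidedIdeal.mem_bot] at this
      exact absurd this hqc
    · rw [h]; trivial
  obtain ⟨y, hy, hy1⟩ := (hmem 1).1 hone
  exact ⟨y, hy, hy1⟩

namespace SplitSystem

variable {k A : Type*} [Field k] [Ring A] [Algebra k A] (S : SplitSystem k A)
  [FiniteDimensional k A]

/-- The projection to the `l`-th matrix block. -/
def proj (l : Fin S.n) : A →ₐ[k] Matrix (Fin (S.d l)) (Fin (S.d l)) k :=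
  (Pi.evalAlgHom k _ l).comp S.π

omit [FiniteDimensional k A] in
@[simp] theorem proj_apply (l : Fin S.n) (a : A) : S.proj l a = S.π a l := rfl

omit [FiniteDimensional k A] in
theorem proj_surjective (l : Fin S.n) : Function.Surjective (S.proj l) := fun y => by
  obtain ⟨x, hx⟩ := S.π_surj (Pi.single l y)
  exact ⟨x, by simp [hx]⟩

instance (l : Fin S.n) : NeZero (S.d l) := ⟨(S.d_pos l).ne'⟩

/-- The radical dies in a simple quotient, since otherwise one of its nilpotent elements would map
to `1`. Some block idempotent survives, and comparison with it identifies the two kernels. -/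
theorem exists_ker_eq {B : Type*} [Ring B] [Algebra k B] [IsSimpleRing B] {q : A →ₐ[k] B}
    (hq : Function.Surjective q) : ∃ l, ∀ a, q a = 0 ↔ S.π a l = 0 := by
  have hq' : Function.Surjective (q : A →+* B) := hq
  have hJ : ∀ x, S.π x = 0 → q x = 0 := by
    intro x hx
    by_contra hqx
    obtain ⟨y, hy, hy1⟩ := exists_mem_map_eq_one hq' (TwoSidedIdeal.ker S.π.toRingHom)
      (c := x) ((TwoSidedIdeal.mem_ker S.π.toRingHom).2 hx) hqx
    have hn : IsNilpotent y := isNilpotent_of_mem_jacobson (k := k)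
      ((S.π_eq_zero y).1 ((TwoSidedIdeal.mem_ker S.π.toRingHom).1 hy))
    have := hn.map (q : A →+* B)
    rw [hy1] at this
    obtain ⟨m, hm⟩ := this
    exact one_ne_zero ((one_pow m).symm.trans hm)
  obtain ⟨l, hl⟩ : ∃ l, q (∑ a, S.e ⟨l, a⟩) ≠ 0 := by
    by_contra! hc
    have := S.coi.complete
    rw [Fintype.sum_sigma] at this
    have := congrArg q this
    rw [map_sum, Finset.sum_eq_zero fun l _ => hc l, map_one] at this
    exact zero_ne_one this
  set z := ∑ a, S.e ⟨l, a⟩ with hz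
  have hzπ := S.π_sum_block l
  rw [← hz] at hzπ
  refine ⟨l, fun a => ⟨fun ha => ?_, fun ha => ?_⟩⟩
  · by_contra hla
    obtain ⟨y, hy, hy1⟩ := exists_mem_map_eq_one
      (q := (S.proj l).toRingHom) (S.proj_surjective l)
      (TwoSidedIdeal.ker (q : A →+* B)) (c := a) ((TwoSidedIdeal.mem_ker _).2 ha) hla
    -- Here `q y = 0` while `y` acts as `1` on the block of `z`; so `z` agrees with `y * z` modulo
    -- the radical and would be killed by `q`.
    have h1 : S.π (y * z - z) = 0 := by
      rw [map_sub, map_mul, hzπ, sub_eq_zero]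
      funext m
      by_cases hm : m = l
      · subst hm
        rw [Pi.mul_apply, Pi.single_eq_same, mul_one]
        exact hy1
      · simp [Pi.single_eq_of_ne hm]
    have h2 := hJ _ h1
    rw [map_sub, map_mul, show q y = 0 from (TwoSidedIdeal.mem_ker _).1 hy, zero_mul, zero_sub,
      neg_eq_zero] at h2
    exact hl h2
  · by_contra hqa
    obtain ⟨y, hy, hy1⟩ := exists_mem_map_eq_one hq'
      (TwoSidedIdeal.ker (S.proj l).toRingHom) (c := a)
      ((TwoSidedIdeal.mem_ker (S.proj l).toRingHom).2 ha) hqa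
    have hy0 : S.π y l = 0 := (TwoSidedIdeal.mem_ker (S.proj l).toRingHom).1 hy
    have h1 : S.π (y * z) = 0 := by
      rw [map_mul, hzπ]
      funext m
      by_cases hm : m = l
      · subst hm; simp [hy0]
      · simp [Pi.single_eq_of_ne hm]
    have h2 := hJ _ h1
    rw [map_mul, show q y = 1 from hy1, one_mul] at h2
    exact hl h2

omit [FiniteDimensional k A] in
theorem index_unique {l m : Fin S.n} (h : ∀ a, S.π a l = 0 ↔ S.π a m = 0) : l = m := by
  by_contra hlm
  exact (S.hasType_E l).ne_zero ((h _).2 ((S.hasType_E l).eq_zero m (Ne.symm hlm)))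

theorem finrank_eq_of_ker_eq {V W W' : Type*} [AddCommGroup V] [Module k V] [AddCommGroup W]
    [Module k W] [AddCommGroup W'] [Module k W'] [FiniteDimensional k V] {f : V →ₗ[k] W}
    {f' : V →ₗ[k] W'} (hf : Function.Surjective f) (hf' : Function.Surjective f')
    (h : ∀ a, f a = 0 ↔ f' a = 0) : Module.finrank k W = Module.finrank k W' := by
  have hk : LinearMap.ker f = LinearMap.ker f' := by ext a; simpa using h a
  have h1 := LinearMap.finrank_range_add_finrank_ker f
  have h2 := LinearMap.finrank_range_add_finrank_ker f'
  rw [LinearMap.range_eq_top.2 hf, finrank_top] at h1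
  rw [LinearMap.range_eq_top.2 hf', finrank_top] at h2
  rw [hk] at h1
  omega

theorem finrank_eq_sq {B : Type*} [Ring B] [Algebra k B] {q : A →ₐ[k] B}
    (hq : Function.Surjective q) {l : Fin S.n} (h : ∀ a, q a = 0 ↔ S.π a l = 0) :
    Module.finrank k B = S.d l * S.d l := by
  rw [finrank_eq_of_ker_eq (f := q.toLinearMap) (f' := (S.proj l).toLinearMap) hq
    (S.proj_surjective l) h]
  simp [Module.finrank_matrix]

/-- `ρ l` is the block of the `l`-th simple module pulled back along `τ`. Pull-back is
contravariant, hence the reversed order in `perm_mul`. -/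
theorem exists_perm (τ : A ≃ₐ[k] A) :
    ∃ ρ : Equiv.Perm (Fin S.n), ∀ l a, S.π (τ a) l = 0 ↔ S.π a (ρ l) = 0 := by
  have : ∀ l, ∃ m, ∀ a, S.π (τ a) l = 0 ↔ S.π a m = 0 := fun l =>
    S.exists_ker_eq (q := (S.proj l).comp (τ : A →ₐ[k] A))
      ((S.proj_surjective l).comp τ.surjective)
  choose ρ hρ using this
  have hinj : Function.Injective ρ := by
    intro l m hlm
    refine S.index_unique fun a => ?_
    have h1 := hρ l (τ.symm a)
    have h2 := hρ m (τ.symm a)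
    rw [AlgEquiv.apply_symm_apply] at h1 h2
    rw [h1, h2, hlm]
  exact ⟨Equiv.ofBijective ρ (Finite.injective_iff_bijective.1 hinj), hρ⟩

/-- The permutation of the blocks induced by an automorphism. -/
noncomputable def perm (τ : A ≃ₐ[k] A) : Equiv.Perm (Fin S.n) := (S.exists_perm τ).choose

theorem perm_spec (τ : A ≃ₐ[k] A) (l : Fin S.n) (a : A) :
    S.π (τ a) l = 0 ↔ S.π a (S.perm τ l) = 0 := (S.exists_perm τ).choose_spec l a

theorem d_perm (τ : A ≃ₐ[k] A) (l : Fin S.n) : S.d (S.perm τ l) = S.d l := by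
  have h := S.finrank_eq_sq (q := (S.proj l).comp (τ : A →ₐ[k] A))
      ((S.proj_surjective l).comp τ.surjective) (l := S.perm τ l) (S.perm_spec τ l)
  simp [Module.finrank_matrix] at h
  exact (Nat.mul_self_inj.1 h).symm

theorem HasType.map {S : SplitSystem k A} {τ : A ≃ₐ[k] A} {f : A} {l : Fin S.n}
    (hf : S.HasType f (S.perm τ l)) : S.HasType (τ f) l where
  idem := hf.idem.map τ
  eq_zero m hm := (S.perm_spec τ m f).2 (hf.eq_zero _ ((S.perm τ).injective.ne hm))
  ne_zero h := hf.ne_zero ((S.perm_spec τ l f).1 h)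
  corner a := by
    obtain ⟨c, hc⟩ := hf.corner (τ.symm a)
    refine ⟨c, ?_⟩
    have : S.π (f * τ.symm a * f - c • f) (S.perm τ l) = 0 := by
      rw [map_sub, Pi.sub_apply, hc, map_smul, Pi.smul_apply, sub_self]
    have := (S.perm_spec τ l _).2 this
    rw [map_sub, map_sub, Pi.sub_apply, sub_eq_zero] at this
    simpa using this

theorem cartan_perm (τ : A ≃ₐ[k] A) (i j : Fin S.n) :
    S.cartan (S.perm τ i) (S.perm τ j) = S.cartan i j := by
  rw [cartan, ← cornerDim_map τ]
  exact ((S.hasType_E _).map).cornerDim_eq (S.hasType_E i) ((S.hasType_E _).map) (S.hasType_E j)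

theorem perm_mul (σ τ : A ≃ₐ[k] A) : S.perm (σ * τ) = S.perm τ * S.perm σ := by
  ext1 l
  refine S.index_unique fun a => ?_
  rw [← S.perm_spec, AlgEquiv.mul_apply, S.perm_spec, S.perm_spec]
  rfl

theorem perm_one : S.perm (1 : A ≃ₐ[k] A) = 1 := by
  ext1 l
  refine S.index_unique fun a => ?_
  rw [← S.perm_spec]
  rfl

theorem perm_pow (τ : A ≃ₐ[k] A) (m : ℕ) : S.perm (τ ^ m) = S.perm τ ^ m := by
  induction m with
  | zero => exact S.perm_one
  | succ m ih => rw [pow_succ, perm_mul, ih, pow_succ']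

end SplitSystem

end BlockSystem

namespace BlockSystem

/-! ### Frobenius forms and the Nakayama automorphism -/

section

variable {k A : Type*} [Field k] [Ring A] [Algebra k A] [FiniteDimensional k A]

/-- Nondegeneracy makes `x ↦ φ(· x)` an isomorphism of `A` with its dual, so each `φ(a ·)` equals
`φ(· σ(a))` for a unique `σ(a)`; uniqueness also yields multiplicativity. -/
theorem exists_nakayama {φ : A →ₗ[k] k} (hφ : ∀ x, (∀ a, φ (a * x) = 0) → x = 0) :
    ∃ σ : A ≃ₐ[k] A, ∀ a b, φ (a * b) = φ (b * σ a) := by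
  let B : A →ₗ[k] Module.Dual k A := ((LinearMap.mul k A).compr₂ φ).flip
  have hB : ∀ x a, B x a = φ (a * x) := fun x a => rfl
  have hBi : Function.Injective B := by
    rw [injective_iff_map_eq_zero]
    intro x hx
    exact hφ x fun a => by rw [← hB, hx]; rfl
  have hBs : Function.Surjective B :=
    (LinearMap.injective_iff_surjective_of_finrank_eq_finrank
      (Subspace.dual_finrank_eq (K := k) (V := A)).symm).1 hBi
  let e : A ≃ₗ[k] Module.Dual k A := LinearEquiv.ofBijective B ⟨hBi, hBs⟩
  let s : A →ₗ[k] A := e.symm.toLinearMap ∘ₗ (LinearMap.mul k A).compr₂ φ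
  have hs : ∀ a b, φ (a * b) = φ (b * s a) := by
    intro a b
    rw [← hB (s a) b]
    have : B (s a) = (LinearMap.mul k A).compr₂ φ a := e.apply_symm_apply _
    rw [this]; rfl
  have hext : ∀ x y, (∀ b, φ (b * x) = φ (b * y)) → x = y := by
    intro x y h
    exact hBi (LinearMap.ext h)
  have hmul : ∀ a a', s (a * a') = s a * s a' := by
    intro a a'
    refine hext _ _ fun b => ?_
    rw [← hs, mul_assoc, hs, mul_assoc, hs, mul_assoc]
  have hone : s 1 = 1 := hext _ _ fun b => by rw [← hs, one_mul, mul_one]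
  have hinj : Function.Injective s := by
    rw [injective_iff_map_eq_zero]
    intro a ha
    by_contra hne
    obtain ⟨f, hf⟩ := (Module.forall_dual_apply_eq_zero_iff k a).not.2 hne |> not_forall.1
    obtain ⟨y, rfl⟩ := hBs f
    exact hf (by rw [hB, hs, ha, mul_zero, map_zero])
  let s' : A →ₐ[k] A := AlgHom.ofLinearMap s hone hmul
  exact ⟨AlgEquiv.ofBijective s' ⟨hinj, (LinearMap.injective_iff_surjective (f := s)).1 hinj⟩, hs⟩

/-- The form `φ(x y)` pairs `f A g` with `g A σ(f)` and has no kernel on the first factor. -/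
theorem cornerDim_le_of_nakayama {φ : A →ₗ[k] k} (hφ : ∀ x, (∀ a, φ (a * x) = 0) → x = 0)
    {σ : A ≃ₐ[k] A} (hσ : ∀ a b, φ (a * b) = φ (b * σ a)) {f g : A}
    (hf : IsIdempotentElem f) (hg : IsIdempotentElem g) :
    cornerDim k f g ≤ cornerDim k g (σ f) := by
  set X := LinearMap.range (LinearMap.mulLeft k f ∘ₗ LinearMap.mulRight k g) with hX
  set Y := LinearMap.range (LinearMap.mulLeft k g ∘ₗ LinearMap.mulRight k (σ f)) with hY
  let F : X →ₗ[k] Module.Dual k Y :=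
    Y.dualRestrict ∘ₗ ((LinearMap.mul k A).compr₂ φ) ∘ₗ X.subtype
  have hF : Function.Injective F := by
    rw [injective_iff_map_eq_zero]
    rintro ⟨_, z, rfl⟩ hx
    set x := (LinearMap.mulLeft k f ∘ₗ LinearMap.mulRight k g) z with hxdef
    have hfx : f * x = x := by simp [hxdef, ← mul_assoc, hf.eq]
    have hxg : x * g = x := by simp [hxdef, mul_assoc, hg.eq]
    have h0 : ∀ y : Y, φ (x * y) = 0 := fun y => LinearMap.congr_fun hx y
    have hx0 : ∀ a, φ (x * a) = 0 := by
      intro a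
      have h1 : x * a = f * (x * a) := by rw [← mul_assoc, hfx]
      rw [h1, hσ]
      have h2 : x * a * σ f = x * (g * (a * σ f)) := by
        rw [← mul_assoc x g, hxg, mul_assoc]
      rw [h2]
      exact h0 ⟨_, a, rfl⟩
    have : ∀ a, φ (a * σ x) = 0 := fun a => by rw [← hσ, hx0]
    have h3 := hφ _ this
    rw [EmbeddingLike.map_eq_zero_iff] at h3
    exact Subtype.ext h3
  calc cornerDim k f g = Module.finrank k X := rfl
    _ ≤ Module.finrank k (Module.Dual k Y) := LinearMap.finrank_le_finrank_of_injective hF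
    _ = cornerDim k g (σ f) := Subspace.dual_finrank_eq

theorem cornerDim_eq_of_nakayama {φ : A →ₗ[k] k} (hφ : ∀ x, (∀ a, φ (a * x) = 0) → x = 0)
    {σ : A ≃ₐ[k] A} (hσ : ∀ a b, φ (a * b) = φ (b * σ a)) {f g : A}
    (hf : IsIdempotentElem f) (hg : IsIdempotentElem g) :
    cornerDim k f g = cornerDim k g (σ f) :=
  le_antisymm (cornerDim_le_of_nakayama hφ hσ hf hg)
    ((cornerDim_le_of_nakayama hφ hσ hg (hf.map σ)).trans_eq (cornerDim_map σ f g))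

end

namespace SplitSystem

variable {k A : Type*} [Field k] [Ring A] [Algebra k A] [FiniteDimensional k A]
  (S : SplitSystem k A) {φ : A →ₗ[k] k} {σ : A ≃ₐ[k] A}

theorem cartan_nakayama (hφ : ∀ x, (∀ a, φ (a * x) = 0) → x = 0)
    (hσ : ∀ a b, φ (a * b) = φ (b * σ a)) (i j : Fin S.n) :
    S.cartan i j = S.cartan j ((S.perm σ)⁻¹ i) := by
  rw [cartan, cornerDim_eq_of_nakayama hφ hσ (S.hasType_E i).idem (S.hasType_E j).idem]
  refine (S.hasType_E j).cornerDim_eq (S.hasType_E j) (HasType.map ?_) (S.hasType_E _)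
  simpa using S.hasType_E i

theorem hasType_symm (j : Fin S.n) : S.HasType (σ.symm (S.E j)) (S.perm σ j) := by
  refine HasType.map (τ := σ.symm) ?_
  have : S.perm σ.symm (S.perm σ j) = j := by
    have h := S.perm_mul σ σ.symm
    rw [show σ * σ.symm = 1 from mul_inv_cancel σ, perm_one] at h
    exact (Equiv.Perm.ext_iff.1 h j).symm
  rw [this]
  exact S.hasType_E j

variable {S}

omit [FiniteDimensional k A] in
theorem mul_eq_of_mem_span {x e : A} (he : IsIdempotentElem e) (hx : x ∈ Ideal.span {e}) :
    x * e = x := by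
  obtain ⟨a, rfl⟩ := Ideal.mem_span_singleton'.1 hx
  rw [mul_assoc, he.eq]

/-- For `y ∈ N` with `φ y ≠ 0` one has `φ y = φ(y E_j) = φ(σ⁻¹(E_j) y)`, so `σ⁻¹(E_j) y ≠ 0`; the
idempotent `σ⁻¹(E_j)` belongs to the block `S.perm σ j`, which thus plays the role of the socle. -/
theorem idealMult_soc_pos (hφ : ∀ x, (∀ a, φ (a * x) = 0) → x = 0)
    (hσ : ∀ a b, φ (a * b) = φ (b * σ a)) {j : Fin S.n} {N : Submodule A A}
    (hN : N ≤ Ideal.span {S.E j}) (hne : N ≠ ⊥) :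
    0 < idealMult k (S.E (S.perm σ j)) N := by
  obtain ⟨x, hx, hx0⟩ := N.ne_bot_iff.1 hne
  obtain ⟨a, ha⟩ : ∃ a, φ (a * x) ≠ 0 := by
    by_contra! hc
    exact hx0 (hφ x hc)
  have hy : a * x ∈ N := N.smul_mem a hx
  have hyE := mul_eq_of_mem_span (S.hasType_E j).idem (hN hy)
  rw [(S.hasType_E _).idealMult_eq (S.hasType_symm (σ := σ) j)]
  refine idealMult_pos hy fun h0 => ha ?_
  have := hσ (σ.symm (S.E j)) (a * x)
  rwa [h0, map_zero, AlgEquiv.apply_symm_apply, hyE, eq_comm] at this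

variable (S)

/-- The radical of the `j`-th indecomposable projective. -/
def rad (j : Fin S.n) : Submodule A A := Ideal.span {S.E j} ⊓ Ring.jacobson A

variable {S}

omit [FiniteDimensional k A] in
theorem cartan_eq_idealMult (i j : Fin S.n) :
    S.cartan i j = idealMult k (S.E i) (Ideal.span {S.E j}) := (idealMult_span _ _).symm

omit [FiniteDimensional k A] in
theorem E_not_mem_jacobson (j : Fin S.n) : S.E j ∉ Ring.jacobson A := fun h =>
  (S.hasType_E j).ne_zero (by rw [(S.π_eq_zero _).2 h]; rfl)

theorem idealMult_rad_lt (j : Fin S.n) : idealMult k (S.E j) (S.rad j) < S.cartan j j := by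
  rw [cartan_eq_idealMult]
  refine idealMult_lt (x := S.E j) inf_le_left (Ideal.mem_span_singleton_self _) fun h => ?_
  rw [(S.hasType_E j).idem.eq] at h
  exact E_not_mem_jacobson j h.2

omit [FiniteDimensional k A] in
theorem E_mul_mul_E_mem_rad {i j : Fin S.n} (hij : i ≠ j) (x : A) :
    S.E i * (x * S.E j) ∈ S.rad j := by
  refine ⟨Ideal.mul_mem_left _ _ (Ideal.mul_mem_left _ _ (Ideal.mem_span_singleton_self _)), ?_⟩
  refine (S.π_eq_zero _).1 ?_
  funext m
  by_cases hm : m = i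
  · subst hm
    simp [(S.hasType_E j).eq_zero m hij]
  · simp [(S.hasType_E i).eq_zero m hm]

omit [FiniteDimensional k A] in
theorem exists_E_mul_mul_E_sub_mem_rad (j : Fin S.n) (x : A) :
    ∃ c : k, S.E j * x * S.E j - c • S.E j ∈ S.rad j := by
  obtain ⟨c, hc⟩ := (S.hasType_E j).corner x
  have h1 : S.E j ∈ Ideal.span {S.E j} := Ideal.mem_span_singleton_self _
  refine ⟨c, sub_mem (Ideal.mul_mem_left _ _ h1) ?_, ?_⟩
  · rw [Algebra.smul_def]; exact Ideal.mul_mem_left _ _ h1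
  · refine (S.π_eq_zero _).1 ?_
    funext m
    rw [map_sub, Pi.sub_apply, map_smul, Pi.smul_apply]
    by_cases hm : m = j
    · subst hm
      rw [hc, sub_self]; rfl
    · simp [(S.hasType_E j).eq_zero m hm]

/-- If the radical of the projective is nonzero, it contains the socle constituent `S.perm σ j`;
together with the top this gives two constituents of dimension `d j`. -/
theorem cartan_eq_one_or_two_le (hφ : ∀ x, (∀ a, φ (a * x) = 0) → x = 0)
    (hσ : ∀ a b, φ (a * b) = φ (b * σ a)) (j : Fin S.n) :
    (S.rad j = ⊥ ∧ ∀ i, S.cartan i j = if i = j then 1 else 0) ∨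
      2 ≤ ∑ i with S.d i = S.d j, S.cartan i j := by
  by_cases hR : S.rad j = ⊥
  · refine Or.inl ⟨hR, fun i => ?_⟩
    split_ifs with hij
    · subst hij
      have : LinearMap.range (LinearMap.mulLeft k (S.E i) ∘ₗ LinearMap.mulRight k (S.E i)) =
          Submodule.span k {S.E i} := by
        apply le_antisymm
        · rintro _ ⟨x, rfl⟩
          obtain ⟨c, hc⟩ := exists_E_mul_mul_E_sub_mem_rad i x
          rw [hR, Submodule.mem_bot, sub_eq_zero] at hc
          rw [Submodule.mem_span_singleton]
          exact ⟨c, by simp [← hc, mul_assoc]⟩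
        · rw [Submodule.span_singleton_le_iff_mem]
          exact ⟨1, by simp [(S.hasType_E i).idem.eq]⟩
      rw [cartan, cornerDim, this]
      refine finrank_span_singleton fun h => ?_
      exact (S.hasType_E i).ne_zero (by rw [h, map_zero]; rfl)
    · have : LinearMap.mulLeft k (S.E i) ∘ₗ LinearMap.mulRight k (S.E j) = 0 := by
        ext x
        have := E_mul_mul_E_mem_rad hij x
        rwa [hR, Submodule.mem_bot] at this
      rw [cartan, cornerDim, this, LinearMap.range_zero, finrank_bot]
  · right
    have h1 := idealMult_soc_pos (k := k) hφ hσ (j := j) inf_le_left hR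
    change 0 < idealMult k (S.E (S.perm σ j)) (S.rad j) at h1
    have h2 := idealMult_rad_lt j
    by_cases hs : S.perm σ j = j
    · rw [hs] at h1
      calc 2 ≤ S.cartan j j := by omega
        _ ≤ _ := Finset.single_le_sum (f := fun i => S.cartan i j) (fun _ _ => Nat.zero_le _)
          (by simp)
    · have h3 : idealMult k (S.E (S.perm σ j)) (S.rad j) ≤ S.cartan (S.perm σ j) j := by
        rw [cartan_eq_idealMult]
        exact idealMult_mono _ inf_le_left
      calc 2 ≤ S.cartan (S.perm σ j) j + S.cartan j j := by omega
        _ = ∑ i ∈ {S.perm σ j, j}, S.cartan i j := by rw [Finset.sum_pair hs]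
        _ ≤ _ := Finset.sum_le_sum_of_subset (by
          intro i hi
          rcases Finset.mem_insert.1 hi with rfl | hi
          · simp [S.d_perm]
          · simp [Finset.mem_singleton.1 hi])

/-! ### One-dimensional blocks -/

omit [FiniteDimensional k A] in
theorem exists_char {l : Fin S.n} (h : S.d l = 1) :
    ∃ χ : A →ₐ[k] k, ∀ a, χ a = 0 ↔ S.π a l = 0 := by
  have : Subsingleton (Fin (S.d l)) := by rw [h]; infer_instance
  let o : Fin (S.d l) := ⟨0, S.d_pos l⟩
  let f : A →ₗ[k] k := (Matrix.entryLinearMap k k o o) ∘ₗ (S.proj l).toLinearMap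
  have hf : ∀ a, f a = S.π a l o o := fun a => rfl
  refine ⟨AlgHom.ofLinearMap f (by simp [hf]) fun a b => ?_, fun a => ?_⟩
  · rw [hf, map_mul, Pi.mul_apply, Matrix.mul_apply, Fintype.sum_subsingleton _ o]; rfl
  · change f a = 0 ↔ _
    rw [hf]
    refine ⟨fun h => ?_, fun h => by rw [h]; rfl⟩
    ext x y
    rw [Subsingleton.elim x o, Subsingleton.elim y o, h]; rfl

section

variable {l : Fin S.n} {χ : A →ₐ[k] k} (hχ : ∀ a, χ a = 0 ↔ S.π a l = 0)

include hχ

omit [FiniteDimensional k A] in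
theorem π_eq_algebraMap (a : A) : S.π a l = algebraMap k _ (χ a) := by
  have := (hχ (a - algebraMap k A (χ a))).1 (by simp)
  rw [map_sub, Pi.sub_apply, sub_eq_zero] at this
  rw [this, AlgHom.commutes]
  rfl

omit [FiniteDimensional k A] in
theorem sub_mul_mem_jacobson {f : A} (hf : S.HasType f l) (a : A) :
    a * f - χ a • f ∈ Ring.jacobson A := by
  refine (S.π_eq_zero _).1 ?_
  funext m
  rw [map_sub, map_mul, map_smul, Pi.sub_apply, Pi.mul_apply, Pi.smul_apply]
  by_cases hm : m = l
  · subst hm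
    rw [π_eq_algebraMap hχ a, Algebra.smul_def, sub_self]; rfl
  · simp [hf.eq_zero m hm]

omit [FiniteDimensional k A] in
theorem mul_sub_mem_jacobson {f : A} (hf : S.HasType f l) (a : A) :
    f * a - χ a • f ∈ Ring.jacobson A := by
  refine (S.π_eq_zero _).1 ?_
  funext m
  rw [map_sub, map_mul, map_smul, Pi.sub_apply, Pi.mul_apply, Pi.smul_apply]
  by_cases hm : m = l
  · subst hm
    rw [π_eq_algebraMap hχ a, ← Algebra.commutes, Algebra.smul_def, sub_self]; rfl
  · simp [hf.eq_zero m hm]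

omit [FiniteDimensional k A] in
theorem char_ext {χ' : A →ₐ[k] k} (hχ' : ∀ a, χ' a = 0 ↔ S.π a l = 0) : χ = χ' := by
  ext a
  have := (hχ' (a - algebraMap k A (χ a))).2 ((hχ _).1 (by simp))
  rw [map_sub, AlgHom.commutes, sub_eq_zero] at this
  exact this.symm

end

theorem exists_index (S : SplitSystem k A) (χ : A →ₐ[k] k) :
    ∃ l, ∀ a, χ a = 0 ↔ S.π a l = 0 :=
  S.exists_ker_eq (q := χ) fun c => ⟨algebraMap k A c, by simp⟩

end SplitSystem

end BlockSystem

/-! ### Split extensions of linear modules and Loewy layers -/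

namespace BlockSystem

section

variable {k A : Type*} [Field k] [Ring A] [Algebra k A]

/-- Extensions between one-dimensional modules split: every derivation of `A` with values in a
one-dimensional bimodule is inner. -/
def SplitsCharExtensions (k A : Type*) [Field k] [Ring A] [Algebra k A] : Prop :=
  ∀ (χ ψ : A →ₐ[k] k) (β : A →ₗ[k] k), (∀ a b, β (a * b) = β a * χ b + ψ a * β b) →
    ∃ c : k, ∀ a, β a = c * (ψ a - χ a)

/-- Nakayama's lemma applied to the image of `N` modulo `W`. -/
theorem le_of_le_sup_jacobson_smul [FiniteDimensional k A] {N W : Submodule A A}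
    (h : N ≤ W ⊔ Ring.jacobson A • N) : N ≤ W := by
  have : IsArtinianRing A := IsArtinianRing.of_finite k A
  have hfg : (N.map W.mkQ).FG := (IsNoetherian.noetherian N).map _
  have hle : N.map W.mkQ ≤ Ring.jacobson A • N.map W.mkQ := by
    rw [← Submodule.map_smul'']
    refine (Submodule.map_mono h).trans ?_
    rw [Submodule.map_sup, Submodule.mkQ_map_self, bot_sup_eq]
  have := Submodule.FG.eq_bot_of_le_jacobson_smul hfg hle
  intro x hx
  have hx' := Submodule.mem_map_of_mem (f := W.mkQ) hx
  rwa [this, Submodule.mem_bot, Submodule.mkQ_apply, Submodule.Quotient.mk_eq_zero] at hx'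

@[simp] theorem idealMult_bot (f : A) : idealMult k f (⊥ : Submodule A A) = 0 := by
  have : (((⊥ : Submodule A A).restrictScalars k).map (LinearMap.mulLeft k f)) = ⊥ := by
    rw [Submodule.restrictScalars_bot, Submodule.map_bot]
  rw [idealMult, this, finrank_bot]

/-- Rank–nullity for right multiplication by `r` on `f N`. -/
theorem idealMult_ker_add_map_le [FiniteDimensional k A] (f r : A) (N : Submodule A A) :
    idealMult k f (N ⊓ LinearMap.ker (LinearMap.toSpanSingleton A A r)) +
      idealMult k f (N.map (LinearMap.toSpanSingleton A A r)) ≤ idealMult k f N := by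
  set V := (N.restrictScalars k).map (LinearMap.mulLeft k f) with hV
  let F : V →ₗ[k] A := (LinearMap.mulRight k r).domRestrict V
  have hr : LinearMap.range F = ((N.map (LinearMap.toSpanSingleton A A r)).restrictScalars k).map
      (LinearMap.mulLeft k f) := by
    rw [LinearMap.range_domRestrict]
    ext x
    simp only [hV, Submodule.mem_map, Submodule.restrictScalars_mem, LinearMap.mulLeft_apply,
      LinearMap.mulRight_apply, LinearMap.toSpanSingleton_apply, smul_eq_mul]
    constructor
    · rintro ⟨_, ⟨z, hz, rfl⟩, rfl⟩
      exact ⟨z * r, ⟨z, hz, rfl⟩, (mul_assoc _ _ _).symm⟩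
    · rintro ⟨_, ⟨z, hz, rfl⟩, rfl⟩
      exact ⟨f * z, ⟨z, hz, rfl⟩, mul_assoc _ _ _⟩
  have hk : (((N ⊓ LinearMap.ker (LinearMap.toSpanSingleton A A r)).restrictScalars k).map
      (LinearMap.mulLeft k f)) ≤ (LinearMap.ker F).map V.subtype := by
    rintro _ ⟨z, ⟨hz, hz0⟩, rfl⟩
    have hz0' : z * r = 0 := hz0
    exact ⟨⟨f * z, z, hz, rfl⟩, by
      change f * z * r = 0
      rw [mul_assoc, hz0', mul_zero], rfl⟩
  have h1 := LinearMap.finrank_range_add_finrank_ker F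
  rw [hr] at h1
  have h2 := Submodule.finrank_mono hk
  rw [Submodule.finrank_map_subtype_eq] at h2
  change _ + _ ≤ Module.finrank k V
  rw [idealMult, idealMult]
  omega

end

namespace SplitSystem

variable {k A : Type*} [Field k] [Ring A] [Algebra k A] [FiniteDimensional k A]
  {S : SplitSystem k A} {φ : A →ₗ[k] k} {σ : A ≃ₐ[k] A}

omit [FiniteDimensional k A] in
/-- There is no one-dimensional constituent in the top of the radical of a one-dimensional block. -/
theorem mul_mem_jacobson_smul_rad (hExt : SplitsCharExtensions k A) {j l : Fin S.n}
    {χ ψ : A →ₐ[k] k} (hχ : ∀ a, χ a = 0 ↔ S.π a j = 0) (hψ : ∀ a, ψ a = 0 ↔ S.π a l = 0)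
    {r : A} (hr : r ∈ S.rad j) : S.E l * r ∈ Ring.jacobson A • S.rad j := by
  by_contra hc
  obtain ⟨γ, hγ, hγ0⟩ := Submodule.exists_le_ker_of_notMem
    (p := (Ring.jacobson A • S.rad j).restrictScalars k) (v := S.E l * r) hc
  have hγ0 : ∀ x ∈ Ring.jacobson A • S.rad j, γ x = 0 := fun x hx => hγ0 hx
  have hE := S.hasType_E j
  have hmul : ∀ x ∈ S.rad j, ∀ a, γ (S.E l * (a * x)) = ψ a * γ (S.E l * x) := by
    intro x hx a
    have := hγ0 _ (Submodule.smul_mem_smul (mul_sub_mem_jacobson hψ (S.hasType_E l) a) hx)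
    rw [smul_eq_mul, sub_mul, map_sub, sub_eq_zero, smul_mul_assoc, map_smul, smul_eq_mul] at this
    rw [← this, mul_assoc]
  -- `β` measures how far `E_j` is from being an eigenvector modulo `J · rad`. It is a derivation,
  -- hence inner, hence zero on `rad`, where both characters vanish; but there `β` is `γ(E_l ·)`,
  -- which is nonzero at `r`.
  let β : A →ₗ[k] k := γ ∘ₗ LinearMap.mulLeft k (S.E l) ∘ₗ
    (LinearMap.mulRight k (S.E j) - χ.toLinearMap.smulRight (S.E j))
  have hβ : ∀ a, β a = γ (S.E l * (a * S.E j - χ a • S.E j)) := fun a => rfl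
  have hmem : ∀ a, a * S.E j - χ a • S.E j ∈ S.rad j := by
    intro a
    refine ⟨?_, sub_mul_mem_jacobson hχ hE a⟩
    rw [← smul_one_mul (χ a), ← sub_mul]
    exact Ideal.mul_mem_left _ _ (Ideal.mem_span_singleton_self _)
  obtain ⟨c, hc⟩ := hExt χ ψ β fun a b => by
    have : S.E l * (a * b * S.E j - χ (a * b) • S.E j) =
        χ b • (S.E l * (a * S.E j - χ a • S.E j)) +
          S.E l * (a * (b * S.E j - χ b • S.E j)) := by
      rw [← mul_smul_comm, ← mul_add, mul_sub a, smul_sub, smul_smul, mul_smul_comm,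
        mul_comm (χ b), mul_assoc, map_mul]
      congr 1
      abel
    rw [hβ, hβ b, ← hmul _ (hmem b), hβ, this, map_add, map_smul, smul_eq_mul, mul_comm]
  have h0 : ∀ x ∈ S.rad j, γ (S.E l * x) = 0 := by
    intro x hx
    have hx0 : S.π x = 0 := (S.π_eq_zero x).2 hx.2
    have h1 : χ x = 0 := (hχ x).2 (by rw [hx0]; rfl)
    have h2 : ψ x = 0 := (hψ x).2 (by rw [hx0]; rfl)
    have := hc x
    rwa [hβ, mul_eq_of_mem_span hE.idem hx.1, h1, h2, zero_smul, sub_zero, sub_self,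
      mul_zero] at this
  exact hγ (h0 r hr)

omit [FiniteDimensional k A] in
theorem apply_eq_zero_of_eigen (hφ : ∀ x, (∀ a, φ (a * x) = 0) → x = 0) {χ : A →ₐ[k] k} {z : A}
    (hz : ∀ a, a * z = χ a • z) (h : φ z = 0) : z = 0 :=
  hφ z fun a => by rw [hz, map_smul, h, smul_zero]

/-- The characters occurring in the socle of the `j`-th indecomposable projective. -/
theorem index_of_eigen (hφ : ∀ x, (∀ a, φ (a * x) = 0) → x = 0)
    (hσ : ∀ a b, φ (a * b) = φ (b * σ a)) {j l : Fin S.n} {χ : A →ₐ[k] k}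
    (hχ : ∀ a, χ a = 0 ↔ S.π a l = 0) {z : A} (hzj : z ∈ Ideal.span {S.E j})
    (hz : ∀ a, a * z = χ a • z) (hz0 : z ≠ 0) : l = S.perm σ j := by
  by_contra hl
  have h1 : χ (σ.symm (S.E j)) = 0 := (hχ _).2 ((S.hasType_symm (σ := σ) j).eq_zero l hl)
  have := hσ (σ.symm (S.E j)) z
  rw [hz, h1, zero_smul, map_zero, AlgEquiv.apply_symm_apply,
    mul_eq_of_mem_span (S.hasType_E j).idem hzj] at this
  exact hz0 (apply_eq_zero_of_eigen hφ hz this.symm)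

/-- Both eigenvectors lie in the block `S.perm σ j`, so they have the same character; `φ` vanishes
on no nonzero eigenvector, so a combination killed by `φ` is zero. -/
theorem mem_span_of_eigen (hφ : ∀ x, (∀ a, φ (a * x) = 0) → x = 0)
    (hσ : ∀ a b, φ (a * b) = φ (b * σ a)) {j : Fin S.n} {χ ψ : A →ₐ[k] k} {z w : A}
    (hzj : z ∈ Ideal.span {S.E j}) (hwj : w ∈ Ideal.span {S.E j})
    (hz : ∀ a, a * z = χ a • z) (hw : ∀ a, a * w = ψ a • w) (hw0 : w ≠ 0) :
    z ∈ Submodule.span k {w} := by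
  rcases eq_or_ne z 0 with rfl | hz0
  · exact zero_mem _
  obtain ⟨l, hl⟩ := S.exists_index χ
  obtain ⟨m, hm⟩ := S.exists_index ψ
  have h1 := index_of_eigen hφ hσ hl hzj hz hz0
  have h2 := index_of_eigen hφ hσ hm hwj hw hw0
  subst h1; subst h2
  obtain rfl := char_ext hl hm
  have hφw : φ w ≠ 0 := fun h => hw0 (apply_eq_zero_of_eigen hφ hw h)
  rw [Submodule.mem_span_singleton]
  refine ⟨φ z / φ w, ?_⟩
  rw [eq_comm, ← sub_eq_zero]
  refine apply_eq_zero_of_eigen hφ (χ := χ) (fun a => ?_) ?_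
  · rw [mul_sub, mul_smul_comm, hz, hw, smul_sub, smul_comm]
  · rw [map_sub, map_smul, smul_eq_mul, div_mul_cancel₀ _ hφw, sub_self]

/-- There is no one-dimensional constituent on top of a one-dimensional socle. -/
theorem mem_span_of_jacobson_mul_mem (hExt : SplitsCharExtensions k A)
    (hφ : ∀ x, (∀ a, φ (a * x) = 0) → x = 0)
    (hσ : ∀ a b, φ (a * b) = φ (b * σ a)) {j l : Fin S.n} {χ ψ : A →ₐ[k] k}
    (hχ : ∀ a, χ a = 0 ↔ S.π a l = 0) {f n w : A} (hf : S.HasType f l)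
    (hnj : n ∈ Ideal.span {S.E j}) (hwj : w ∈ Ideal.span {S.E j}) (hfn : f * n = n)
    (hw : ∀ a, a * w = ψ a • w) (hw0 : w ≠ 0)
    (hJ : ∀ x ∈ Ring.jacobson A, x * n ∈ Submodule.span k {w}) : n ∈ Submodule.span k {w} := by
  have h1 : ∀ a, a * n - χ a • n ∈ Submodule.span k {w} := by
    intro a
    have := hJ _ (sub_mul_mem_jacobson hχ hf a)
    rwa [sub_mul, mul_assoc, hfn, smul_mul_assoc, hfn] at this
  obtain ⟨g, hg⟩ : ∃ g : A →ₗ[k] k, g w = 1 := by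
    obtain ⟨g, hg⟩ := (Module.forall_dual_apply_eq_zero_iff k w).not.2 hw0 |> not_forall.1
    exact ⟨(g w)⁻¹ • g, inv_mul_cancel₀ hg⟩
  -- `n` and `w` span an extension of two characters with cocycle `β`. Splitting it corrects `n` by
  -- a multiple of `w` to an eigenvector, which must again lie on the line of `w`.
  let β : A →ₗ[k] k := g ∘ₗ (LinearMap.mulRight k n - χ.toLinearMap.smulRight n)
  have hβ : ∀ a, a * n - χ a • n = β a • w := by
    intro a
    obtain ⟨c, hc⟩ := Submodule.mem_span_singleton.1 (h1 a)
    have : β a = c := by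
      change g (a * n - χ a • n) = c
      rw [← hc, map_smul, hg, smul_eq_mul, mul_one]
    rw [this, hc]
  have hβ' : ∀ a, a * n = χ a • n + β a • w := fun a => by rw [← hβ]; abel
  obtain ⟨c, hc⟩ := hExt χ ψ β fun a b => by
    have h2 : a * b * n = a * (b * n) := mul_assoc _ _ _
    rw [hβ', hβ' b, mul_add, mul_smul_comm, mul_smul_comm, hβ', hw, smul_add, smul_smul, smul_smul,
      smul_smul, map_mul, mul_comm (χ a), add_assoc, ← add_smul] at h2
    have h3 := smul_left_injective k hw0 (add_left_cancel h2)
    rw [h3]; ring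
  have h4 : ∀ a, a * (n - c • w) = χ a • (n - c • w) := by
    intro a
    rw [mul_sub, hβ', mul_smul_comm, hw, hc]
    module
  have h5 := mem_span_of_eigen hφ hσ (z := n - c • w)
    (sub_mem hnj (by rw [Algebra.smul_def]; exact Ideal.mul_mem_left _ _ hwj)) hwj h4 hw hw0
  have := add_mem h5 (Submodule.smul_mem _ c (Submodule.mem_span_singleton_self w))
  rwa [sub_add_cancel] at this

/-- Nonzero submodules of a one-dimensional block's projective contain an eigenvector. -/
theorem exists_eigen_mem (hφ : ∀ x, (∀ a, φ (a * x) = 0) → x = 0)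
    (hσ : ∀ a b, φ (a * b) = φ (b * σ a)) {j : Fin S.n} {χ : A →ₐ[k] k}
    (hχ : ∀ a, χ a = 0 ↔ S.π a (S.perm σ j) = 0) {N : Submodule A A}
    (hN : N ≤ Ideal.span {S.E j}) (hne : N ≠ ⊥) :
    ∃ w ∈ N, w ≠ 0 ∧ ∀ a, a * w = χ a • w := by
  have : IsArtinianRing A := IsArtinianRing.of_finite k A
  obtain ⟨L, hL, hLN⟩ := (eq_bot_or_exists_atom_le N).resolve_left hne
  have hJL : Ring.jacobson A • L = ⊥ :=
    hL.2 _ (Submodule.FG.jacobson_smul_lt hL.1 (IsNoetherian.noetherian L))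
  have hpos := idealMult_soc_pos (k := k) hφ hσ (hLN.trans hN) hL.1
  obtain ⟨x, hx, hx0⟩ : ∃ x ∈ L, S.E (S.perm σ j) * x ≠ 0 := by
    by_contra! hc
    rw [idealMult, Module.finrank_pos_iff_exists_ne_zero] at hpos
    obtain ⟨⟨_, z, hz, rfl⟩, h⟩ := hpos
    exact h (Subtype.ext (hc z hz))
  refine ⟨S.E (S.perm σ j) * x, hLN (L.smul_mem _ hx), hx0, fun a => ?_⟩
  have h1 := Submodule.smul_mem_smul (sub_mul_mem_jacobson hχ (S.hasType_E (S.perm σ j)) a) hx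
  rw [hJL, Submodule.mem_bot, smul_eq_mul, sub_mul, sub_eq_zero, mul_assoc, smul_mul_assoc] at h1
  exact h1

/-- The number of one-dimensional constituents of a left ideal. -/
noncomputable def linearMult (S : SplitSystem k A) (N : Submodule A A) : ℕ :=
  ∑ l with S.d l = 1, idealMult k (S.E l) N

/-- The number of constituents of dimension at least two of a left ideal. -/
noncomputable def nonlinearMult (S : SplitSystem k A) (N : Submodule A A) : ℕ :=
  ∑ l with 1 < S.d l, idealMult k (S.E l) N

omit [FiniteDimensional k A] in
theorem exists_mul_notMem {x : A} {N : Submodule A A} (hx : x ∉ N) : ∃ s, S.e s * x ∉ N := by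
  by_contra! hc
  refine hx ?_
  rw [← one_mul x, ← S.coi.complete, Finset.sum_mul]
  exact sum_mem fun s _ => hc s

/-- The top of the radical is nonzero by Nakayama's lemma and contains no linear module by
`mul_mem_jacobson_smul_rad`. -/
theorem exists_nonlinear_top (hExt : SplitsCharExtensions k A) {j : Fin S.n} (hj : S.d j = 1)
    (hR : S.rad j ≠ ⊥) : ∃ l, 1 < S.d l ∧
      idealMult k (S.E l) (Ring.jacobson A • S.rad j) < idealMult k (S.E l) (S.rad j) ∧
      ∃ r ∈ S.rad j, S.E l * r ∉ Ring.jacobson A • S.rad j := by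
  have : IsArtinianRing A := IsArtinianRing.of_finite k A
  have hlt := Submodule.FG.jacobson_smul_lt hR (IsNoetherian.noetherian _)
  obtain ⟨x, hx, hxJ⟩ := SetLike.exists_of_lt hlt
  obtain ⟨s, hs⟩ := exists_mul_notMem (S := S) hxJ
  have h1 : idealMult k (S.E s.1) (Ring.jacobson A • S.rad j) <
      idealMult k (S.E s.1) (S.rad j) := by
    rw [← (S.hasType_e s).idealMult_eq (S.hasType_E s.1),
      ← (S.hasType_e s).idealMult_eq (S.hasType_E s.1)]
    exact idealMult_lt hlt.le hx hs
  have h2 : ∃ r ∈ S.rad j, S.E s.1 * r ∉ Ring.jacobson A • S.rad j := by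
    by_contra! hc
    refine absurd h1 (not_lt.2 (Submodule.finrank_mono ?_))
    rintro _ ⟨z, hz, rfl⟩
    exact ⟨S.E s.1 * z, hc z hz, by simp [← mul_assoc, (S.hasType_E s.1).idem.eq]⟩
  refine ⟨s.1, ?_, h1, h2⟩
  obtain ⟨r, hr, hr'⟩ := h2
  have h0 := S.d_pos s.1
  by_contra hd
  obtain ⟨χ, hχ⟩ := exists_char hj
  obtain ⟨ψ, hψ⟩ := exists_char (S := S) (l := s.1) (by omega)
  exact hr' (mul_mem_jacobson_smul_rad hExt hχ hψ hr)

theorem linearMult_rad_le (hExt : SplitsCharExtensions k A) {j : Fin S.n} (hj : S.d j = 1) :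
    S.linearMult (S.rad j) ≤ S.linearMult (Ring.jacobson A • S.rad j) := by
  refine Finset.sum_le_sum fun l hl => Submodule.finrank_mono ?_
  rintro _ ⟨z, hz, rfl⟩
  obtain ⟨χ, hχ⟩ := exists_char hj
  obtain ⟨ψ, hψ⟩ := exists_char (S := S) (l := l) (Finset.mem_filter.1 hl).2
  exact ⟨S.E l * z, mul_mem_jacobson_smul_rad hExt hχ hψ hz,
    by simp [← mul_assoc, (S.hasType_E l).idem.eq]⟩

theorem nonlinearMult_lt (hExt : SplitsCharExtensions k A) {j : Fin S.n} (hj : S.d j = 1)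
    (hR : S.rad j ≠ ⊥) :
    S.nonlinearMult (Ring.jacobson A • S.rad j) < S.nonlinearMult (S.rad j) := by
  obtain ⟨l, hl, hlt, -⟩ := exists_nonlinear_top hExt hj hR
  exact Finset.sum_lt_sum (fun m _ => idealMult_mono _ Submodule.smul_le_right)
    ⟨l, by simpa using hl, hlt⟩

theorem cartan_le_idealMult_rad_add (l j : Fin S.n) :
    S.cartan l j ≤ idealMult k (S.E l) (S.rad j) + if l = j then 1 else 0 := by
  rw [cartan, cornerDim]
  split_ifs with h
  · subst h
    have hle : LinearMap.range (LinearMap.mulLeft k (S.E l) ∘ₗ LinearMap.mulRight k (S.E l)) ≤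
        ((S.rad l).restrictScalars k).map (LinearMap.mulLeft k (S.E l)) ⊔
          Submodule.span k {S.E l} := by
      rintro _ ⟨x, rfl⟩
      obtain ⟨c, hc⟩ := exists_E_mul_mul_E_sub_mem_rad l x
      refine Submodule.mem_sup.2 ⟨S.E l * (S.E l * x * S.E l - c • S.E l), ⟨_, hc, rfl⟩,
        c • S.E l, Submodule.smul_mem _ _ (Submodule.mem_span_singleton_self _), ?_⟩
      simp [mul_sub, ← mul_assoc, (S.hasType_E l).idem.eq]
    refine (Submodule.finrank_mono hle).trans ((Submodule.finrank_add_le_finrank_add_finrank _ _).trans ?_)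
    exact Nat.add_le_add_left (finrank_span_le_card _ |>.trans (by simp)) _
  · refine Submodule.finrank_mono ?_
    rintro _ ⟨x, rfl⟩
    exact ⟨_, E_mul_mul_E_mem_rad h x, by simp [← mul_assoc, (S.hasType_E l).idem.eq]⟩

theorem linear_cartan_le (j : Fin S.n) :
    ∑ l with S.d l = 1, S.cartan l j ≤ S.linearMult (S.rad j) + 1 := by
  refine (Finset.sum_le_sum fun l _ => cartan_le_idealMult_rad_add l j).trans ?_
  rw [Finset.sum_add_distrib]
  refine Nat.add_le_add_left ?_ _
  rw [Finset.sum_ite_eq']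
  split_ifs <;> simp

theorem nonlinearMult_rad_le (j : Fin S.n) :
    S.nonlinearMult (S.rad j) ≤ ∑ l with 1 < S.d l, S.cartan l j :=
  Finset.sum_le_sum fun l _ => by
    rw [cartan_eq_idealMult]; exact idealMult_mono _ inf_le_left

theorem one_le_nonlinear (hExt : SplitsCharExtensions k A) {j : Fin S.n} (hj : S.d j = 1)
    (hR : S.rad j ≠ ⊥) : 1 ≤ ∑ l with 1 < S.d l, S.cartan l j :=
  (Nat.succ_le_of_lt ((Nat.zero_le _).trans_lt (nonlinearMult_lt hExt hj hR))).trans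
    (nonlinearMult_rad_le j)

theorem linearMult_span_le_one {l : Fin S.n} {χ : A →ₐ[k] k} (hχ : ∀ a, χ a = 0 ↔ S.π a l = 0)
    {w : A} (hw : ∀ a, a * w = χ a • w) : S.linearMult (Ideal.span {w}) ≤ 1 := by
  have hW : (Ideal.span {w} : Submodule A A).restrictScalars k ≤ Submodule.span k {w} := by
    intro x hx
    obtain ⟨a, rfl⟩ := Ideal.mem_span_singleton'.1 hx
    rw [hw]
    exact Submodule.smul_mem _ _ (Submodule.mem_span_singleton_self _)
  have h1 : ∀ m, idealMult k (S.E m) (Ideal.span {w}) ≤ if m = l then 1 else 0 := by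
    intro m
    split_ifs with h
    · exact (Submodule.finrank_map_le _ _).trans ((Submodule.finrank_mono hW).trans
        (finrank_span_le_card _ |>.trans (by simp)))
    · have : ((Ideal.span {w} : Submodule A A).restrictScalars k).map
          (LinearMap.mulLeft k (S.E m)) = ⊥ := by
        rw [eq_bot_iff]
        rintro _ ⟨x, hx, rfl⟩
        obtain ⟨c, rfl⟩ := Submodule.mem_span_singleton.1 (hW hx)
        have : χ (S.E m) = 0 := (hχ _).2 ((S.hasType_E m).eq_zero l (Ne.symm h))
        simp [hw, this]
      rw [idealMult, this, finrank_bot]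
  refine (Finset.sum_le_sum fun m _ => h1 m).trans ?_
  rw [Finset.sum_ite_eq']
  split_ifs <;> simp

/-- Of three linear constituents at most one is the top, so two survive in `J · rad`, because the
top of the radical has none. The socle line accounts for only one, so there is a layer directly
above it, and that layer cannot be linear. -/
theorem one_le_nonlinearMult_jacobson_smul_rad (hExt : SplitsCharExtensions k A)
    (hφ : ∀ x, (∀ a, φ (a * x) = 0) → x = 0)
    (hσ : ∀ a b, φ (a * b) = φ (b * σ a)) {j : Fin S.n} (hj : S.d j = 1)
    (hx : 3 ≤ ∑ l with S.d l = 1, S.cartan l j) :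
    1 ≤ S.nonlinearMult (Ring.jacobson A • S.rad j) := by
  have : IsArtinianRing A := IsArtinianRing.of_finite k A
  set N := Ring.jacobson A • S.rad j with hN
  have hNj : N ≤ Ideal.span {S.E j} := Submodule.smul_le_right.trans inf_le_left
  have hlin : 2 ≤ S.linearMult N := by
    have h1 := linear_cartan_le (S := S) j
    have h2 : _ ≤ S.linearMult N := linearMult_rad_le hExt hj
    omega
  have hNne : N ≠ ⊥ := by
    intro h
    rw [h] at hlin
    simp [linearMult] at hlin
  obtain ⟨χ, hχ⟩ := exists_char (S := S) (l := S.perm σ j) (by rw [S.d_perm, hj])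
  obtain ⟨w, hwN, hw0, hw⟩ := exists_eigen_mem hφ hσ hχ hNj hNne
  have hWN : Ideal.span {w} < N := by
    refine lt_of_le_of_ne ((Ideal.span_singleton_le_iff_mem _).2 hwN) fun h => ?_
    have := linearMult_span_le_one hχ hw
    rw [h] at this
    omega
  -- `N₁` is a minimal submodule above the socle line; Nakayama's lemma gives `J N₁ ≤ Ideal.span
  -- {w}`, as needed by `mem_span_of_jacobson_mul_mem`.
  obtain ⟨N₁, hcov, hN₁⟩ := exists_covBy_le_of_lt hWN
  have hJN₁ : Ring.jacobson A • N₁ ≤ Ideal.span {w} := by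
    rcases hcov.eq_or_eq (c := Ideal.span {w} ⊔ Ring.jacobson A • N₁) le_sup_left
      (sup_le hcov.le Submodule.smul_le_right) with h | h
    · exact le_sup_right.trans h.le
    · exact absurd (le_of_le_sup_jacobson_smul (k := k) h.ge) hcov.lt.not_ge
  obtain ⟨n, hn, hnW⟩ := SetLike.exists_of_lt hcov.lt
  obtain ⟨s, hs⟩ := exists_mul_notMem (S := S) hnW
  have hspan : ∀ x, x ∈ Submodule.span k {w} ↔ x ∈ Ideal.span {w} := by
    intro x
    rw [Submodule.mem_span_singleton, Ideal.mem_span_singleton']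
    constructor
    · rintro ⟨c, rfl⟩
      exact ⟨algebraMap k A c, (Algebra.smul_def _ _).symm⟩
    · rintro ⟨a, rfl⟩
      exact ⟨χ a, (hw a).symm⟩
  have hsN : S.e s * n ∈ N₁ := N₁.smul_mem _ hn
  have hd : S.d s.1 ≠ 1 := by
    intro hd
    obtain ⟨ψ, hψ⟩ := exists_char hd
    refine hs ((hspan _).1 (mem_span_of_jacobson_mul_mem hExt hφ hσ hψ (S.hasType_e s)
      (hNj (hN₁ hsN)) (hNj hwN) ?_ hw hw0 fun x hx => ?_))
    · rw [← mul_assoc, (S.coi.idem s).eq]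
    · exact (hspan _).2 (hJN₁ (Submodule.smul_mem_smul hx hsN))
  have hpos : 0 < idealMult k (S.E s.1) N := by
    rw [← (S.hasType_e s).idealMult_eq (S.hasType_E s.1)]
    refine idealMult_pos (hN₁ hn) fun h => hs ?_
    rw [h]; exact zero_mem _
  have h0 := S.d_pos s.1
  exact hpos.trans_le (Finset.single_le_sum (f := fun l => idealMult k (S.E l) N)
    (fun _ _ => Nat.zero_le _) (by simp; omega))

/-- Loewy structure of a one-dimensional block's projective with at least three one-dimensional
constituents. -/
theorem two_le_nonlinear (hExt : SplitsCharExtensions k A)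
    (hφ : ∀ x, (∀ a, φ (a * x) = 0) → x = 0)
    (hσ : ∀ a b, φ (a * b) = φ (b * σ a)) {j : Fin S.n} (hj : S.d j = 1) (hR : S.rad j ≠ ⊥)
    (hx : 3 ≤ ∑ l with S.d l = 1, S.cartan l j) :
    2 ≤ ∑ l with 1 < S.d l, S.cartan l j ∧
      (∑ l with 1 < S.d l, S.cartan l j = 2 →
        ∃ l, 1 < S.d l ∧ 1 ≤ S.cartan l j ∧ 3 ≤ ∑ m with 1 < S.d m, S.cartan m l) := by
  have hJR := one_le_nonlinearMult_jacobson_smul_rad hExt hφ hσ hj hx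
  have hlt := nonlinearMult_lt hExt hj hR
  have hle := nonlinearMult_rad_le (S := S) j
  refine ⟨by omega, fun h2 => ?_⟩
  obtain ⟨l, hl, hlt', r, hr, hrJ⟩ := exists_nonlinear_top hExt hj hR
  have hmono : ∀ m, idealMult k (S.E m) (Ring.jacobson A • S.rad j) ≤
      idealMult k (S.E m) (S.rad j) := fun m => idealMult_mono _ Submodule.smul_le_right
  -- With exactly two nonlinear constituents, one in `J · rad`, only one is left for the top of
  -- `rad`: that top is the single simple module `l`.
  have hkey : ∀ m, idealMult k (S.E m) (S.rad j) ≤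
      idealMult k (S.E m) (Ring.jacobson A • S.rad j) + if m = l then 1 else 0 := by
    intro m
    by_cases hm : S.d m = 1
    · refine le_trans (Submodule.finrank_mono ?_) (Nat.le_add_right _ _)
      rintro _ ⟨z, hz, rfl⟩
      obtain ⟨χ, hχ⟩ := exists_char hj
      obtain ⟨ψ, hψ⟩ := exists_char hm
      exact ⟨S.E m * z, mul_mem_jacobson_smul_rad hExt hχ hψ hz,
        by simp [← mul_assoc, (S.hasType_E m).idem.eq]⟩
    · have hm1 : 1 < S.d m := by have := S.d_pos m; omega
      by_contra hc
      rw [not_le] at hc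
      have h3 : S.nonlinearMult (Ring.jacobson A • S.rad j) + 1 < S.nonlinearMult (S.rad j) := by
        have h4 : S.nonlinearMult (Ring.jacobson A • S.rad j) + 1 =
            ∑ i with 1 < S.d i, (idealMult k (S.E i) (Ring.jacobson A • S.rad j) +
              if i = l then 1 else 0) := by
          rw [Finset.sum_add_distrib, Finset.sum_ite_eq', if_pos (by simpa using hl)]; rfl
        rw [h4]
        refine Finset.sum_lt_sum (fun i _ => ?_) ⟨m, by simpa using hm1, hc⟩
        split_ifs with hi
        · rw [hi]; exact hlt'
        · exact hmono i
      omega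
  set r' := S.E l * r with hr'
  have hr'R : r' ∈ S.rad j := Submodule.smul_mem _ _ hr
  have hEr : S.E l * r' = r' := by rw [hr', ← mul_assoc, (S.hasType_E l).idem.eq]
  -- A simple top means, by Nakayama's lemma, that `rad` is generated by `r'`, so it is a quotient
  -- of the projective of `l`.
  have hspan : S.rad j ≤ Ideal.span {r'} := by
    refine le_of_le_sup_jacobson_smul (k := k) fun x hx => ?_
    by_contra hxN
    obtain ⟨s, hs⟩ := exists_mul_notMem (S := S) hxN
    have hN : Ideal.span {r'} ⊔ Ring.jacobson A • S.rad j ≤ S.rad j :=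
      sup_le ((Ideal.span_singleton_le_iff_mem _).2 hr'R) Submodule.smul_le_right
    have h1 := idealMult_lt (k := k) hN hx hs
    rw [(S.hasType_e s).idealMult_eq (S.hasType_E s.1),
      (S.hasType_e s).idealMult_eq (S.hasType_E s.1)] at h1
    have h2 := hkey s.1
    have h3 : idealMult k (S.E s.1) (Ring.jacobson A • S.rad j) + (if s.1 = l then 1 else 0) ≤
        idealMult k (S.E s.1) (Ideal.span {r'} ⊔ Ring.jacobson A • S.rad j) := by
      split_ifs with hsl
      · rw [hsl]
        refine idealMult_lt le_sup_right (x := r')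
          (le_sup_left (a := Ideal.span {r'}) (Ideal.mem_span_singleton_self r')) ?_
        rwa [hEr]
      · exact idealMult_mono _ le_sup_right
    omega
  set θ := LinearMap.toSpanSingleton A A r' with hθ
  have hmap : Submodule.map θ (Ideal.span {S.E l}) = S.rad j := by
    apply le_antisymm
    · rintro _ ⟨z, _, rfl⟩
      exact Submodule.smul_mem _ _ hr'R
    · intro x hx
      obtain ⟨a, rfl⟩ := Ideal.mem_span_singleton'.1 (hspan hx)
      refine ⟨a * S.E l, Ideal.mul_mem_left _ _ (Ideal.mem_span_singleton_self _), ?_⟩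
      simp [hθ, mul_assoc, hEr]
  set K : Submodule A A := Ideal.span {S.E l} ⊓ LinearMap.ker θ with hK
  -- If the surjection were injective, the socle eigenvector of `rad` would lift to the projective
  -- of `l`, whose socle block has dimension `d l > 1`.
  have hKne : K ≠ ⊥ := by
    intro hK0
    obtain ⟨χ, hχ⟩ := exists_char (S := S) (l := S.perm σ j) (by rw [S.d_perm, hj])
    obtain ⟨w, hwR, hw0, hw⟩ := exists_eigen_mem hφ hσ hχ (N := S.rad j) inf_le_left hR
    rw [← hmap] at hwR
    obtain ⟨z, hz, hzw⟩ := hwR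
    have hz0 : z ≠ 0 := by rintro rfl; exact hw0 (by rw [← hzw, map_zero])
    have hzχ : ∀ a, a * z = χ a • z := by
      intro a
      have : a * z - χ a • z ∈ K := by
        refine ⟨sub_mem (Ideal.mul_mem_left _ _ hz)
          (by rw [Algebra.smul_def]; exact Ideal.mul_mem_left _ _ hz), ?_⟩
        have hzw' : z * r' = w := hzw
        change (a * z - χ a • z) * r' = 0
        rw [sub_mul, mul_assoc, smul_mul_assoc, hzw', hw, sub_self]
      rwa [hK0, Submodule.mem_bot, sub_eq_zero] at this
    have := index_of_eigen hφ hσ hχ hz hzχ hz0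
    have := congrArg S.d this
    rw [S.d_perm, S.d_perm] at this
    omega
  have hKpos : 1 ≤ S.nonlinearMult K := by
    have := idealMult_soc_pos (k := k) hφ hσ (j := l) (N := K) inf_le_left hKne
    exact this.trans_le (Finset.single_le_sum (f := fun l => idealMult k (S.E l) K)
      (fun _ _ => Nat.zero_le _) (by simp [S.d_perm, hl]))
  refine ⟨l, hl, ?_, ?_⟩
  · rw [cartan_eq_idealMult]
    have := idealMult_mono (k := k) (S.E l) (show S.rad j ≤ Ideal.span {S.E j} from inf_le_left)
    omega
  -- The kernel contributes a nonlinear constituent (the socle of the projective of `l`), the image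
  -- two more.
  · have : S.nonlinearMult K + S.nonlinearMult (S.rad j) ≤ ∑ m with 1 < S.d m, S.cartan m l := by
      rw [nonlinearMult, nonlinearMult, ← Finset.sum_add_distrib]
      refine Finset.sum_le_sum fun m _ => ?_
      rw [cartan_eq_idealMult, ← hmap]
      exact idealMult_ker_add_map_le _ _ _
    omega

end SplitSystem

end BlockSystem

namespace BlockSystem

open Coalgebra HopfAlgebra WithConv

/-! ### The convolution algebra of a finite-dimensional coalgebra -/

section

variable {k H : Type*} [Field k]

/-- The dual algebra of a coalgebra. -/
abbrev DualAlgebra (k H : Type*) [Field k] [AddCommGroup H] [Module k H] := WithConv (H →ₗ[k] k)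

section

variable [AddCommGroup H] [Module k H] [FiniteDimensional k H]

instance : FiniteDimensional k (DualAlgebra k H) :=
  Module.Finite.equiv (WithConv.linearEquiv k (H →ₗ[k] k)).symm

omit [FiniteDimensional k H] in
theorem finrank_dualAlgebra : Module.finrank k (DualAlgebra k H) = Module.finrank k H := by
  rw [LinearEquiv.finrank_eq (WithConv.linearEquiv k (H →ₗ[k] k))]
  exact Subspace.dual_finrank_eq

theorem exists_eval_eq (β : DualAlgebra k H →ₗ[k] k) : ∃ x : H, ∀ a, β a = a x := by
  let γ : Module.Dual k (Module.Dual k H) :=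
    β ∘ₗ (WithConv.linearEquiv k (H →ₗ[k] k)).symm.toLinearMap
  obtain ⟨x, hx⟩ := (Module.evalEquiv k H).surjective γ
  refine ⟨x, fun a => ?_⟩
  have := LinearMap.congr_fun hx a.ofConv
  exact this.symm

omit [FiniteDimensional k H] in
theorem eq_of_forall_dual {x y : H} (h : ∀ a : DualAlgebra k H, a x = a y) : x = y := by
  rw [← sub_eq_zero, ← Module.forall_dual_apply_eq_zero_iff k]
  intro f
  rw [map_sub, sub_eq_zero]
  exact h (toConv f)

theorem tensor_ext {z w : H ⊗[k] H}
    (h : ∀ a b : H →ₗ[k] k, LinearMap.mul' k k (TensorProduct.map a b z) =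
      LinearMap.mul' k k (TensorProduct.map a b w)) : z = w := by
  let b := Module.finBasis k H
  refine (b.tensorProduct b).ext_elem fun ⟨i, j⟩ => ?_
  have : ∀ z : H ⊗[k] H, (b.tensorProduct b).repr z (i, j) =
      LinearMap.mul' k k (TensorProduct.map (b.coord i) (b.coord j) z) := by
    intro z
    induction z with
    | zero => simp
    | tmul x y => simp [Module.Basis.tensorProduct_repr_tmul_apply, mul_comm]
    | add x y hx hy => simp [hx, hy]
  rw [this, this, h]

theorem sum_coord_smul {V : Type*} [AddCommGroup V] [Module k V] (f : H →ₗ[k] V) (x : H) :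
    ∑ m, (Module.finBasis k H).coord m x • f (Module.finBasis k H m) = f x := by
  rw [← Finset.sum_congr rfl fun m _ => map_smul f _ _, ← map_sum]
  congr 1
  exact (Module.finBasis k H).sum_repr x

end

variable [Ring H] [HopfAlgebra k H]

theorem sum_counit_right_smul (x : H) :
    ∑ i ∈ (ℛ k x).index, counit (R := k) ((ℛ k x).right i) • (ℛ k x).left i = x := by
  have h := congrArg (TensorProduct.rid k H) (sum_tmul_counit_eq (ℛ k x))
  rw [map_sum] at h
  simpa only [TensorProduct.rid_tmul, one_smul] using h

theorem antipode_antipode_mul (x y : H) :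
    antipode k (antipode k (x * y)) = antipode k (antipode k x) * antipode k (antipode k y) := by
  rw [antipode_mul_antidistrib, antipode_mul_antidistrib]

/-- The left coaction of a functional: `u ↦ a(u₁) u₂`. -/
noncomputable def hit (a : H →ₗ[k] k) : H →ₗ[k] H :=
  (TensorProduct.lid k H).toLinearMap ∘ₗ TensorProduct.map a LinearMap.id ∘ₗ comul

theorem hit_apply (a : H →ₗ[k] k) (u : H) :
    hit a u = ∑ i ∈ (ℛ k u).index, a ((ℛ k u).left i) • (ℛ k u).right i := by
  conv_lhs => rw [hit, LinearMap.comp_apply, LinearMap.comp_apply, ← (ℛ k u).eq]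
  simp [map_sum]

theorem sum_coassoc {V : Type*} [AddCommGroup V] [Module k V] (G : H ⊗[k] (H ⊗[k] H) →ₗ[k] V)
    (u : H) :
    ∑ i ∈ (ℛ k u).index, ∑ j ∈ (ℛ k ((ℛ k u).left i)).index,
      G ((ℛ k ((ℛ k u).left i)).left j ⊗ₜ ((ℛ k ((ℛ k u).left i)).right j ⊗ₜ (ℛ k u).right i)) =
    ∑ i ∈ (ℛ k u).index, ∑ j ∈ (ℛ k ((ℛ k u).right i)).index,
      G ((ℛ k u).left i ⊗ₜ ((ℛ k ((ℛ k u).right i)).left j ⊗ₜ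
        (ℛ k ((ℛ k u).right i)).right j)) := by
  have := congrArg G (sum_tmul_tmul_eq (ℛ k u) (fun i => ℛ k ((ℛ k u).left i))
    (fun i => ℛ k ((ℛ k u).right i)))
  simpa only [map_sum] using this

theorem hit_mul (a : H →ₗ[k] k) (x u : H) :
    hit a (x * u) = ∑ i ∈ (ℛ k x).index, ∑ j ∈ (ℛ k u).index,
      a ((ℛ k x).left i * (ℛ k u).left j) • ((ℛ k x).right i * (ℛ k u).right j) := by
  rw [hit, LinearMap.comp_apply, LinearMap.comp_apply, Bialgebra.comul_mul]
  conv_lhs => rw [← (ℛ k x).eq, ← (ℛ k u).eq]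
  simp [Finset.sum_mul_sum, map_sum]

/-- After coassociativity the inner factor is `S(h₃) S²(h₂) = S(S(h₂) h₃)`, which collapses to a
counit. -/
theorem sum_antipode_hit (a : H →ₗ[k] k) (h u : H) :
    ∑ i ∈ (ℛ k h).index, antipode k ((ℛ k h).right i) *
      antipode k (antipode k (hit a ((ℛ k h).left i * u))) =
    antipode k (antipode k (hit (a ∘ₗ LinearMap.mulLeft k h) u)) := by
  have key : ∀ v w : H, ∑ i ∈ (ℛ k h).index, ∑ j ∈ (ℛ k ((ℛ k h).left i)).index,
      a ((ℛ k ((ℛ k h).left i)).left j * v) • (antipode k ((ℛ k h).right i) *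
        (antipode k (antipode k ((ℛ k ((ℛ k h).left i)).right j * w)))) =
      a (h * v) • antipode k (antipode k w) := by
    intro v w
    let G : H ⊗[k] (H ⊗[k] H) →ₗ[k] H := (TensorProduct.lid k H).toLinearMap ∘ₗ
      TensorProduct.map (a ∘ₗ LinearMap.mulRight k v)
        (LinearMap.mulRight k (antipode k (antipode k w)) ∘ₗ antipode k ∘ₗ LinearMap.mul' k H ∘ₗ
          TensorProduct.map (antipode k) LinearMap.id)
    have hG : ∀ x y z, G (x ⊗ₜ (y ⊗ₜ z)) =
        a (x * v) • (antipode k (antipode k y * z) * antipode k (antipode k w)) := by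
      intro x y z; simp [G]
    have := sum_coassoc G h
    simp only [hG] at this
    have e1 : ∀ x y z : H, a (x * v) • (antipode k z * antipode k (antipode k (y * w))) =
        a (x * v) • (antipode k (antipode k y * z) * antipode k (antipode k w)) := by
      intro x y z
      rw [antipode_antipode_mul, antipode_mul_antidistrib (antipode k y) z, mul_assoc]
    simp only [e1]
    rw [this]
    have e2 : ∀ y : H, ∑ j ∈ (ℛ k y).index, antipode k (antipode k ((ℛ k y).left j) *
        (ℛ k y).right j) = counit (R := k) y • 1 := by
      intro y
      rw [← map_sum, sum_antipode_mul_eq_smul, map_smul, antipode_one]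
    simp only [← Finset.smul_sum, ← Finset.sum_mul, e2]
    have e3 : a (h * v) = ∑ i ∈ (ℛ k h).index,
        counit (R := k) ((ℛ k h).right i) * a ((ℛ k h).left i * v) := by
      conv_lhs => rw [← sum_counit_right_smul (k := k) h]
      simp [Finset.sum_mul, map_sum]
    rw [e3, Finset.sum_smul]
    refine Finset.sum_congr rfl fun i _ => ?_
    rw [smul_mul_assoc, one_mul, smul_smul, mul_comm]
  calc _ = ∑ i ∈ (ℛ k h).index, ∑ j ∈ (ℛ k ((ℛ k h).left i)).index, ∑ v ∈ (ℛ k u).index,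
      a ((ℛ k ((ℛ k h).left i)).left j * (ℛ k u).left v) • (antipode k ((ℛ k h).right i) *
        (antipode k (antipode k ((ℛ k ((ℛ k h).left i)).right j * (ℛ k u).right v)))) := by
        simp only [hit_mul, map_sum, map_smul, Finset.mul_sum, mul_smul_comm]
    _ = ∑ v ∈ (ℛ k u).index, ∑ i ∈ (ℛ k h).index, ∑ j ∈ (ℛ k ((ℛ k h).left i)).index,
      a ((ℛ k ((ℛ k h).left i)).left j * (ℛ k u).left v) • (antipode k ((ℛ k h).right i) *
        (antipode k (antipode k ((ℛ k ((ℛ k h).left i)).right j * (ℛ k u).right v)))) := by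
        rw [Finset.sum_comm]
        exact Finset.sum_congr rfl fun i _ => Finset.sum_comm
    _ = _ := by
        rw [hit_apply, map_sum, map_sum]
        refine Finset.sum_congr rfl fun v _ => ?_
        rw [key, map_smul, map_smul]
        rfl

/-- Summing over dual bases produces `a(u₁) S²(u₃) S(u₂) y`, and `S²(u₃) S(u₂) = S(u₂ S(u₃))`
collapses. With `a = ε` and `y = 1` this exhibits an operator of trace `1`, so the integral built
from traces is not always zero. -/
theorem sum_hit_conv (a : H →ₗ[k] k) [FiniteDimensional k H] (u y : H) :
    ∑ m, antipode k (antipode k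
      (hit (toConv a * toConv ((Module.finBasis k H).coord m) : DualAlgebra k H).ofConv u)) *
        (antipode k (Module.finBasis k H m) * y) = a u • y := by
  set b := Module.finBasis k H with hb
  let G : H ⊗[k] (H ⊗[k] H) →ₗ[k] H := (TensorProduct.lid k H).toLinearMap ∘ₗ
      TensorProduct.map a (LinearMap.mulRight k y ∘ₗ antipode k ∘ₗ LinearMap.mul' k H ∘ₗ
          TensorProduct.map LinearMap.id (antipode k))
  have hG : ∀ p q r, G (p ⊗ₜ (q ⊗ₜ r)) = a p • (antipode k (antipode k r) * antipode k q * y) := by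
    intro p q r
    simp [G, antipode_mul_antidistrib]
  have h1 : ∀ m, antipode k (antipode k
      (hit (toConv a * toConv (b.coord m) : DualAlgebra k H).ofConv u)) *
        (antipode k (b m) * y) = ∑ i ∈ (ℛ k u).index, ∑ j ∈ (ℛ k ((ℛ k u).left i)).index,
        b.coord m ((ℛ k ((ℛ k u).left i)).right j) • a ((ℛ k ((ℛ k u).left i)).left j) •
          (antipode k (antipode k ((ℛ k u).right i)) * antipode k (b m) * y) := by
    intro m
    rw [hit_apply, map_sum, map_sum, Finset.sum_mul]
    refine Finset.sum_congr rfl fun i _ => ?_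
    rw [(ℛ k ((ℛ k u).left i)).convMul_apply, Finset.sum_smul, map_sum, map_sum, Finset.sum_mul]
    refine Finset.sum_congr rfl fun j _ => ?_
    rw [map_smul, map_smul, smul_mul_assoc, smul_smul, mul_assoc, mul_comm]
  calc _ = ∑ i ∈ (ℛ k u).index, ∑ j ∈ (ℛ k ((ℛ k u).left i)).index,
        G ((ℛ k ((ℛ k u).left i)).left j ⊗ₜ ((ℛ k ((ℛ k u).left i)).right j ⊗ₜ
          (ℛ k u).right i)) := by
        rw [Finset.sum_congr rfl fun m _ => h1 m, Finset.sum_comm]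
        refine Finset.sum_congr rfl fun i _ => ?_
        rw [Finset.sum_comm]
        refine Finset.sum_congr rfl fun j _ => ?_
        let F : H →ₗ[k] H := a ((ℛ k ((ℛ k u).left i)).left j) •
          (LinearMap.mulRight k y ∘ₗ LinearMap.mulLeft k (antipode k (antipode k ((ℛ k u).right i)))
            ∘ₗ antipode k)
        rw [hG]
        exact sum_coord_smul F _
    _ = _ := by
        rw [sum_coassoc]
        have h2 : ∀ p z : H, ∑ j ∈ (ℛ k z).index, G (p ⊗ₜ ((ℛ k z).left j ⊗ₜ (ℛ k z).right j)) =
            (counit (R := k) z * a p) • y := by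
          intro p z
          have h3 := sum_mul_antipode_eq_smul (R := k) (ℛ k z)
          have h4 := congrArg (fun w => a p • (antipode k w * y)) h3
          simp only [map_sum, antipode_mul_antidistrib, Finset.sum_mul, Finset.smul_sum, map_smul,
            antipode_one, smul_mul_assoc, one_mul] at h4
          simp only [hG]
          rw [h4, smul_smul, mul_comm]
        rw [Finset.sum_congr rfl fun i _ => h2 _ _, ← Finset.sum_smul]
        congr 1
        conv_rhs => rw [← sum_counit_right_smul (k := k) u]
        simp [map_sum]

/-- A finite-dimensional Hopf algebra has a nonzero left integral. -/
theorem exists_integral (k H : Type*) [Field k] [Ring H] [HopfAlgebra k H]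
    [FiniteDimensional k H] :
    ∃ Λ : H, Λ ≠ 0 ∧ ∀ h, h * Λ = counit (R := k) h • Λ := by
  let S : H →ₗ[k] H := antipode k
  -- For fixed `x` the trace of `u ↦ S²(a(u₁) u₂) x` is a functional of `a`, hence evaluation at an
  -- element of `H`; that element will be a left integral.
  let D : H →ₗ[k] DualAlgebra k H →ₗ[k] k := LinearMap.mk₂ k
    (fun x a => LinearMap.trace k H (LinearMap.mulRight k x ∘ₗ S ∘ₗ S ∘ₗ hit a.ofConv))
    (by intro x y a; rw [← map_add]; congr 1; ext u; simp [mul_add])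
    (by intro c x a; rw [← map_smul]; congr 1; ext u; simp)
    (by intro x a b; rw [← map_add]; congr 1; ext u; simp [hit, TensorProduct.map_add_left, add_mul])
    (by intro c x a; rw [← map_smul]; congr 1; ext u; simp [hit, TensorProduct.map_smul_left])
  have hD : ∀ x a, D x a =
    LinearMap.trace k H (LinearMap.mulRight k x ∘ₗ S ∘ₗ S ∘ₗ hit a.ofConv) := fun _ _ => rfl
  -- Cyclicity of the trace brings `h₁` next to `S(h₂)`, whose product sums to `ε(h)`.
  have hint : ∀ x a h, D x (toConv (a ∘ₗ LinearMap.mulLeft k h)) =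
      counit (R := k) h * D x (toConv a) := by
    intro x a h
    have h1 : LinearMap.mulRight k x ∘ₗ S ∘ₗ S ∘ₗ hit (a ∘ₗ LinearMap.mulLeft k h) =
        ∑ i ∈ (ℛ k h).index, (LinearMap.mulLeft k (antipode k ((ℛ k h).right i)) ∘ₗ
          LinearMap.mulRight k x ∘ₗ S ∘ₗ S ∘ₗ hit a) ∘ₗ LinearMap.mulLeft k ((ℛ k h).left i) := by
      ext u
      simp only [LinearMap.comp_apply, LinearMap.sum_apply, LinearMap.mulRight_apply,
        LinearMap.mulLeft_apply, S]
      rw [← sum_antipode_hit, Finset.sum_mul]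
      exact Finset.sum_congr rfl fun i _ => mul_assoc _ _ _
    have h2 : ∀ i, LinearMap.trace k H ((LinearMap.mulLeft k (antipode k ((ℛ k h).right i)) ∘ₗ
          LinearMap.mulRight k x ∘ₗ S ∘ₗ S ∘ₗ hit a) ∘ₗ LinearMap.mulLeft k ((ℛ k h).left i)) =
        LinearMap.trace k H (LinearMap.mulLeft k ((ℛ k h).left i * antipode k ((ℛ k h).right i)) ∘ₗ
          LinearMap.mulRight k x ∘ₗ S ∘ₗ S ∘ₗ hit a) := by
      intro i
      rw [← Module.End.mul_eq_comp, LinearMap.trace_mul_comm, LinearMap.mulLeft_mul]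
      rfl
    rw [hD, hD, ofConv_toConv, ofConv_toConv, h1, map_sum, Finset.sum_congr rfl fun i _ => h2 i,
      ← map_sum, ← smul_eq_mul, ← map_smul]
    congr 1
    ext u
    simp only [LinearMap.comp_apply, LinearMap.sum_apply, LinearMap.mulLeft_apply]
    rw [← Finset.sum_mul, sum_mul_antipode_eq_smul, smul_mul_assoc, one_mul]
    rfl
  have hne : ∃ x, D x ≠ 0 := by
    by_contra! hc
    have h1 : (∑ m, LinearMap.mulRight k (antipode k (Module.finBasis k H m) * 1) ∘ₗ S ∘ₗ S ∘ₗ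
        hit (toConv counit * toConv ((Module.finBasis k H).coord m) : DualAlgebra k H).ofConv) =
        (counit : H →ₗ[k] k).smulRight (1 : H) := by
      ext u
      simp only [LinearMap.sum_apply, LinearMap.comp_apply, LinearMap.mulRight_apply,
        LinearMap.smulRight_apply, S]
      exact sum_hit_conv _ _ _
    have h2 := congrArg (LinearMap.trace k H) h1
    rw [map_sum, Finset.sum_eq_zero fun m _ => ?_] at h2
    · rw [LinearMap.trace_smulRight, Bialgebra.counit_one] at h2
      exact zero_ne_one h2
    · rw [← hD, hc]; rfl
  obtain ⟨x, hx⟩ := hne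
  obtain ⟨Λ, hΛ⟩ := exists_eval_eq (D x)
  refine ⟨Λ, ?_, fun h => eq_of_forall_dual (k := k) fun a => ?_⟩
  · rintro rfl
    exact hx (LinearMap.ext fun a => by rw [hΛ, map_zero]; rfl)
  · have := hint x a.ofConv h
    rw [hΛ, hΛ] at this
    rw [map_smul]
    exact this

end

end BlockSystem

/-! ### The integral as a Frobenius form -/

namespace BlockSystem

open Coalgebra HopfAlgebra WithConv

section

variable {k H : Type*} [Field k] [Ring H] [HopfAlgebra k H]

variable (k H) in
/-- The inclusion `x ↦ x ⊗ 1`. -/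
abbrev inclLeft : H →ₗ[k] H ⊗[k] H :=
  (Algebra.TensorProduct.includeLeft : H →ₐ[k] H ⊗[k] H).toLinearMap

variable (k H) in
/-- The inclusion `x ↦ 1 ⊗ x`. -/
abbrev inclRight : H →ₗ[k] H ⊗[k] H :=
  (Algebra.TensorProduct.includeRight : H →ₐ[k] H ⊗[k] H).toLinearMap

/-- Comultiplication is the convolution product of the two inclusions, so antipode identities can be
proved by cancelling invertible factors in a convolution algebra. -/
theorem conv_incl : toConv (inclLeft k H) * toConv (inclRight k H) =
    (toConv comul : WithConv (H →ₗ[k] H ⊗[k] H)) := by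
  ext x
  rw [(ℛ k x).convMul_apply]
  simp [(ℛ k x).eq]

theorem conv_algHom_one {B : Type*} [Ring B] [Algebra k B] (f : H →ₐ[k] B) :
    f.toLinearMap ∘ₗ (1 : WithConv (H →ₗ[k] H)).ofConv = (1 : WithConv (H →ₗ[k] B)).ofConv := by
  ext x; simp [LinearMap.convOne_def]

theorem conv_antipode_mul {B : Type*} [Ring B] [Algebra k B] (f : H →ₐ[k] B) :
    toConv (f.toLinearMap ∘ₗ antipode k) * toConv f.toLinearMap = (1 : WithConv (H →ₗ[k] B)) := by
  have := LinearMap.algHom_comp_convMul_distrib f (toConv (antipode k (A := H)))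
    (toConv (LinearMap.id : H →ₗ[k] H))
  rw [LinearMap.antipode_mul_id, conv_algHom_one] at this
  exact (WithConv.ext this).symm

theorem conv_mul_antipode {B : Type*} [Ring B] [Algebra k B] (f : H →ₐ[k] B) :
    toConv f.toLinearMap * toConv (f.toLinearMap ∘ₗ antipode k) = (1 : WithConv (H →ₗ[k] B)) := by
  have := LinearMap.algHom_comp_convMul_distrib f
    (toConv (LinearMap.id : H →ₗ[k] H)) (toConv (antipode k (A := H)))
  rw [LinearMap.id_mul_antipode, conv_algHom_one] at this
  exact (WithConv.ext this).symm

/-- For a left integral `Λ`, `Λ₁ ⊗ h Λ₂ = S(h) Λ₁ ⊗ Λ₂`. -/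
theorem integral_shift {Λ : H} (hΛ : ∀ h, h * Λ = counit (R := k) h • Λ) (h : H) :
    ((1 : H) ⊗ₜ[k] h) * comul Λ = (antipode k h ⊗ₜ[k] (1 : H)) * comul Λ := by
  have h1 : toConv ((inclLeft k H) ∘ₗ antipode k) * toConv comul = (toConv (inclRight k H) :
      WithConv (H →ₗ[k] H ⊗[k] H)) := by
    rw [← conv_incl, ← mul_assoc, conv_antipode_mul, one_mul]
  have h2 := congrArg (fun f : WithConv (H →ₗ[k] H ⊗[k] H) => f h * comul Λ) h1
  simp only [(ℛ k h).convMul_apply] at h2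
  change _ = ((1 : H) ⊗ₜ[k] h) * comul Λ at h2
  rw [← h2, Finset.sum_mul]
  have h3 : ∀ i, (toConv ((inclLeft k H) ∘ₗ antipode k)) ((ℛ k h).left i) *
      (toConv comul : WithConv (H →ₗ[k] H ⊗[k] H)) ((ℛ k h).right i) * comul Λ =
      ((antipode k (counit (R := k) ((ℛ k h).right i) • (ℛ k h).left i)) ⊗ₜ[k] (1 : H)) *
        comul Λ := by
    intro i
    change (antipode k ((ℛ k h).left i) ⊗ₜ[k] (1 : H)) * comul ((ℛ k h).right i) * comul Λ = _
    rw [mul_assoc, ← Bialgebra.comul_mul, hΛ, map_smul, map_smul, mul_smul_comm,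
      ← smul_mul_assoc, TensorProduct.smul_tmul']
  rw [Finset.sum_congr rfl fun i _ => h3 i, ← Finset.sum_mul, ← TensorProduct.sum_tmul, ← map_sum,
    sum_counit_right_smul]

/-- `(ε ⊗ b)(Δ u)`-type contraction `u ⊗ v ↦ b(v) u`. -/
noncomputable def contract (b : H →ₗ[k] k) : H ⊗[k] H →ₗ[k] H :=
  (TensorProduct.rid k H).toLinearMap ∘ₗ TensorProduct.map LinearMap.id b

@[simp] theorem contract_tmul (b : H →ₗ[k] k) (u v : H) : contract b (u ⊗ₜ[k] v) = b v • u := by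
  simp [contract]

theorem contract_mul_left (b : H →ₗ[k] k) (u : H) (z : H ⊗[k] H) :
    contract b ((u ⊗ₜ[k] 1) * z) = u * contract b z := by
  induction z with
  | zero => simp
  | tmul x y => simp
  | add x y hx hy => simp [mul_add, hx, hy]

theorem contract_mul_right (b : H →ₗ[k] k) (u : H) (z : H ⊗[k] H) :
    contract b (z * (u ⊗ₜ[k] 1)) = contract b z * u := by
  induction z with
  | zero => simp
  | tmul x y => simp
  | add x y hx hy => simp [add_mul, hx, hy]

theorem contract_comp_mulLeft (b : H →ₗ[k] k) (u : H) (z : H ⊗[k] H) :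
    contract (b ∘ₗ LinearMap.mulLeft k u) z = contract b (((1 : H) ⊗ₜ[k] u) * z) := by
  induction z with
  | zero => simp
  | tmul x y => simp
  | add x y hx hy => simp [mul_add, hx, hy]

theorem apply_contract (a b : DualAlgebra k H) (u : H) :
    a (contract b.ofConv (comul u)) = (a * b) u := by
  rw [(ℛ k u).convMul_apply]
  conv_lhs => rw [← (ℛ k u).eq]
  simp [map_sum, mul_comm]

/-- This is `b(S(x₁) x₂) = ε(x) b(1)` with the product expanded over a basis; it writes the scalar
`b(1)` as a combination of left translates of `b`. -/
theorem sum_conv_antipode [FiniteDimensional k H] (b : H →ₗ[k] k) :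
    ∑ m, toConv ((Module.finBasis k H).coord m ∘ₗ antipode k) *
      toConv (b ∘ₗ LinearMap.mulLeft k (Module.finBasis k H m)) =
    (b 1 • 1 : DualAlgebra k H) := by
  refine WithConv.ext (LinearMap.ext fun x => ?_)
  rw [ofConv_sum, LinearMap.sum_apply]
  simp only [(ℛ k x).convMul_apply]
  rw [Finset.sum_comm]
  have : ∀ i, ∑ m, (Module.finBasis k H).coord m (antipode k ((ℛ k x).left i)) *
      b (Module.finBasis k H m * (ℛ k x).right i) =
      b (antipode k ((ℛ k x).left i) * (ℛ k x).right i) := fun i =>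
    sum_coord_smul (b ∘ₗ LinearMap.mulRight k ((ℛ k x).right i)) _
  refine (Finset.sum_congr rfl fun i _ => this i).trans ?_
  rw [← map_sum, sum_antipode_mul_eq_smul, map_smul]
  simp [LinearMap.convOne_def, mul_comm]

/-- Evaluation at a nonzero left integral is a Frobenius form on the dual algebra. -/
theorem integral_nondegenerate [FiniteDimensional k H] {Λ : H} (hΛ0 : Λ ≠ 0)
    (hΛ : ∀ h, h * Λ = counit (R := k) h • Λ) (b : DualAlgebra k H)
    (hb : ∀ a : DualAlgebra k H, (a * b) Λ = 0) : b = 0 := by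
  have h0 : contract b.ofConv (comul Λ) = 0 :=
    eq_of_forall_dual (k := k) fun a => by rw [apply_contract, hb, map_zero]
  -- By `integral_shift`, the annihilation of `Λ` passes from `b` to all its translates;
  -- `sum_conv_antipode` then turns `b h ≠ 0` into `a Λ = 0` for every `a`.
  have h1 : ∀ h, contract (b.ofConv ∘ₗ LinearMap.mulLeft k h) (comul Λ) = 0 := by
    intro h
    rw [contract_comp_mulLeft, integral_shift hΛ, contract_mul_left, h0, mul_zero]
  have h2 : ∀ (h : H) (a : DualAlgebra k H),
      (a * toConv (b.ofConv ∘ₗ LinearMap.mulLeft k h)) Λ = 0 := by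
    intro h a
    rw [← apply_contract, ofConv_toConv, h1, map_zero]
  refine WithConv.ext (LinearMap.ext fun h => ?_)
  have h3 := sum_conv_antipode (b.ofConv ∘ₗ LinearMap.mulLeft k h)
  by_contra hne
  refine hΛ0 (eq_of_forall_dual (k := k) fun a => ?_)
  have h4 := congrArg (fun c : DualAlgebra k H => (a * c) Λ) h3
  simp only [Finset.mul_sum, ofConv_sum, LinearMap.sum_apply, mul_smul_comm, mul_one] at h4
  rw [Finset.sum_eq_zero fun m _ => ?_] at h4
  · have h5 : b h * a Λ = 0 := by
      rw [h4]; simp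
    rw [map_zero]
    exact (mul_eq_zero.1 h5).resolve_left hne
  · rw [← mul_assoc, LinearMap.comp_assoc, ← LinearMap.mulLeft_mul]
    exact h2 _ _

/-! ### Characters of the dual algebra and skew-primitive elements -/

theorem conv_apply_tensor (a b : DualAlgebra k H)
    (x : H) : (a * b) x = LinearMap.mul' k k (TensorProduct.map a.ofConv b.ofConv (comul x)) := rfl

theorem exists_groupLike [FiniteDimensional k H] (χ : DualAlgebra k H →ₐ[k] k) :
    ∃ g : H, IsGroupLikeElem k g ∧ ∀ a, χ a = a g := by
  obtain ⟨g, hg⟩ := exists_eval_eq χ.toLinearMap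
  have hg : ∀ a, χ a = a g := hg
  refine ⟨g, ⟨?_, ?_⟩, hg⟩
  · have := hg 1
    rw [map_one] at this
    simpa using this.symm
  · refine tensor_ext fun a b => ?_
    have := map_mul χ (toConv a) (toConv b)
    rw [hg, hg, hg, conv_apply_tensor] at this
    rw [this]; simp

/-- A derivation between the characters `g` and `g'` is evaluation at some `x`, and the derivation
rule says `Δ x = g' ⊗ x + x ⊗ g`. It is inner exactly when `x` is a multiple of `g' - g`. -/
theorem splitsCharExtensions_of_skewPrimitive [FiniteDimensional k H]
    (h : ∀ x : H, ¬ IsNontrivialSkewPrimitive k x) :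
    SplitsCharExtensions k (DualAlgebra k H) := by
  intro χ ψ β hβ
  obtain ⟨g, hg, hgχ⟩ := exists_groupLike χ
  obtain ⟨g', hg', hgψ⟩ := exists_groupLike ψ
  obtain ⟨x, hx⟩ := exists_eval_eq β
  have hΔ : comul (R := k) x = g' ⊗ₜ[k] x + x ⊗ₜ[k] g := by
    refine tensor_ext fun a b => ?_
    have := hβ (toConv a) (toConv b)
    rw [hx, hx, hx, hgχ, hgψ, conv_apply_tensor] at this
    rw [this]; simp [add_comm]
  have hmem : x ∈ Submodule.span k {g' - g} := by
    by_contra hc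
    exact h x ⟨g', g, hg', hg, hΔ, hc⟩
  obtain ⟨c, hc⟩ := Submodule.mem_span_singleton.1 hmem
  refine ⟨c, fun a => ?_⟩
  rw [hx, ← hc, map_smul, map_sub, hgχ, hgψ, smul_eq_mul]

/-- Evaluation at a group-like element is a character of the dual algebra. -/
noncomputable def evalChar {g : H} (hg : IsGroupLikeElem k g) : DualAlgebra k H →ₐ[k] k :=
  AlgHom.ofLinearMap (LinearMap.applyₗ g ∘ₗ (WithConv.linearEquiv k (H →ₗ[k] k)).toLinearMap)
    (by simp [hg.counit_eq_one])
    (fun a b => by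
      change (a * b) g = a g * b g
      rw [conv_apply_tensor, hg.comul_eq_tmul_self]; simp)

theorem evalChar_apply {g : H} (hg : IsGroupLikeElem k g) (a : DualAlgebra k H) :
    evalChar hg a = a g := rfl

/-- Translation by a group-like element, as an endomorphism of the dual algebra. -/
noncomputable def translateHom {g : H} (hg : IsGroupLikeElem k g) :
    DualAlgebra k H →ₐ[k] DualAlgebra k H :=
  AlgHom.ofLinearMap ((WithConv.linearEquiv k (H →ₗ[k] k)).symm.toLinearMap ∘ₗ
      LinearMap.lcomp k k (LinearMap.mulLeft k g) ∘ₗ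
        (WithConv.linearEquiv k (H →ₗ[k] k)).toLinearMap)
    (by
      refine WithConv.ext (LinearMap.ext fun x => ?_)
      change (1 : DualAlgebra k H) (g * x) = (1 : DualAlgebra k H) x
      simp [hg.counit_eq_one])
    (fun a b => by
      refine WithConv.ext (LinearMap.ext fun x => ?_)
      change (a * b) (g * x) = (toConv (a.ofConv ∘ₗ LinearMap.mulLeft k g) *
        toConv (b.ofConv ∘ₗ LinearMap.mulLeft k g)) x
      rw [conv_apply_tensor, conv_apply_tensor, Bialgebra.comul_mul, hg.comul_eq_tmul_self]
      generalize comul (R := k) x = z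
      induction z with
      | zero => simp
      | tmul x y => simp
      | add x y hx hy => rw [mul_add, map_add, map_add, hx, hy, map_add, map_add])

/-- Translation by a group-like element, as an automorphism of the dual algebra. -/
noncomputable def translate (g : GroupLike k H) : DualAlgebra k H ≃ₐ[k] DualAlgebra k H :=
  AlgEquiv.ofAlgHom (translateHom g.2) (translateHom g⁻¹.2)
    (by
      ext a x
      change a ((g⁻¹ : GroupLike k H).val * (g.val * x)) = a x
      rw [← mul_assoc, ← GroupLike.val_mul, inv_mul_cancel, GroupLike.val_one, one_mul])
    (by
      ext a x
      change a (g.val * ((g⁻¹ : GroupLike k H).val * x)) = a x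
      rw [← mul_assoc, ← GroupLike.val_mul, mul_inv_cancel, GroupLike.val_one, one_mul])

theorem translate_apply (g : GroupLike k H) (a : DualAlgebra k H) (x : H) :
    translate g a x = a (g.val * x) := rfl

theorem translate_pow_apply (g : GroupLike k H) (m : ℕ) (a : DualAlgebra k H) (x : H) :
    (translate g ^ m) a x = a ((g ^ m).val * x) := by
  induction m generalizing a with
  | zero => simp
  | succ m ih =>
    rw [pow_succ, AlgEquiv.mul_apply, ih, translate_apply, ← mul_assoc, ← GroupLike.val_mul,
      ← pow_succ']

end

end BlockSystem

namespace BlockSystem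

open Coalgebra HopfAlgebra WithConv

/-! ### A normalized integral makes the dual algebra semisimple -/

section

variable {k H : Type*} [Field k] [Ring H] [HopfAlgebra k H]

theorem exists_retraction {k V : Type*} [Field k] [AddCommGroup V] [Module k V]
    (W : Submodule k V) : ∃ r : V →ₗ[k] W, ∀ x ∈ W, (r x : V) = x := by
  obtain ⟨r, hr⟩ := LinearMap.exists_leftInverse_of_injective W.subtype W.ker_subtype
  exact ⟨r, fun x hx => congrArg Subtype.val (LinearMap.congr_fun hr ⟨x, hx⟩)⟩

theorem contract_comp_mulRight (b : H →ₗ[k] k) (u : H) (z : H ⊗[k] H) :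
    contract (b ∘ₗ LinearMap.mulRight k u) z = contract b (z * ((1 : H) ⊗ₜ[k] u)) := by
  induction z with
  | zero => simp
  | tmul x y => simp
  | add x y hx hy => simp [add_mul, hx, hy]

theorem sum_comul_antipode_mul (y : H) :
    ∑ j ∈ (ℛ k y).index, comul (R := k) (antipode k ((ℛ k y).left j)) *
      ((ℛ k y).right j ⊗ₜ[k] (1 : H)) = (1 : H) ⊗ₜ[k] antipode k y := by
  have h1 : toConv (comul ∘ₗ antipode k) * toConv (inclLeft k H) * toConv (inclRight k H) =
      (1 : WithConv (H →ₗ[k] H ⊗[k] H)) := by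
    rw [mul_assoc, conv_incl]
    exact conv_antipode_mul (Bialgebra.comulAlgHom k H)
  have h2 : toConv (comul ∘ₗ antipode k) * toConv (inclLeft k H) =
      (toConv (inclRight k H ∘ₗ antipode k) : WithConv (H →ₗ[k] H ⊗[k] H)) := by
    rw [← mul_one (toConv (comul ∘ₗ antipode k) * toConv (inclLeft k H)),
      ← conv_mul_antipode (Algebra.TensorProduct.includeRight : H →ₐ[k] H ⊗[k] H), ← mul_assoc,
      h1, one_mul]
  have h3 := congrArg (fun f : WithConv (H →ₗ[k] H ⊗[k] H) => f y) h2
  simp only [(ℛ k y).convMul_apply] at h3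
  exact h3

/-- The functional `y ↦ l(h S(y))`. -/
noncomputable def antipodeShift (l : DualAlgebra k H) (h : H) : DualAlgebra k H :=
  toConv (l.ofConv ∘ₗ LinearMap.mulLeft k h ∘ₗ antipode k)

variable [FiniteDimensional k H]

theorem sum_coord_mul_antipodeShift (l : DualAlgebra k H) :
    ∑ m, toConv ((Module.finBasis k H).coord m) * antipodeShift l (Module.finBasis k H m) =
      (l 1 • 1 : DualAlgebra k H) := by
  refine WithConv.ext (LinearMap.ext fun x => ?_)
  rw [ofConv_sum, LinearMap.sum_apply]
  simp only [(ℛ k x).convMul_apply]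
  rw [Finset.sum_comm]
  have : ∀ i, ∑ m, (Module.finBasis k H).coord m ((ℛ k x).left i) *
      antipodeShift l (Module.finBasis k H m) ((ℛ k x).right i) =
      l ((ℛ k x).left i * antipode k ((ℛ k x).right i)) := fun i =>
    sum_coord_smul (l.ofConv ∘ₗ LinearMap.mulRight k (antipode k ((ℛ k x).right i))) _
  refine (Finset.sum_congr rfl fun i _ => this i).trans ?_
  rw [← map_sum, sum_mul_antipode_eq_smul, map_smul]
  simp [LinearMap.convOne_def, mul_comm]

/-- Together with `sum_coord_mul_antipodeShift`, this says that the dual basis paired with the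
functionals `l(b_m S(·))` is a separability (Casimir) element. The left integral property enters as
`z₁ l(z₂) = l(z) 1`, applied to `z = x S(y₁)`. -/
theorem antipodeShift_mul {l : DualAlgebra k H} (hl : ∀ a : DualAlgebra k H, a * l = a 1 • l)
    (a : DualAlgebra k H) (x : H) :
    ∑ m, (a * toConv ((Module.finBasis k H).coord m)) x •
      antipodeShift l (Module.finBasis k H m) = antipodeShift l x * a := by
  have hc : ∀ z, contract l.ofConv (comul z) = l z • 1 := fun z =>
    eq_of_forall_dual (k := k) fun a => by
      rw [apply_contract, hl, map_smul]
      exact mul_comm _ _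
  refine WithConv.ext (LinearMap.ext fun y => ?_)
  rw [ofConv_sum, LinearMap.sum_apply]
  have h1 : ∑ m, (a * toConv ((Module.finBasis k H).coord m)) x *
      antipodeShift l (Module.finBasis k H m) y =
      (a * toConv (l.ofConv ∘ₗ LinearMap.mulRight k (antipode k y))) x := by
    simp only [(ℛ k x).convMul_apply, Finset.sum_mul]
    rw [Finset.sum_comm]
    refine Finset.sum_congr rfl fun i _ => ?_
    have := sum_coord_smul (l.ofConv ∘ₗ LinearMap.mulRight k (antipode k y)) ((ℛ k x).right i)
    refine Eq.trans ?_ (congrArg (a ((ℛ k x).left i) * ·) this)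
    simp only [Finset.mul_sum, mul_assoc]
    rfl
  refine Eq.trans h1 ?_
  rw [← apply_contract, ofConv_toConv, contract_comp_mulRight, ← sum_comul_antipode_mul,
    Finset.mul_sum, map_sum]
  change _ = (antipodeShift l x * a) y
  rw [(ℛ k y).convMul_apply, map_sum]
  refine Finset.sum_congr rfl fun j _ => ?_
  rw [← mul_assoc, ← Bialgebra.comul_mul, contract_mul_right, hc, smul_mul_assoc, one_mul,
    map_smul]
  rfl

/-- Maschke: averaging a linear retraction onto `J` with the Casimir element gives a left-linear
one, that is, right multiplication by some `r ∈ J`. Then `j = j * r` for all `j ∈ J`, and `r` is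
nilpotent. -/
theorem jacobson_eq_bot_of_integral {l : DualAlgebra k H}
    (hl : ∀ a : DualAlgebra k H, a * l = a 1 • l) (h1 : l 1 = 1) :
    Ring.jacobson (DualAlgebra k H) = ⊥ := by
  set J := Ring.jacobson (DualAlgebra k H) with hJ
  let J' : Submodule k (DualAlgebra k H) := J.restrictScalars k
  obtain ⟨pr, hpr'⟩ := exists_retraction J'
  let b := Module.finBasis k H
  let r : DualAlgebra k H := ∑ m, toConv (b.coord m) * (pr (antipodeShift l (b m)) : J')
  have hr : r ∈ J := sum_mem fun m _ => J.mul_mem_left _ (pr (antipodeShift l (b m))).2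
  have key : ∀ j ∈ J, j * r = j := by
    intro j hj
    have e1 : ∀ c : DualAlgebra k H, c = ∑ n, c (b n) • toConv (b.coord n) := by
      intro c
      refine WithConv.ext (LinearMap.ext fun x => ?_)
      rw [ofConv_sum, LinearMap.sum_apply]
      refine (sum_coord_smul c.ofConv x).symm.trans (Finset.sum_congr rfl fun n _ => ?_)
      exact mul_comm _ _
    calc j * r = ∑ m, (∑ n, (j * toConv (b.coord m)) (b n) • toConv (b.coord n)) *
          ((pr (antipodeShift l (b m)) : J') : DualAlgebra k H) := by
          rw [Finset.mul_sum]
          refine Finset.sum_congr rfl fun m _ => ?_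
          rw [← mul_assoc, ← e1]
      _ = ∑ n, toConv (b.coord n) * ((pr (∑ m, (j * toConv (b.coord m)) (b n) •
            antipodeShift l (b m)) : J') : DualAlgebra k H) := by
          simp only [Finset.sum_mul, map_sum, map_smul, Submodule.coe_sum, Submodule.coe_smul,
            Finset.mul_sum, smul_mul_assoc, mul_smul_comm]
          exact Finset.sum_comm
      _ = ∑ n, toConv (b.coord n) * antipodeShift l (b n) * j := by
          refine Finset.sum_congr rfl fun n _ => ?_
          rw [antipodeShift_mul hl, hpr' _ (J.mul_mem_left _ hj), mul_assoc]
      _ = j := by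
          rw [← Finset.sum_mul, sum_coord_mul_antipodeShift, h1, one_smul, one_mul]
  refine (Submodule.eq_bot_iff _).2 fun j hj => ?_
  obtain ⟨m, hm⟩ := isNilpotent_of_mem_jacobson (k := k) hr
  have : ∀ m, j * r ^ m = j := by
    intro m
    induction m with
    | zero => simp
    | succ m ih => rw [pow_succ', ← mul_assoc, key j hj, ih]
  rw [← this m, hm, mul_zero]

/-- If the projective cover of the trivial module has zero radical, its idempotent is itself a left
integral of the dual algebra, with value `1` at the unit. -/
theorem SplitSystem.jacobson_eq_bot (S : SplitSystem k (DualAlgebra k H)) {i : Fin S.n}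
    (hi : ∀ a : DualAlgebra k H, a 1 = 0 ↔ S.π a i = 0) (hR : S.rad i = ⊥) :
    Ring.jacobson (DualAlgebra k H) = ⊥ := by
  have h1 : IsGroupLikeElem k (1 : H) := ⟨by simp, by simp [Algebra.TensorProduct.one_def]⟩
  have hE := S.hasType_E i
  refine jacobson_eq_bot_of_integral (l := S.E i) (fun a => ?_) ?_
  · have h2 : a * S.E i - a 1 • S.E i ∈ S.rad i :=
      ⟨sub_mem (Ideal.mul_mem_left _ _ (Ideal.mem_span_singleton_self _)) (by
        rw [Algebra.smul_def]
        exact Ideal.mul_mem_left _ _ (Ideal.mem_span_singleton_self _)),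
        sub_mul_mem_jacobson (χ := evalChar h1) hi hE a⟩
    rw [hR] at h2
    exact sub_eq_zero.1 h2
  · have h2 : (S.E i) 1 * (S.E i) 1 = (S.E i) 1 := by
      conv_rhs => rw [← hE.idem.eq]
      exact (map_mul (evalChar h1) (S.E i) (S.E i)).symm
    have h3 : (S.E i) 1 ≠ 0 := fun h => hE.ne_zero ((hi _).1 h)
    exact mul_left_cancel₀ h3 (h2.trans (mul_one _).symm)

end

end BlockSystem

namespace BlockSystem

open Coalgebra HopfAlgebra WithConv

/-! ### Coefficient coalgebras of the blocks of the dual algebra -/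

section

variable {k H : Type*} [Field k] [Ring H] [HopfAlgebra k H] [FiniteDimensional k H]

omit [FiniteDimensional k H] in
theorem apply_eq_zero_of_isSubcoalgebra {E : Submodule k H} (hE : IsSubcoalgebra E)
    {f g : DualAlgebra k H} (hfg : (∀ x ∈ E, f x = 0) ∨ ∀ x ∈ E, g x = 0) {x : H} (hx : x ∈ E) :
    (f * g) x = 0 := by
  obtain ⟨z, hz⟩ := hE x hx
  rw [conv_apply_tensor, ← hz]
  clear hz
  induction z with
  | zero => simp
  | tmul x y =>
    rcases hfg with h | h
    · have := h x x.2
      simp only [TensorProduct.map_tmul, LinearMap.mul'_apply, Submodule.subtype_apply]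
      exact mul_eq_zero_of_left this _
    · have := h y y.2
      simp only [TensorProduct.map_tmul, LinearMap.mul'_apply, Submodule.subtype_apply]
      exact mul_eq_zero_of_right _ this
  | add x y hx hy => rw [map_add, map_add, map_add, hx, hy, add_zero]

/-- The annihilator of a subcoalgebra. -/
noncomputable def annihilator (E : Submodule k H) (hE : IsSubcoalgebra E) : TwoSidedIdeal (DualAlgebra k H) :=
  TwoSidedIdeal.mk' {f | ∀ x ∈ E, f x = 0} (fun _ _ => rfl)
    (fun {f g} hf hg x hx => by
      change f x + g x = 0
      rw [hf x hx, hg x hx, add_zero])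
    (fun {f} hf x hx => by
      change -(f x) = 0
      rw [hf x hx, neg_zero])
    (fun {f g} hg x hx => apply_eq_zero_of_isSubcoalgebra hE (Or.inr hg) hx)
    (fun {f g} hf x hx => apply_eq_zero_of_isSubcoalgebra hE (Or.inl hf) hx)

omit [FiniteDimensional k H] in
theorem mem_annihilator {E : Submodule k H} {hE : IsSubcoalgebra E} {f : DualAlgebra k H} :
    f ∈ annihilator E hE ↔ ∀ x ∈ E, f x = 0 := TwoSidedIdeal.mem_mk' _ _ _ _ _ _ _

omit [FiniteDimensional k H] in
theorem mem_of_forall_dual {E : Submodule k H} {x : H}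
    (h : ∀ f : DualAlgebra k H, (∀ y ∈ E, f y = 0) → f x = 0) : x ∈ E := by
  by_contra hx
  obtain ⟨f, hf, hE⟩ := Submodule.exists_le_ker_of_notMem hx
  exact hf (h (toConv f) fun y hy => hE hy)

namespace SplitSystem

variable (S : SplitSystem k (DualAlgebra k H))

theorem exists_coeff (l : Fin S.n) (a b : Fin (S.d l)) : ∃ x : H, ∀ f, S.π f l a b = f x :=
  exists_eval_eq (Matrix.entryLinearMap k k a b ∘ₗ (S.proj l).toLinearMap)

/-- The matrix coefficients of the `l`-th block. -/
noncomputable def coeff (l : Fin S.n) (a b : Fin (S.d l)) : H := (S.exists_coeff l a b).choose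

theorem π_apply (l : Fin S.n) (a b : Fin (S.d l)) (f : DualAlgebra k H) :
    S.π f l a b = f (S.coeff l a b) := (S.exists_coeff l a b).choose_spec f

theorem comul_coeff (l : Fin S.n) (a b : Fin (S.d l)) :
    comul (R := k) (S.coeff l a b) = ∑ c, S.coeff l a c ⊗ₜ[k] S.coeff l c b := by
  refine tensor_ext fun f g => ?_
  have h := S.π_apply l a b (toConv f * toConv g)
  rw [map_mul, Pi.mul_apply, Matrix.mul_apply, conv_apply_tensor] at h
  simp only [π_apply] at h
  simpa using h.symm

/-- The span of the matrix coefficients of the `l`-th block. -/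
noncomputable def coeffSpace (l : Fin S.n) : Submodule k H :=
  Submodule.span k (Set.range fun s : Fin (S.d l) × Fin (S.d l) => S.coeff l s.1 s.2)

theorem coeff_mem (l : Fin S.n) (a b : Fin (S.d l)) : S.coeff l a b ∈ S.coeffSpace l :=
  Submodule.subset_span ⟨(a, b), rfl⟩

theorem π_eq_zero_iff (l : Fin S.n) (f : DualAlgebra k H) :
    S.π f l = 0 ↔ ∀ x ∈ S.coeffSpace l, f x = 0 := by
  constructor
  · intro h x hx
    induction hx using Submodule.span_induction with
    | mem x hx =>
      obtain ⟨s, rfl⟩ := hx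
      change f (S.coeff l s.1 s.2) = 0
      rw [← π_apply, h]; rfl
    | zero => exact map_zero f.ofConv
    | add x y _ _ hx hy =>
      change f.ofConv (x + y) = 0
      rw [map_add]
      exact (congrArg₂ (· + ·) hx hy).trans (add_zero _)
    | smul c x _ hx =>
      change f.ofConv (c • x) = 0
      rw [map_smul]
      exact (congrArg (c • ·) hx).trans (smul_zero _)
  · intro h
    ext a b
    rw [π_apply]
    exact h _ (S.coeff_mem l a b)

theorem linearIndependent_coeff (l : Fin S.n) :
    LinearIndependent k fun s : Fin (S.d l) × Fin (S.d l) => S.coeff l s.1 s.2 := by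
  rw [Fintype.linearIndependent_iff]
  rintro c hc ⟨a, b⟩
  obtain ⟨f, hf⟩ := S.proj_surjective l (Matrix.single a b 1)
  have h1 := congrArg f.ofConv hc
  rw [map_sum, map_zero, Finset.sum_eq_single (a, b)] at h1
  · rw [map_smul] at h1
    have h2 : f.ofConv (S.coeff l a b) = 1 := by
      refine (S.π_apply l a b f).symm.trans ?_
      rw [← proj_apply, hf, Matrix.single_apply_same]
    rw [h2] at h1
    simpa using h1
  · rintro ⟨a', b'⟩ - hne
    have h2 : f.ofConv (S.coeff l a' b') = 0 := by
      refine (S.π_apply l a' b' f).symm.trans ?_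
      rw [← proj_apply, hf, Matrix.single_apply_of_ne]
      rintro ⟨rfl, rfl⟩
      exact hne rfl
    rw [map_smul, h2, smul_zero]
  · simp

theorem finrank_coeffSpace (l : Fin S.n) :
    Module.finrank k (S.coeffSpace l) = S.d l * S.d l := by
  rw [coeffSpace, finrank_span_eq_card (S.linearIndependent_coeff l)]
  simp

theorem isSubcoalgebra_coeffSpace (l : Fin S.n) : IsSubcoalgebra (S.coeffSpace l) := by
  intro x hx
  induction hx using Submodule.span_induction with
  | mem x hx =>
    obtain ⟨⟨a, b⟩, rfl⟩ := hx
    rw [S.comul_coeff l a b]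
    exact sum_mem fun c _ => ⟨⟨_, S.coeff_mem l a c⟩ ⊗ₜ ⟨_, S.coeff_mem l c b⟩, rfl⟩
  | zero => simp
  | add x y _ _ hx hy => rw [map_add]; exact add_mem hx hy
  | smul c x _ hx => rw [map_smul]; exact Submodule.smul_mem _ _ hx

theorem isSimpleSubcoalgebra_coeffSpace (l : Fin S.n) : IsSimpleSubcoalgebra (S.coeffSpace l) where
  isSubcoalgebra := S.isSubcoalgebra_coeffSpace l
  ne_bot h := by
    have h1 := S.finrank_coeffSpace l
    rw [h, finrank_bot] at h1
    exact (Nat.mul_pos (S.d_pos l) (S.d_pos l)).ne h1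
  eq_bot_or_eq E hED hE := by
    have : Nonempty (Fin (S.d l)) := ⟨⟨0, S.d_pos l⟩⟩
    by_contra! hc
    obtain ⟨x, hx, hxE⟩ := Set.not_subset.1 fun h => hc.2 (le_antisymm hED h)
    obtain ⟨f, hfE, hfx⟩ : ∃ f : DualAlgebra k H, (∀ y ∈ E, f y = 0) ∧ f x ≠ 0 := by
      by_contra! h
      exact hxE (mem_of_forall_dual h)
    obtain ⟨y, hy, hy1⟩ := exists_mem_map_eq_one (q := (S.proj l).toRingHom) (S.proj_surjective l)
      (annihilator E hE) (c := f) (mem_annihilator.2 hfE) fun h =>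
        hfx ((S.π_eq_zero_iff l f).1 h x hx)
    have hy1 : S.π y l = 1 := hy1
    refine hc.1 ((Submodule.eq_bot_iff _).2 fun z hz =>
      eq_of_forall_dual (k := k) fun f => ?_)
    have h1 : S.π (f - f * y) l = 0 := by
      rw [map_sub, map_mul, Pi.sub_apply, Pi.mul_apply, hy1, mul_one, sub_self]
    have h2 : f z - (f * y) z = 0 := (S.π_eq_zero_iff l _).1 h1 z (hED hz)
    rw [map_zero, ← h2, mem_annihilator.1 ((annihilator E hE).mul_mem_left f y hy) z hz, sub_zero]

include S in
-- A functional that vanishes on all coefficient coalgebras is killed by every block, so it lies in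
-- the radical.
theorem isCosemisimple_of_jacobson_eq_bot (h : Ring.jacobson (DualAlgebra k H) = ⊥) :
    IsCosemisimple k H := by
  refine (Submodule.eq_top_iff').2 fun x => mem_of_forall_dual fun f hf => ?_
  have h1 : S.π f = 0 := funext fun l => (S.π_eq_zero_iff l f).2 fun y hy =>
    hf y (le_sSup (a := S.coeffSpace l) (S.isSimpleSubcoalgebra_coeffSpace l) hy)
  have h2 : f = 0 := by
    have := (S.π_eq_zero f).1 h1
    rwa [h] at this
  rw [h2]; rfl

theorem mul_mem_coeffSpace {g : GroupLike k H} {l : Fin S.n} (hl : S.perm (translate g) l = l)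
    {x : H} (hx : x ∈ S.coeffSpace l) : g.val * x ∈ S.coeffSpace l := by
  refine mem_of_forall_dual fun f hf => ?_
  have h1 := (S.perm_spec (translate g) l f).2 (by rw [hl]; exact (S.π_eq_zero_iff l f).2 hf)
  exact (S.π_eq_zero_iff l _).1 h1 x hx

end SplitSystem

end

/-! ### Traces of operators of prime order -/

section

variable {k V : Type*} [Field k] [CharZero k] [AddCommGroup V] [Module k V]
  [FiniteDimensional k V] {T : Module.End k V} {p : ℕ}

omit [CharZero k] [FiniteDimensional k V] in
theorem mul_geom_average (hT : T ^ p = 1) :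
    T * ((p : k)⁻¹ • ∑ i ∈ Finset.range p, T ^ i) = (p : k)⁻¹ • ∑ i ∈ Finset.range p, T ^ i := by
  rw [mul_smul_comm]
  congr 1
  have h := mul_neg_geom_sum T p
  rw [hT, sub_self, sub_mul, one_mul, sub_eq_zero] at h
  exact h.symm

omit [FiniteDimensional k V] in
theorem isIdempotentElem_geom_average (hp : p ≠ 0) (hT : T ^ p = 1) :
    IsIdempotentElem ((p : k)⁻¹ • ∑ i ∈ Finset.range p, T ^ i) := by
  set e := (p : k)⁻¹ • ∑ i ∈ Finset.range p, T ^ i with he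
  have h1 : ∀ i, T ^ i * e = e := by
    intro i
    induction i with
    | zero => simp
    | succ i ih => rw [pow_succ', mul_assoc, ih, mul_geom_average hT]
  have h2 : (∑ i ∈ Finset.range p, T ^ i) * e = (p : k) • e := by
    rw [Finset.sum_mul, Finset.sum_congr rfl fun i _ => h1 i, Finset.sum_const, Finset.card_range,
      Nat.cast_smul_eq_nsmul]
  have hp' : (p : k) ≠ 0 := Nat.cast_ne_zero.2 hp
  change e * e = e
  conv_lhs => lhs; rw [he]
  rw [smul_mul_assoc, h2, smul_smul, inv_mul_cancel₀ hp', one_smul]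

/-- The average of the powers of `T` is a projection; its rank equals its trace, which is `dim V /
p`. -/
theorem dvd_finrank_of_trace_pow_eq_zero (hp : p ≠ 0) (hT : T ^ p = 1)
    (h : ∀ i, 0 < i → i < p → LinearMap.trace k V (T ^ i) = 0) : p ∣ Module.finrank k V := by
  have hp' : (p : k) ≠ 0 := Nat.cast_ne_zero.2 hp
  have h1 := LinearMap.IsIdempotentElem.isProj_range _ (isIdempotentElem_geom_average hp hT)
  have h2 := h1.trace
  rw [map_smul, map_sum, Finset.sum_eq_single 0, pow_zero, LinearMap.trace_one, smul_eq_mul,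
    inv_mul_eq_iff_eq_mul₀ hp'] at h2
  · exact ⟨_, by exact_mod_cast h2⟩
  · intro i hi hi0
    exact h i (Nat.pos_of_ne_zero hi0) (Finset.mem_range.1 hi)
  · intro h0
    exact absurd (Finset.mem_range.2 (Nat.pos_of_ne_zero hp)) h0

variable [IsAlgClosed k]

/-- An algebraic substitute for the triangle inequality. Write the roots as `ζ ^ a r` with `a r <
p`; then `∑ (X ^ a r - 1)` vanishes at `ζ`, so by degree it is a constant multiple of the cyclotomic
polynomial. It vanishes at `1`, where that polynomial has value `p`; hence it is zero. -/
theorem eq_one_of_sum_eq_card (hp : p.Prime) {s : Multiset k} (hs : ∀ r ∈ s, r ^ p = 1)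
    (h : s.sum = s.card) : ∀ r ∈ s, r = 1 := by
  have : NeZero (p : k) := ⟨Nat.cast_ne_zero.2 hp.ne_zero⟩
  obtain ⟨ζ, hζ⟩ := HasEnoughRootsOfUnity.exists_primitiveRoot k p
  have h1 : ∀ r : k, ∃ a < p, r ∈ s → ζ ^ a = r := by
    intro r
    by_cases hr : r ∈ s
    · have : NeZero p := ⟨hp.ne_zero⟩
      obtain ⟨a, ha, h⟩ := hζ.eq_pow_of_pow_eq_one (hs r hr)
      exact ⟨a, ha, fun _ => h⟩
    · exact ⟨0, hp.pos, fun h => absurd h hr⟩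
  choose a hap ha using h1
  let P : Polynomial ℚ := (s.map fun r => (Polynomial.X ^ a r - 1 : Polynomial ℚ)).sum
  have hP0 : Polynomial.aeval ζ P = 0 := by
    rw [map_multiset_sum, Multiset.map_map]
    have : s.map (Polynomial.aeval ζ ∘ fun r => (Polynomial.X ^ a r - 1 : Polynomial ℚ)) =
        s.map fun r => r - 1 := Multiset.map_congr rfl fun r hr => by simp [ha r hr]
    rw [this, Multiset.sum_map_sub]
    simp [h]
  have hdvd : Polynomial.cyclotomic p ℚ ∣ P := by
    rw [Polynomial.cyclotomic_eq_minpoly_rat hζ hp.pos]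
    exact minpoly.dvd ℚ ζ hP0
  have hP1 : P.eval 1 = 0 := by
    rw [← Polynomial.coe_evalRingHom, map_multiset_sum, Multiset.map_map]
    refine Multiset.sum_eq_zero fun x hx => ?_
    obtain ⟨r, -, rfl⟩ := Multiset.mem_map.1 hx
    simp
  have hP : P = 0 := by
    obtain ⟨Q, hQ⟩ := hdvd
    by_contra hne
    have hQ0 : Q ≠ 0 := by rintro rfl; exact hne (by rw [hQ, mul_zero])
    have hdeg : P.natDegree ≤ p - 1 := by
      have hmem : P ∈ Polynomial.degreeLT ℚ p := by
        refine multiset_sum_mem _ fun x hx => ?_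
        obtain ⟨r, -, rfl⟩ := Multiset.mem_map.1 hx
        refine sub_mem (Polynomial.mem_degreeLT.2 ?_) (Polynomial.mem_degreeLT.2 ?_)
        · rw [Polynomial.degree_X_pow]
          exact_mod_cast hap r
        · rw [Polynomial.degree_one]
          exact_mod_cast hp.pos
      have := (Polynomial.natDegree_lt_iff_degree_lt hne).2 (Polynomial.mem_degreeLT.1 hmem)
      omega
    have hdeg' := congrArg Polynomial.natDegree hQ
    rw [Polynomial.natDegree_mul (Polynomial.cyclotomic_ne_zero p ℚ) hQ0,
      Polynomial.natDegree_cyclotomic, Nat.totient_prime hp] at hdeg'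
    have hQd : Q.natDegree = 0 := by omega
    have h3 := congrArg (Polynomial.eval 1) hQ
    have : Fact p.Prime := ⟨hp⟩
    rw [hP1, Polynomial.eval_mul, Polynomial.eval_one_cyclotomic_prime] at h3
    have h4 : Q.eval 1 = 0 :=
      (mul_eq_zero.1 h3.symm).resolve_left (Nat.cast_ne_zero.2 hp.ne_zero)
    rw [Polynomial.eq_C_of_natDegree_eq_zero hQd, Polynomial.eval_C] at h4
    exact hQ0 (by rw [Polynomial.eq_C_of_natDegree_eq_zero hQd, h4, Polynomial.C_0])
  -- The derivative at `1` of the zero polynomial is the sum of the exponents.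
  have hsum : (s.map a).sum = 0 := by
    have h5 := congrArg (fun P : Polynomial ℚ => P.derivative.eval 1) hP
    simp only [Polynomial.derivative_zero, Polynomial.eval_zero] at h5
    rw [← Polynomial.coe_evalRingHom, map_multiset_sum, Multiset.map_map, map_multiset_sum,
      Multiset.map_map] at h5
    have : s.map (Polynomial.evalRingHom 1 ∘ (Polynomial.derivative (R := ℚ)) ∘
        fun r => (Polynomial.X ^ a r - 1 : Polynomial ℚ)) = s.map fun r => (a r : ℚ) :=
      Multiset.map_congr rfl fun r hr => by simp [Polynomial.derivative_X_pow]
    rw [this] at h5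
    have h6 : (((s.map a).sum : ℕ) : ℚ) = 0 := by
      rw [Nat.cast_multiset_sum, Multiset.map_map]; exact h5
    exact_mod_cast h6
  intro r hr
  have h7 : a r = 0 := Multiset.sum_eq_zero_iff.1 hsum _ (Multiset.mem_map_of_mem a hr)
  rw [← ha r hr, h7, pow_zero]

theorem eq_one_of_trace_eq_finrank (hp : p.Prime) (hT : T ^ p = 1)
    (h : LinearMap.trace k V T = Module.finrank k V) : T = 1 := by
  have hsplit : T.charpoly.Splits := IsAlgClosed.splits _
  have hcard : T.charpoly.roots.card = Module.finrank k V := by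
    rw [← hsplit.natDegree_eq_card_roots, LinearMap.charpoly_natDegree]
  have h1 : ∀ r ∈ T.charpoly.roots, r = 1 := by
    refine eq_one_of_sum_eq_card hp (fun r hr => ?_) ?_
    · have hev : T.HasEigenvalue r :=
        (Module.End.hasEigenvalue_iff_isRoot_charpoly T r).2 (Polynomial.isRoot_of_mem_roots hr)
      obtain ⟨v, hv⟩ := hev.exists_hasEigenvector
      have h2 : (T ^ p) v = r ^ p • v := hv.pow_apply p
      rw [hT, Module.End.one_apply] at h2
      have h3 : (1 - r ^ p) • v = 0 := by rw [sub_smul, one_smul, ← h2, sub_self]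
      exact (sub_eq_zero.1 ((smul_eq_zero.1 h3).resolve_right hv.2)).symm
    · rw [hcard, ← h]
      exact (Module.End.trace_eq_sum_roots_charpoly_of_splits hsplit).symm
  have h2 : T.charpoly = (Polynomial.X - Polynomial.C 1) ^ Module.finrank k V := by
    rw [hsplit.eq_prod_roots_of_monic T.charpoly_monic, Multiset.eq_replicate.2 ⟨hcard, h1⟩]
    simp
  have h3 : (T - 1) ^ Module.finrank k V = 0 := by
    have := T.aeval_self_charpoly
    rw [h2] at this
    simpa using this
  set e := (p : k)⁻¹ • ∑ i ∈ Finset.range p, T ^ i with he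
  have hTe : T * e = e := mul_geom_average hT
  have hie : IsIdempotentElem (1 - e) := (isIdempotentElem_geom_average hp.ne_zero hT).one_sub
  -- `1 - e` is idempotent, and as a multiple of the nilpotent `T - 1` it is also nilpotent; so `e =
  -- 1`, and `T e = e` gives `T = 1`.
  have hfac : ∃ Q : Module.End k V, 1 - e = (T - 1) * Q ∧ Commute (T - 1) Q := by
    refine ⟨-((p : k)⁻¹ • ∑ i ∈ Finset.range p, ∑ j ∈ Finset.range i, T ^ j), ?_, ?_⟩
    · have : ∀ i, (T - 1) * ∑ j ∈ Finset.range i, T ^ j = T ^ i - 1 := fun i => mul_geom_sum T i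
      rw [mul_neg, mul_smul_comm, Finset.mul_sum, Finset.sum_congr rfl fun i _ => this i,
        Finset.sum_sub_distrib, smul_sub, ← he]
      rw [Finset.sum_const, Finset.card_range, ← Nat.cast_smul_eq_nsmul k, smul_smul,
        inv_mul_cancel₀ (Nat.cast_ne_zero.2 hp.ne_zero), one_smul, neg_sub]
    · refine Commute.neg_right (Commute.smul_right (Commute.sum_right _ _ _ fun i _ =>
        Commute.sum_right _ _ _ fun j _ => ?_) _)
      exact ((Commute.refl T).pow_right j).sub_left (Commute.one_left _)
  obtain ⟨Q, hQ, hcomm⟩ := hfac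
  have h4 : 1 - e = 0 := by
    have h5 : (1 - e) ^ (Module.finrank k V + 1) = 0 := by
      rw [hQ, hcomm.mul_pow, pow_succ, h3, zero_mul, zero_mul]
    rwa [hie.pow_succ_eq] at h5
  rw [← sub_eq_zero.1 h4, mul_one] at hTe
  exact hTe

end

/-! ### Blocks fixed by translation -/

section

variable {k H : Type*} [Field k] [Ring H] [HopfAlgebra k H]

/-- The map `u ⊗ v ↦ f(u) (1 ⊗ v)`. -/
noncomputable def twist (f : H →ₗ[k] H ⊗[k] H) : H ⊗[k] H →ₗ[k] H ⊗[k] H :=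
  TensorProduct.lift ((LinearMap.mul k (H ⊗[k] H)).compl₁₂ f (inclRight k H))

theorem twist_tmul (f : H →ₗ[k] H ⊗[k] H) (u v : H) :
    twist f (u ⊗ₜ v) = f u * ((1 : H) ⊗ₜ[k] v) := rfl

theorem twist_mul (f : H →ₗ[k] H ⊗[k] H) (z : H ⊗[k] H) (v : H) :
    twist f (z * ((1 : H) ⊗ₜ[k] v)) = twist f z * ((1 : H) ⊗ₜ[k] v) := by
  induction z with
  | zero => simp
  | tmul x y => simp [twist_tmul, mul_assoc]
  | add x y hx hy => simp [add_mul, hx, hy]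

theorem twist_comul_apply (f : H →ₗ[k] H ⊗[k] H) (x : H) :
    twist f (comul x) = (toConv f * toConv (inclRight k H) : WithConv (H →ₗ[k] H ⊗[k] H)) x := by
  rw [(ℛ k x).convMul_apply]
  conv_lhs => rw [← (ℛ k x).eq]
  rw [map_sum]
  rfl

/-- `u ⊗ v ↦ u₁ ⊗ u₂ v` is the Galois map, with left inverse `u ⊗ v ↦ u₁ ⊗ S(u₂) v`. -/
theorem twist_comul_injective : Function.Injective (twist (comul : H →ₗ[k] H ⊗[k] H)) := by
  refine Function.LeftInverse.injective
    (g := twist (toConv (inclLeft k H) * toConv (inclRight k H ∘ₗ antipode k) :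
      WithConv (H →ₗ[k] H ⊗[k] H)).ofConv) fun z => ?_
  induction z with
  | zero => simp
  | tmul x y =>
    have : toConv (inclRight k H ∘ₗ antipode k) * toConv (inclRight k H) =
      (1 : WithConv (H →ₗ[k] H ⊗[k] H)) :=
      conv_antipode_mul (Algebra.TensorProduct.includeRight : H →ₐ[k] H ⊗[k] H)
    rw [twist_tmul, twist_mul, twist_comul_apply, toConv_ofConv, mul_assoc, this, mul_one]
    simp
  | add x y hx hy => rw [map_add, map_add, hx, hy]

variable [FiniteDimensional k H]

/-- The Galois map restricts to an automorphism of `D ⊗ H` and conjugates `T ⊗ id` into `T ⊗ L_g`,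
so both have the same trace. -/
theorem trace_mul_finrank {D : Submodule k H} (hD : IsSubcoalgebra D) {g : H}
    (hg : IsGroupLikeElem k g) {T : Module.End k D} (hT : ∀ x : D, (T x : H) = g * x) :
    LinearMap.trace k D T * Module.finrank k H =
      LinearMap.trace k D T * LinearMap.trace k H (LinearMap.mulLeft k g) := by
  obtain ⟨q, hq⟩ := exists_retraction D
  let ι : D ⊗[k] H →ₗ[k] H ⊗[k] H := TensorProduct.map D.subtype LinearMap.id
  let κ : H ⊗[k] H →ₗ[k] D ⊗[k] H := TensorProduct.map q LinearMap.id
  have hκι : ∀ z, κ (ι z) = z := by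
    intro z
    induction z with
    | zero => simp
    | tmul x y =>
      have : q x = x := Subtype.ext (hq x x.2)
      simp [κ, ι, this]
    | add x y hx hy => rw [map_add, map_add, hx, hy]
  have hιi : Function.Injective ι := Function.LeftInverse.injective hκι
  have hmem : ∀ z, twist comul (ι z) ∈ LinearMap.range ι := by
    intro z
    induction z with
    | zero => simp
    | tmul x y =>
      obtain ⟨w, hw⟩ := hD x x.2
      change twist comul ((x : H) ⊗ₜ[k] y) ∈ _
      rw [twist_tmul, ← hw]
      clear hw
      induction w with
      | zero => simp
      | tmul u v => exact ⟨u ⊗ₜ ((v : H) * y), by simp [ι]⟩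
      | add u v hu hv => rw [map_add, add_mul]; exact add_mem hu hv
    | add x y hx hy => rw [map_add, map_add]; exact add_mem hx hy
  let Φ : D ⊗[k] H →ₗ[k] D ⊗[k] H := κ ∘ₗ twist comul ∘ₗ ι
  have hιΦ : ∀ z, ι (Φ z) = twist comul (ι z) := by
    intro z
    obtain ⟨w, hw⟩ := hmem z
    change ι (κ (twist comul (ι z))) = _
    rw [← hw, hκι]
  have hΦi : Function.Injective Φ := fun z w h => by
    refine hιi (twist_comul_injective ?_)
    rw [← hιΦ, ← hιΦ, h]
  let e : (D ⊗[k] H) ≃ₗ[k] D ⊗[k] H := 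
    LinearEquiv.ofBijective Φ ⟨hΦi, (LinearMap.injective_iff_surjective (K := k) (V := D ⊗[k] H)).1 hΦi⟩
  let L : Module.End k H := LinearMap.mulLeft k g
  have hιT : ∀ z, ι (TensorProduct.map T LinearMap.id z) = (g ⊗ₜ[k] (1 : H)) * ι z := by
    intro z
    induction z with
    | zero => simp
    | tmul x y => simp [ι, hT]
    | add x y hx hy => rw [map_add, map_add, hx, hy, map_add, mul_add]
  have hιTL : ∀ z, ι (TensorProduct.map T L z) = (g ⊗ₜ[k] g) * ι z := by
    intro z
    induction z with
    | zero => simp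
    | tmul x y => simp [ι, hT, L]
    | add x y hx hy => rw [map_add, map_add, hx, hy, map_add, mul_add]
  have htw : ∀ z, twist comul ((g ⊗ₜ[k] (1 : H)) * z) = (g ⊗ₜ[k] g) * twist comul z := by
    intro z
    induction z with
    | zero => simp
    | tmul x y =>
      rw [Algebra.TensorProduct.tmul_mul_tmul, one_mul, twist_tmul, twist_tmul,
        Bialgebra.comul_mul, hg.comul_eq_tmul_self, mul_assoc]
    | add x y hx hy => rw [mul_add, map_add, hx, hy, map_add, mul_add]
  have hconj : e.conj (TensorProduct.map T LinearMap.id) = TensorProduct.map T L := by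
    refine LinearMap.ext fun z => ?_
    obtain ⟨w, rfl⟩ := e.surjective z
    rw [LinearEquiv.conj_apply_apply, LinearEquiv.symm_apply_apply]
    refine hιi ?_
    change ι (Φ _) = ι (TensorProduct.map T L (Φ w))
    rw [hιΦ, hιT, htw, hιTL, hιΦ]
  have h1 := LinearMap.trace_conj' (R := k) (M := D ⊗[k] H) (N := D ⊗[k] H)
    (TensorProduct.map T LinearMap.id) e
  rw [hconj, LinearMap.trace_tensorProduct', LinearMap.trace_tensorProduct', LinearMap.trace_id]
    at h1
  exact h1.symm

/-- On the coefficient coalgebra of a fixed block the nontrivial powers of `g` have trace zero: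
otherwise `trace_mul_finrank` would give `L_{g^i}` trace `dim H`, hence `g ^ i = 1`. So `p` divides
`d²`. -/
theorem SplitSystem.dvd_d_of_perm_eq [CharZero k] [IsAlgClosed k]
    (S : SplitSystem k (DualAlgebra k H)) {p : ℕ} (hp : p.Prime) {g : GroupLike k H}
    (hg : orderOf g = p) {l : Fin S.n} (hl : S.perm (translate g) l = l) : p ∣ S.d l := by
  let T : Module.End k (S.coeffSpace l) :=
    (LinearMap.mulLeft k g.val).restrict fun x hx => S.mul_mem_coeffSpace hl hx
  have hT : ∀ i (x : S.coeffSpace l), ((T ^ i) x : H) = (g ^ i).val * x := by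
    intro i x
    induction i with
    | zero => simp
    | succ i ih =>
      rw [pow_succ', Module.End.mul_apply]
      change g.val * ((T ^ i) x : H) = _
      rw [ih, ← mul_assoc, ← GroupLike.val_mul, ← pow_succ']
  have hTp : T ^ p = 1 := by
    ext x
    rw [hT, ← hg, pow_orderOf_eq_one]
    simp
  have h := dvd_finrank_of_trace_pow_eq_zero hp.ne_zero hTp fun i hi hip => by
    by_contra hne
    have h1 := trace_mul_finrank (S.isSubcoalgebra_coeffSpace l) (g ^ i).2 (hT i)
    have h2 := mul_left_cancel₀ hne h1
    have h3 : LinearMap.mulLeft k (g ^ i).val = 1 := by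
      refine eq_one_of_trace_eq_finrank hp ?_ h2.symm
      ext x
      rw [LinearMap.pow_mulLeft, LinearMap.mulLeft_apply, ← GroupLike.val_pow, ← pow_mul, mul_comm,
        pow_mul, ← hg, pow_orderOf_eq_one]
      simp
    have h4 : g ^ i = 1 := by
      refine GroupLike.ext ?_
      have := LinearMap.congr_fun h3 1
      simpa using this
    exact Nat.not_dvd_of_pos_of_lt hi hip (hg ▸ orderOf_dvd_of_pow_eq_one h4)
  rw [S.finrank_coeffSpace] at h
  exact (hp.dvd_mul.1 h).elim id id

end

end BlockSystem

namespace BlockSystem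

/-! ### Combinatorics of the Cartan matrix -/

/-- The numerical data attached to the blocks of the dual algebra: dimensions `d` of the simple
modules, Cartan matrix `c`, the action `ρ` of a generator of the group of group-like elements, the
Nakayama permutation `ν` and the trivial module `i₀`. -/
structure CartanData (I : Type*) [Fintype I] [DecidableEq I] (p : ℕ) where
  prime : p.Prime
  d : I → ℕ
  c : I → I → ℕ
  ρ : Equiv.Perm I
  ν : Equiv.Perm I
  i₀ : I
  ρ_pow : ρ ^ p = 1
  d_ρ : ∀ i, d (ρ i) = d i
  c_ρ : ∀ i j, c (ρ i) (ρ j) = c i j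
  d_ν : ∀ i, d (ν i) = d i
  c_ν : ∀ i j, c i j = c j (ν i)
  d_pos : ∀ i, 0 < d i
  d_i₀ : d i₀ = 1
  linear : ∀ i, d i = 1 → ∃ m : ℕ, i = (ρ ^ m) i₀
  ρ_i₀ : ρ i₀ ≠ i₀
  proj_or : ∀ j, (∀ i, c i j = if i = j then 1 else 0) ∨ 2 ≤ ∑ i with d i = d j, c i j
  dvd_d : ∀ j, ρ j = j → p ∣ d j
  two_le_x : 2 ≤ ∑ i with d i = 1, c i i₀
  one_le_v : 1 ≤ ∑ i with 1 < d i, c i i₀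
  loewy : 3 ≤ ∑ i with d i = 1, c i i₀ → 2 ≤ ∑ i with 1 < d i, c i i₀ ∧
    (∑ i with 1 < d i, c i i₀ = 2 → ∃ l, 1 < d l ∧ 1 ≤ c l i₀ ∧ 3 ≤ ∑ i with 1 < d i, c i l)

namespace CartanData

variable {I : Type*} [Fintype I] [DecidableEq I] {p : ℕ} (D : CartanData I p)

/-- The orbit of `j` under the group-like elements. -/
def orb (j : I) : Finset I := (Finset.range p).image fun m => (D.ρ ^ m) j

theorem mem_orb_self (j : I) : j ∈ D.orb j :=
  Finset.mem_image.2 ⟨0, Finset.mem_range.2 D.prime.pos, rfl⟩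

theorem apply_mem_orb {i j : I} (h : i ∈ D.orb j) : D.ρ i ∈ D.orb j := by
  obtain ⟨m, hm, rfl⟩ := Finset.mem_image.1 h
  have hm := Finset.mem_range.1 hm
  rcases Nat.lt_or_ge (m + 1) p with h1 | h1
  · exact Finset.mem_image.2 ⟨m + 1, Finset.mem_range.2 h1, by rw [pow_succ']; rfl⟩
  · have : m + 1 = p := by omega
    have h2 : D.ρ ((D.ρ ^ m) j) = j := by
      rw [← Equiv.Perm.mul_apply, ← pow_succ', this, D.ρ_pow, Equiv.Perm.one_apply]
    rw [h2]
    exact D.mem_orb_self j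

theorem pow_apply_mem {F : Finset I} (hF : ∀ i ∈ F, D.ρ i ∈ F) {j : I} (hj : j ∈ F) (m : ℕ) :
    (D.ρ ^ m) j ∈ F := by
  induction m with
  | zero => exact hj
  | succ m ih => rw [pow_succ']; exact hF _ ih

theorem orb_subset {F : Finset I} (hF : ∀ i ∈ F, D.ρ i ∈ F) {j : I} (hj : j ∈ F) :
    D.orb j ⊆ F := by
  intro i hi
  obtain ⟨m, -, rfl⟩ := Finset.mem_image.1 hi
  exact D.pow_apply_mem hF hj m

theorem pow_mem_orb (j : I) (m : ℕ) : (D.ρ ^ m) j ∈ D.orb j :=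
  D.pow_apply_mem (fun _ => D.apply_mem_orb) (D.mem_orb_self j) m

theorem eq_of_mem_orb {β : Type*} {f : I → β} (hf : ∀ i, f (D.ρ i) = f i) {i j : I}
    (h : i ∈ D.orb j) : f i = f j := by
  obtain ⟨m, -, rfl⟩ := Finset.mem_image.1 h
  clear h
  induction m with
  | zero => rfl
  | succ m ih => rw [pow_succ', Equiv.Perm.mul_apply, hf, ih]

theorem orb_symm {i j : I} (h : i ∈ D.orb j) : j ∈ D.orb i := by
  obtain ⟨m, hm, rfl⟩ := Finset.mem_image.1 h
  have hm := Finset.mem_range.1 hm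
  have : (D.ρ ^ (p - m)) ((D.ρ ^ m) j) = j := by
    rw [← Equiv.Perm.mul_apply, ← pow_add, Nat.sub_add_cancel hm.le, D.ρ_pow, Equiv.Perm.one_apply]
  have h2 := D.pow_mem_orb ((D.ρ ^ m) j) (p - m)
  rwa [this] at h2

theorem sdiff_orb {F : Finset I} (hF : ∀ i ∈ F, D.ρ i ∈ F) (j : I) :
    ∀ i ∈ F \ D.orb j, D.ρ i ∈ F \ D.orb j := by
  intro i hi
  rw [Finset.mem_sdiff] at hi ⊢
  refine ⟨hF i hi.1, fun h => hi.2 ?_⟩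
  have h1 := D.orb_subset (fun _ => D.apply_mem_orb) h
  exact h1 (D.orb_symm (D.apply_mem_orb (D.mem_orb_self i)))

theorem orb_eq_singleton {j : I} (hj : D.ρ j = j) : D.orb j = {j} := by
  refine Finset.Subset.antisymm (D.orb_subset ?_ (Finset.mem_singleton_self j)) ?_
  · intro i hi
    rw [Finset.mem_singleton] at hi ⊢
    rw [hi, hj]
  · exact Finset.singleton_subset_iff.2 (D.mem_orb_self j)

theorem sum_orb {j : I} (hj : D.ρ j ≠ j) {f : I → ℕ} (hf : ∀ i, f (D.ρ i) = f i) :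
    ∑ i ∈ D.orb j, f i = p * f j := by
  have hper : Function.minimalPeriod D.ρ j = p := by
    have h1 : Function.IsPeriodicPt D.ρ p j := by
      change D.ρ^[p] j = j
      rw [Equiv.Perm.iterate_eq_pow, D.ρ_pow, Equiv.Perm.one_apply]
    refine (D.prime.eq_one_or_self_of_dvd _ h1.minimalPeriod_dvd).resolve_left fun h => hj ?_
    exact Function.minimalPeriod_eq_one_iff_isFixedPt.1 h
  rw [Finset.sum_congr rfl fun i hi => D.eq_of_mem_orb hf hi, Finset.sum_const, smul_eq_mul, orb,
    Finset.card_image_of_injOn, Finset.card_range]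
  intro a ha b hb hab
  have := Function.iterate_injOn_Iio_minimalPeriod (f := D.ρ) (x := j)
  rw [hper] at this
  refine this (by simpa using ha) (by simpa using hb) ?_
  simpa [Equiv.Perm.iterate_eq_pow] using hab

/-- The nonlinear simple modules. -/
def N : Finset I := Finset.univ.filter fun i => 1 < D.d i

theorem mem_N {i : I} : i ∈ D.N ↔ 1 < D.d i := by simp [N]

theorem N_invariant : ∀ i ∈ D.N, D.ρ i ∈ D.N := fun i hi => by
  rw [mem_N, D.d_ρ]; exact D.mem_N.1 hi

theorem sum_N_ρ (f : I → ℕ) : ∑ i ∈ D.N, f (D.ρ i) = ∑ i ∈ D.N, f i :=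
  Finset.sum_equiv D.ρ (fun i => by rw [mem_N, mem_N, D.d_ρ]) fun _ _ => rfl

/-- The number of nonlinear constituents of the `j`-th projective. -/
def u (j : I) : ℕ := ∑ i ∈ D.N, D.c i j

/-- The dimension of the nonlinear part of the `j`-th projective. -/
def q (j : I) : ℕ := ∑ i ∈ D.N, D.d i * D.c i j

theorem u_ρ (j : I) : D.u (D.ρ j) = D.u j := by
  rw [u, ← D.sum_N_ρ]
  simp only [D.c_ρ]
  rfl

theorem q_ρ (j : I) : D.q (D.ρ j) = D.q j := by
  rw [q, ← D.sum_N_ρ]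
  simp only [D.c_ρ, D.d_ρ]
  rfl

/-- The number of linear constituents of the projective cover of the trivial module. -/
def x : ℕ := ∑ i with D.d i = 1, D.c i D.i₀

theorem linear_eq_orb : (Finset.univ.filter fun i => D.d i = 1) = D.orb D.i₀ := by
  ext i
  simp only [Finset.mem_filter, Finset.mem_univ, true_and]
  constructor
  · intro h
    obtain ⟨m, rfl⟩ := D.linear i h
    exact D.pow_mem_orb _ _
  · intro h
    rw [D.eq_of_mem_orb D.d_ρ h, D.d_i₀]

theorem sum_linear {f : I → ℕ} (hf : ∀ i, f (D.ρ i) = f i) :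
    ∑ i with D.d i = 1, f i = p * f D.i₀ := by
  rw [linear_eq_orb, D.sum_orb D.ρ_i₀ hf]

theorem sum_univ (f : I → ℕ) : ∑ i, f i = ∑ i with D.d i = 1, f i + ∑ i ∈ D.N, f i := by
  rw [← Finset.sum_filter_add_sum_filter_not Finset.univ fun i => D.d i = 1]
  congr 1
  refine Finset.sum_congr (Finset.ext fun i => ?_) fun _ _ => rfl
  have := D.d_pos i
  simp only [N, Finset.mem_filter, Finset.mem_univ, true_and]
  omega

theorem sum_cartan : ∑ i, ∑ j, D.d i * D.d j * D.c i j =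
    p * (D.x + 2 * D.q D.i₀) + ∑ j ∈ D.N, D.d j * D.q j := by
  have hx : ∀ j, ∑ i with D.d i = 1, D.d i * D.d (D.ρ j) * D.c i (D.ρ j) =
      ∑ i with D.d i = 1, D.d i * D.d j * D.c i j := by
    intro j
    rw [← Finset.sum_equiv D.ρ (s := Finset.univ.filter fun i => D.d i = 1)
      (fun i => by simp [D.d_ρ]) fun i _ => rfl]
    simp only [D.d_ρ, D.c_ρ]
  have h1 : ∑ j with D.d j = 1, ∑ i with D.d i = 1, D.d i * D.d j * D.c i j = p * D.x := by
    rw [D.sum_linear hx, x, D.d_i₀]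
    congr 1
    refine Finset.sum_congr rfl fun i hi => ?_
    rw [(Finset.mem_filter.1 hi).2, one_mul, one_mul]
  have h2 : ∑ j with D.d j = 1, ∑ i ∈ D.N, D.d i * D.d j * D.c i j = p * D.q D.i₀ := by
    rw [← D.sum_linear D.q_ρ]
    refine Finset.sum_congr rfl fun j hj => Finset.sum_congr rfl fun i _ => ?_
    rw [(Finset.mem_filter.1 hj).2, mul_one]
  -- The Nakayama permutation exchanges the two mixed parts of the Cartan matrix; this is the source
  -- of the factor `2` in front of `q`.
  have h3 : ∑ j ∈ D.N, ∑ i with D.d i = 1, D.d i * D.d j * D.c i j = p * D.q D.i₀ := by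
    rw [← h2, Finset.sum_comm]
    refine Finset.sum_equiv D.ν (fun i => by simp [D.d_ν]) fun i _ =>
      Finset.sum_congr rfl fun j _ => ?_
    rw [D.d_ν, ← D.c_ν, mul_comm (D.d i)]
  have h4 : ∑ j ∈ D.N, ∑ i ∈ D.N, D.d i * D.d j * D.c i j = ∑ j ∈ D.N, D.d j * D.q j := by
    refine Finset.sum_congr rfl fun j _ => ?_
    rw [q, Finset.mul_sum]
    refine Finset.sum_congr rfl fun i _ => ?_
    ring
  rw [Finset.sum_comm, D.sum_univ]
  simp only [D.sum_univ fun i => D.d i * D.d _ * D.c i _]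
  rw [Finset.sum_add_distrib, Finset.sum_add_distrib, h1, h2, h3, h4]
  ring

theorem mul_le_q {i : I} (hi : i ∈ D.N) (j : I) : D.d i * D.c i j ≤ D.q j :=
  Finset.single_le_sum (f := fun i => D.d i * D.c i j) (fun _ _ => Nat.zero_le _) hi

theorem sum_eq_le_u {j : I} (hj : j ∈ D.N) : ∑ i with D.d i = D.d j, D.c i j ≤ D.u j := by
  refine Finset.sum_le_sum_of_subset fun i hi => ?_
  rw [mem_N, (Finset.mem_filter.1 hi).2]
  exact D.mem_N.1 hj

theorem sum_eq_add_le_q {j : I} (hj : j ∈ D.N) {i : I} (hi : i ∈ D.N) (hij : D.d i ≠ D.d j) :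
    D.d j * ∑ i with D.d i = D.d j, D.c i j + D.d i * D.c i j ≤ D.q j := by
  have hd : i ∉ Finset.univ.filter fun i => D.d i = D.d j := by simp [hij]
  rw [Finset.mul_sum, add_comm]
  have : ∑ l with D.d l = D.d j, D.d j * D.c l j = ∑ l with D.d l = D.d j, D.d l * D.c l j :=
    Finset.sum_congr rfl fun l hl => by rw [(Finset.mem_filter.1 hl).2]
  rw [this, ← Finset.sum_insert (f := fun l => D.d l * D.c l j) hd]
  refine Finset.sum_le_sum_of_subset fun l hl => ?_
  rcases Finset.mem_insert.1 hl with rfl | hl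
  · exact hi
  · rw [mem_N, (Finset.mem_filter.1 hl).2]
    exact D.mem_N.1 hj

theorem mul_sum_eq_le_q {j : I} (hj : j ∈ D.N) :
    D.d j * ∑ i with D.d i = D.d j, D.c i j ≤ D.q j := by
  rw [Finset.mul_sum]
  have : ∑ l with D.d l = D.d j, D.d j * D.c l j = ∑ l with D.d l = D.d j, D.d l * D.c l j :=
    Finset.sum_congr rfl fun l hl => by rw [(Finset.mem_filter.1 hl).2]
  rw [this]
  refine Finset.sum_le_sum_of_subset fun l hl => ?_
  rw [mem_N, (Finset.mem_filter.1 hl).2]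
  exact D.mem_N.1 hj

/-- By `c_ν`, the projective of `j` contains the simple module `ν⁻¹ i`, whose dimension differs from
that of `j`; so it is not simple. -/
theorem two_le_of_cartan_pos {i j : I} (h : 1 ≤ D.c j i) (hij : D.d i ≠ D.d j) :
    2 ≤ ∑ i with D.d i = D.d j, D.c i j := by
  refine (D.proj_or j).resolve_left fun h1 => ?_
  have h2 := h1 (D.ν.symm i)
  rw [D.c_ν, Equiv.apply_symm_apply, if_neg] at h2
  · omega
  · rintro rfl
    exact hij (by rw [← D.d_ν (D.ν.symm i), Equiv.apply_symm_apply])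

theorem q_eq_or {j : I} (hj : j ∈ D.N) : D.q j = D.d j ∨ 2 * D.d j ≤ D.q j := by
  rcases D.proj_or j with h | h
  · left
    simp [q, h, hj]
  · right
    have := D.mul_sum_eq_le_q hj
    nlinarith

theorem two_mul_le_q {i j : I} (h : 1 ≤ D.c j i) (hij : D.d i ≠ D.d j) (hj : j ∈ D.N) :
    2 * D.d j ≤ D.q j := by
  have h1 := D.mul_sum_eq_le_q hj
  have h2 := D.two_le_of_cartan_pos h hij
  nlinarith

/-- The contribution of the orbit of `j` to the dimension, divided by `p`. -/
def wt (j : I) : ℕ := if D.ρ j = j then D.d j / p * D.q j else D.d j * D.q j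

theorem sum_orb_eq_wt (j : I) : ∑ i ∈ D.orb j, D.d i * D.q i = p * D.wt j := by
  rw [wt]
  split_ifs with h
  · rw [D.orb_eq_singleton h, Finset.sum_singleton, ← mul_assoc,
      Nat.mul_div_cancel' (D.dvd_d j h)]
  · exact D.sum_orb h fun i => by rw [D.d_ρ, D.q_ρ]

theorem sum_eq_wt_add {F : Finset I} (hF : ∀ i ∈ F, D.ρ i ∈ F) {j : I} (hj : j ∈ F) :
    ∑ i ∈ F, D.d i * D.q i = p * D.wt j + ∑ i ∈ F \ D.orb j, D.d i * D.q i := by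
  rw [← D.sum_orb_eq_wt, add_comm, Finset.sum_sdiff (D.orb_subset hF hj)]

theorem wt_of_fixed {j : I} (hj : D.ρ j = j) {m : ℕ} (hm : D.d j = p * m) :
    D.wt j = m * D.q j := by
  rw [wt, if_pos hj, hm, Nat.mul_div_cancel_left _ D.prime.pos]

theorem wt_of_not_fixed {j : I} (hj : D.ρ j ≠ j) : D.wt j = D.d j * D.q j := if_neg hj

/-- The two cheapest orbits have simple projectives: a free one with `d = 2` has weight `4`, a fixed
one with `d = p` has weight `p`. A larger dimension or a non-simple projective costs at least `8` or
`2 * p`. -/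
theorem wt_cases {j : I} (hj : j ∈ D.N) :
    D.wt j = 4 ∨ D.wt j = p ∨ 8 ≤ D.wt j ∨ 2 * p ≤ D.wt j := by
  have h2 := D.mem_N.1 hj
  by_cases h : D.ρ j = j
  · obtain ⟨m, hm⟩ := D.dvd_d j h
    rw [D.wt_of_fixed h hm]
    have hm0 : m ≠ 0 := by rintro rfl; omega
    rcases D.q_eq_or hj with h3 | h3
    · rcases Nat.lt_or_ge m 2 with h4 | h4
      · have : m = 1 := by omega
        subst this
        right; left
        rw [h3, hm]; ring
      · right; right; right
        rw [h3, hm]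
        nlinarith [D.prime.pos, Nat.mul_le_mul h4 h4, Nat.mul_le_mul_left p (Nat.mul_le_mul h4 h4)]
    · right; right; right
      have h5 : 1 ≤ m := by omega
      rw [hm] at h3
      nlinarith [Nat.mul_le_mul h5 h3, Nat.mul_le_mul h5 h5, D.prime.pos]
  · rw [D.wt_of_not_fixed h]
    rcases D.q_eq_or hj with h3 | h3
    · rw [h3]
      rcases Nat.lt_or_ge (D.d j) 3 with h4 | h4
      · have : D.d j = 2 := by omega
        left; rw [this]
      · right; right; left; nlinarith
    · right; right; left; nlinarith

/-- No orbit, exactly one, or at least two: in the last case add the minimal weights of `wt_cases`.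
-/
theorem remainder_cases {F : Finset I} (hF : ∀ i ∈ F, D.ρ i ∈ F) (hFN : F ⊆ D.N) {R : ℕ}
    (hR : ∑ i ∈ F, D.d i * D.q i = p * R) :
    R = 0 ∨ R = 4 ∨ R = p ∨ 8 ≤ R ∨ 2 * p ≤ R ∨ 4 + p ≤ R := by
  have hp := D.prime.pos
  rcases F.eq_empty_or_nonempty with rfl | ⟨j, hj⟩
  · left
    rw [Finset.sum_empty] at hR
    exact (mul_eq_zero.1 hR.symm).resolve_left hp.ne'
  · rw [D.sum_eq_wt_add hF hj] at hR
    have h1 := D.wt_cases (hFN hj)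
    rcases (F \ D.orb j).eq_empty_or_nonempty with h | ⟨l, hl⟩
    · rw [h, Finset.sum_empty, add_zero] at hR
      have := Nat.eq_of_mul_eq_mul_left hp hR
      omega
    · rw [D.sum_eq_wt_add (D.sdiff_orb hF j) hl, ← add_assoc, ← mul_add] at hR
      have h2 := D.wt_cases (hFN (Finset.mem_sdiff.1 hl).1)
      have h3 : D.wt j + D.wt l ≤ R := Nat.le_of_mul_le_mul_left (by omega) hp
      omega

theorem le_wt {i : I} (hi : i ∈ D.N) {a : ℕ} (hq : a * D.d i ≤ D.q i) :
    (D.ρ i ≠ i ∧ a * (D.d i * D.d i) ≤ D.wt i) ∨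
      ∃ m, D.d i = p * m ∧ 1 ≤ m ∧ a * p * (m * m) ≤ D.wt i := by
  by_cases h : D.ρ i = i
  · right
    obtain ⟨m, hm⟩ := D.dvd_d i h
    refine ⟨m, hm, Nat.pos_of_ne_zero ?_, ?_⟩
    · rintro rfl
      have := D.mem_N.1 hi
      omega
    · rw [D.wt_of_fixed h hm]
      rw [hm] at hq
      calc a * p * (m * m) = m * (a * (p * m)) := by ring
        _ ≤ _ := Nat.mul_le_mul_left m hq
  · left
    refine ⟨h, ?_⟩
    rw [D.wt_of_not_fixed h]
    calc a * (D.d i * D.d i) = D.d i * (a * D.d i) := by ring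
      _ ≤ _ := Nat.mul_le_mul_left _ hq

theorem d_le_q {i : I} (hi : i ∈ D.N) : 1 * D.d i ≤ D.q i := by
  rcases D.q_eq_or hi with h | h <;> omega

theorem add_le_q {i i' : I} (hi : i ∈ D.N) (hi' : i' ∈ D.N) (hne : i ≠ i') (j : I) :
    D.d i * D.c i j + D.d i' * D.c i' j ≤ D.q j := by
  rw [← Finset.sum_pair (f := fun i => D.d i * D.c i j) hne]
  refine Finset.sum_le_sum_of_subset fun l hl => ?_
  rcases Finset.mem_insert.1 hl with rfl | hl
  · exact hi
  · rwa [Finset.mem_singleton.1 hl]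

theorem q_eq_mul_u {j : I} {a : ℕ} (h : ∀ i ∈ D.N, 1 ≤ D.c i j → D.d i = a) :
    D.q j = a * D.u j := by
  rw [q, u, Finset.mul_sum]
  refine Finset.sum_congr rfl fun i hi => ?_
  rcases Nat.eq_zero_or_pos (D.c i j) with h0 | h0
  · rw [h0, mul_zero, mul_zero]
  · rw [h i hi h0]

theorem exists_nonlinear : ∃ V ∈ D.N, 1 ≤ D.c V D.i₀ := by
  by_contra! h
  have h1 : 1 ≤ D.u D.i₀ := D.one_le_v
  rw [u, Finset.sum_eq_zero fun i hi => Nat.lt_one_iff.1 (h i hi)] at h1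
  omega

theorem ne_of_mem_N {V : I} (hV : V ∈ D.N) : D.d D.i₀ ≠ D.d V := by
  rw [D.d_i₀]
  exact (D.mem_N.1 hV).ne

/-! ### Case analysis for the values of t -/

variable {t : ℕ} (ht : t * p = ∑ i, ∑ j, D.d i * D.d j * D.c i j)

include ht

theorem exists_remainder {V : I} (hV : V ∈ D.N) :
    ∃ R, ∑ j ∈ D.N \ D.orb V, D.d j * D.q j = p * R ∧
      t = D.x + 2 * D.q D.i₀ + D.wt V + R := by
  rw [D.sum_cartan, D.sum_eq_wt_add D.N_invariant hV, ← add_assoc, ← mul_add, mul_comm] at ht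
  obtain ⟨R, hR⟩ : p ∣ ∑ j ∈ D.N \ D.orb V, D.d j * D.q j :=
    (Nat.dvd_add_right (dvd_mul_right p _)).1 (ht ▸ dvd_mul_right p t)
  refine ⟨R, hR, ?_⟩
  rw [hR, ← mul_add] at ht
  exact Nat.eq_of_mul_eq_mul_left D.prime.pos ht

omit ht in
theorem wt_le_remainder {V i : I} (hi : i ∈ D.N) (hiV : i ∉ D.orb V) {R : ℕ}
    (hR : ∑ j ∈ D.N \ D.orb V, D.d j * D.q j = p * R) : D.wt i ≤ R := by
  rw [D.sum_eq_wt_add (D.sdiff_orb D.N_invariant V) (Finset.mem_sdiff.2 ⟨hi, hiV⟩)] at hR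
  exact Nat.le_of_mul_le_mul_left (by omega) D.prime.pos

omit ht in
theorem remainder_cases' {V : I} {R : ℕ}
    (hR : ∑ j ∈ D.N \ D.orb V, D.d j * D.q j = p * R) :
    R = 0 ∨ R = 4 ∨ R = p ∨ 8 ≤ R ∨ 2 * p ≤ R ∨ 4 + p ≤ R :=
  D.remainder_cases (D.sdiff_orb D.N_invariant V) Finset.sdiff_subset hR

/-- Below `22` only `x = 2` and `d V = 2` survive: `14 = 2 + 4 + 8` is the minimal configuration,
and `18` arises from one more constituent in the projective of `V` or of the trivial module. For `x
≥ 3` the Loewy condition already gives `23`. -/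
theorem dim_of_free (hfree : ∀ V ∈ D.N, 1 ≤ D.c V D.i₀ → D.ρ V ≠ V) :
    22 ≤ t ∨ ∃ R, (t = 14 + R ∨ t = 18 + R) ∧
      (R = 0 ∨ R = 4 ∨ R = p ∨ 8 ≤ R ∨ 2 * p ≤ R ∨ 4 + p ≤ R) := by
  by_contra! hcon
  obtain ⟨ht22, hcon⟩ := hcon
  have hx : 2 ≤ D.x := D.two_le_x
  have hd2 : ∀ V ∈ D.N, 1 ≤ D.c V D.i₀ → D.d V = 2 := by
    intro V hV hc
    by_contra hne
    have h3 : 3 ≤ D.d V := by have := D.mem_N.1 hV; omega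
    obtain ⟨R, -, hR⟩ := D.exists_remainder ht hV
    have h4 := D.mul_le_q hV D.i₀
    have h5 : D.wt V = _ := D.wt_of_not_fixed (hfree V hV hc)
    have h6 := D.two_mul_le_q hc (D.ne_of_mem_N hV) hV
    have h7 : 3 * 6 ≤ D.d V * D.q V := Nat.mul_le_mul h3 (by omega)
    have h8 : 3 * 1 ≤ D.d V * D.c V D.i₀ := Nat.mul_le_mul h3 hc
    omega
  obtain ⟨V, hV, hcV⟩ := D.exists_nonlinear
  have hdV := hd2 V hV hcV
  obtain ⟨R, hR, htR⟩ := D.exists_remainder ht hV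
  have hwV : D.wt V = _ := D.wt_of_not_fixed (hfree V hV hcV)
  have hqV := D.two_mul_le_q hcV (D.ne_of_mem_N hV) hV
  have h2V := D.two_le_of_cartan_pos hcV (D.ne_of_mem_N hV)
  have hsV := D.mul_le_q hV D.i₀
  rw [hdV] at hwV hqV hsV
  -- A second orbit would force `t ≥ 2 + 8 + 8 + 8`.
  have horb : ∀ W ∈ D.N, 1 ≤ D.c W D.i₀ → W ∈ D.orb V := by
    intro W hW hcW
    by_contra hne
    have h1 := D.wt_le_remainder hW hne hR
    have h2 : D.wt W = _ := D.wt_of_not_fixed (hfree W hW hcW)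
    have h3 := D.two_mul_le_q hcW (D.ne_of_mem_N hW) hW
    have h4 := D.add_le_q hV hW (by rintro rfl; exact hne (D.mem_orb_self V)) D.i₀
    rw [hd2 W hW hcW] at h2 h3 h4
    rw [hdV] at h4
    omega
  have hs : D.q D.i₀ = 2 * D.u D.i₀ := D.q_eq_mul_u hd2
  -- Otherwise `q V ≥ 7`, so `wt V ≥ 14`, and the orbit of `i` adds at least `6`.
  have hdim : ∀ i ∈ D.N, 1 ≤ D.c i V → D.d i = 2 := by
    intro i hi hc
    by_contra hne
    have h3 : 3 ≤ D.d i := by have := D.mem_N.1 hi; omega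
    have hiV : i ∉ D.orb V := fun h => hne ((D.eq_of_mem_orb D.d_ρ h).trans hdV)
    have h1 := D.wt_le_remainder hi hiV hR
    have hne' : D.d V ≠ D.d i := by omega
    have h2 := D.sum_eq_add_le_q hV hi (Ne.symm hne')
    have h4 : 3 * 1 ≤ D.d i * D.c i V := Nat.mul_le_mul h3 hc
    have h5 : 6 ≤ D.wt i := by
      rcases D.le_wt hi (D.two_mul_le_q hc hne' hi) with ⟨-, h⟩ | ⟨m, hm, hm1, h⟩
      · have := Nat.mul_le_mul h3 h3
        omega
      · refine le_trans ?_ h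
        have : 3 ≤ p * m := hm ▸ h3
        calc 6 ≤ 2 * (p * m) * 1 := by omega
          _ ≤ 2 * (p * m) * m := Nat.mul_le_mul_left _ hm1
          _ = _ := by ring
    rw [hdV] at h2 h2V
    omega
  have hqu : D.q V = 2 * D.u V := D.q_eq_mul_u hdim
  have hlo : 3 ≤ D.x → 2 ≤ D.u D.i₀ ∧ (D.u D.i₀ = 2 → 3 ≤ D.u V) := by
    intro h
    obtain ⟨h1, h2⟩ := D.loewy h
    refine ⟨h1, fun h3 => ?_⟩
    obtain ⟨W, hW, hcW, h4⟩ := h2 h3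
    rw [← D.eq_of_mem_orb D.u_ρ (horb W (D.mem_N.2 hW) hcW)]
    exact h4
  have hv : 1 ≤ D.u D.i₀ := D.one_le_v
  have hR' := D.remainder_cases' hR
  have h14 := hcon R
  by_cases h3 : 3 ≤ D.x
  · have := hlo h3
    omega
  · omega

/-- Here `p` divides `d V`, so `q i₀ ≥ 5` and `wt V ≥ 2 * p ≥ 10`; thus `t ≥ 2 + 10 + 10`. -/
theorem dim_of_fixed_of_five_le (hp : 5 ≤ p) {V : I} (hV : V ∈ D.N) (hc : 1 ≤ D.c V D.i₀)
    (hfix : D.ρ V = V) : 22 ≤ t := by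
  have hx : 2 ≤ D.x := D.two_le_x
  obtain ⟨R, -, hR⟩ := D.exists_remainder ht hV
  have h1 := D.mul_le_q hV D.i₀
  rcases D.le_wt hV (D.two_mul_le_q hc (D.ne_of_mem_N hV) hV) with ⟨h, -⟩ | ⟨m, hm, hm1, h⟩
  · exact absurd hfix h
  · have h2 : 5 * 1 ≤ p * m := Nat.mul_le_mul hp hm1
    have h3 : 5 * 1 ≤ D.d V * D.c V D.i₀ := Nat.mul_le_mul (hm ▸ h2) hc
    have h4 : 10 * 1 ≤ 2 * p * (m * m) := Nat.mul_le_mul (by omega) (Nat.mul_le_mul hm1 hm1)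
    omega

/-- Below `20` one has `d V = 3`, `x = 2` and one nonlinear constituent in the trivial projective:
`14 = 2 + 6 + 6`, while `17` comes from a third constituent in the projective of `V`. -/
theorem dim_of_fixed_of_three (hp : p = 3) {V : I} (hV : V ∈ D.N) (hcV : 1 ≤ D.c V D.i₀)
    (hfix : D.ρ V = V) : 20 ≤ t ∨ ∃ R, (t = 14 + R ∨ t = 17 + R) ∧
      (R = 0 ∨ R = 4 ∨ R = p ∨ 8 ≤ R ∨ 2 * p ≤ R ∨ 4 + p ≤ R) := by
  by_contra! hcon
  obtain ⟨ht20, hcon⟩ := hcon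
  subst hp
  have hx : 2 ≤ D.x := D.two_le_x
  obtain ⟨R, hR, htR⟩ := D.exists_remainder ht hV
  have hsV := D.mul_le_q hV D.i₀
  have hqV := D.two_mul_le_q hcV (D.ne_of_mem_N hV) hV
  have h2V := D.two_le_of_cartan_pos hcV (D.ne_of_mem_N hV)
  have hdV : D.d V = 3 := by
    obtain ⟨m, hm⟩ := D.dvd_d V hfix
    have h1 := D.wt_of_fixed hfix hm
    have h2 := D.mem_N.1 hV
    by_contra hne
    have h3 : 2 ≤ m := by omega
    have h4 : 2 * 12 ≤ m * D.q V := Nat.mul_le_mul h3 (by omega)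
    omega
  have hwV : D.wt V = D.q V := by rw [D.wt_of_fixed (m := 1) hfix (by omega), one_mul]
  rw [hdV] at hqV hsV
  have hwt : ∀ i ∈ D.N, 2 * D.d i ≤ D.q i → 6 ≤ D.wt i := by
    intro i hi hq
    have h2 := D.mem_N.1 hi
    rcases D.le_wt hi hq with ⟨-, h⟩ | ⟨m, hm, hm1, h⟩
    · have := Nat.mul_le_mul h2 h2
      omega
    · have := Nat.mul_le_mul hm1 hm1
      omega
  have huniq : ∀ W ∈ D.N, 1 ≤ D.c W D.i₀ → D.d W = 3 := by
    intro W hW hcW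
    by_contra hne
    have hWV : W ∉ D.orb V := fun h => hne ((D.eq_of_mem_orb D.d_ρ h).trans hdV)
    have h1 := D.wt_le_remainder hW hWV hR
    have h2 := hwt W hW (D.two_mul_le_q hcW (D.ne_of_mem_N hW) hW)
    have h4 := D.add_le_q hV hW (by rintro rfl; exact hne hdV) D.i₀
    have h5 : 2 * 1 ≤ D.d W * D.c W D.i₀ := Nat.mul_le_mul (D.mem_N.1 hW) hcW
    rw [hdV] at h4
    omega
  have hs : D.q D.i₀ = 3 * D.u D.i₀ := D.q_eq_mul_u huniq
  have hdim : ∀ i ∈ D.N, 1 ≤ D.c i V → D.d i = 3 := by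
    intro i hi hc
    by_contra hne
    have hne' : D.d V ≠ D.d i := by omega
    have hiV : i ∉ D.orb V := fun h => hne ((D.eq_of_mem_orb D.d_ρ h).trans hdV)
    have h1 := D.wt_le_remainder hi hiV hR
    have h2 := D.sum_eq_add_le_q hV hi (Ne.symm hne')
    have h4 : 2 * 1 ≤ D.d i * D.c i V := Nat.mul_le_mul (D.mem_N.1 hi) hc
    have h5 := hwt i hi (D.two_mul_le_q hc hne' hi)
    rw [hdV] at h2 h2V
    omega
  have hqu : D.q V = 3 * D.u V := D.q_eq_mul_u hdim
  have hv : 1 ≤ D.u D.i₀ := D.one_le_v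
  have hR' := D.remainder_cases' hR
  have h14 := hcon R
  by_cases h3 : 3 ≤ D.x
  · have : 2 ≤ D.u D.i₀ := (D.loewy h3).1
    omega
  · omega

theorem dim_of_fixed_of_two (hp : p = 2) {V : I} (hV : V ∈ D.N) (hcV : 1 ≤ D.c V D.i₀)
    (hfix : D.ρ V = V) : 10 ≤ t ∧ (Even t ∨ 17 ≤ t) := by
  subst hp
  have hx : 2 ≤ D.x := D.two_le_x
  obtain ⟨R, hR, htR⟩ := D.exists_remainder ht hV
  have hsV := D.mul_le_q hV D.i₀
  have hqV := D.two_mul_le_q hcV (D.ne_of_mem_N hV) hV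
  obtain ⟨m, hm⟩ := D.dvd_d V hfix
  have hwV := D.wt_of_fixed hfix hm
  have hm1 : 1 ≤ m := by have := D.mem_N.1 hV; omega
  have h1 : 2 * 1 ≤ D.d V * D.c V D.i₀ := Nat.mul_le_mul (by omega) hcV
  have h2 : 1 * 4 ≤ m * D.q V := Nat.mul_le_mul hm1 (by omega)
  refine ⟨by omega, ?_⟩
  -- If all nonlinear dimensions are `2`, then `t = x + 4 u + 2 U`, with `u` the nonlinear count of
  -- the trivial projective and `U` its sum over all nonlinear projectives. So `t` is even for `x =
  -- 2`, and for `x ≥ 3` the Loewy condition gives `t ≥ 17`. A dimension above `2` makes the weights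
  -- large.
  by_cases hdim : ∀ i ∈ D.N, D.d i = 2
  · have h2V := D.two_le_of_cartan_pos hcV (D.ne_of_mem_N hV)
    have hs : D.q D.i₀ = 2 * D.u D.i₀ := D.q_eq_mul_u fun i hi _ => hdim i hi
    have hQ : ∑ j ∈ D.N, D.d j * D.q j = 4 * ∑ j ∈ D.N, D.u j := by
      rw [Finset.mul_sum]
      refine Finset.sum_congr rfl fun j hj => ?_
      rw [hdim j hj, D.q_eq_mul_u fun i hi _ => hdim i hi]
      ring
    rw [D.sum_cartan, hQ, hs] at ht
    have hU : ∀ j ∈ D.N, D.u j ≤ ∑ j ∈ D.N, D.u j := fun j hj =>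
      Finset.single_le_sum (f := D.u) (fun _ _ => Nat.zero_le _) hj
    have hUV := hU V hV
    have huV := D.sum_eq_le_u hV
    have hv : 1 ≤ D.u D.i₀ := D.one_le_v
    have hlo : 3 ≤ D.x → 2 ≤ D.u D.i₀ ∧ (D.u D.i₀ = 2 → 3 ≤ ∑ j ∈ D.N, D.u j) := by
      intro h
      obtain ⟨h1, h2⟩ := D.loewy h
      refine ⟨h1, fun h3 => ?_⟩
      obtain ⟨W, hW, hcW, h4⟩ := h2 h3
      exact le_trans h4 (hU W (D.mem_N.2 hW))
    rw [Nat.even_iff]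
    by_cases h3 : 3 ≤ D.x
    · have := hlo h3
      omega
    · omega
  · push Not at hdim
    obtain ⟨i, hi, hdi⟩ := hdim
    right
    by_cases hm2 : m = 1
    · have hiV : i ∉ D.orb V := fun h => hdi (by rw [D.eq_of_mem_orb D.d_ρ h]; omega)
      have h3 := D.wt_le_remainder hi hiV hR
      have h4 : 3 ≤ D.d i := by have := D.mem_N.1 hi; omega
      have h5 : 8 ≤ D.wt i := by
        rcases D.le_wt hi (D.d_le_q hi) with ⟨-, h⟩ | ⟨l, hl, -, h⟩
        · have := Nat.mul_le_mul h4 h4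
          omega
        · have h5 : 2 ≤ l := by omega
          have := Nat.mul_le_mul h5 h5
          omega
      omega
    · have h3 : 2 ≤ m := by omega
      have h4 : 2 * 8 ≤ m * D.q V := Nat.mul_le_mul h3 (by omega)
      omega

theorem not_mem : (p = 2 → t ∉ ({1, 2, 3, 4, 5, 6, 7, 8, 9, 11, 13, 15} : Set ℕ)) ∧
    (p = 3 → t ∉ ({1, 2, 3, 4, 5, 6, 7, 8, 9, 10, 11, 12, 13, 15, 16, 19} : Set ℕ)) ∧
    (3 < p →
      t ∉ ({1, 2, 3, 4, 5, 6, 7, 8, 9, 10, 11, 12, 13, 15, 16, 17, 20} : Set ℕ) ∧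
      (p ≠ 5 → t ≠ 19) ∧ (p ≠ 7 → t ≠ 21)) := by
  simp only [Set.mem_insert_iff, Set.mem_singleton_iff]
  by_cases hfree : ∀ V ∈ D.N, 1 ≤ D.c V D.i₀ → D.ρ V ≠ V
  · have h := D.dim_of_free ht hfree
    have h4 : p ≠ 4 := fun h => absurd D.prime (by rw [h]; norm_num)
    -- A remainder `R = 6` would allow `t = 20`. The genuine exceptions `19 = 14 + 5` and `21 = 14 +
    -- 7` come from a single fixed block of dimension `p` with simple projective.
    have h6 : p ≠ 6 := fun h => absurd D.prime (by rw [h]; norm_num)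
    rcases h with h | ⟨R, h, h'⟩ <;> omega
  · push Not at hfree
    obtain ⟨V, hV, hc, hfix⟩ := hfree
    refine ⟨fun hp => ?_, fun hp => ?_, fun hp => ?_⟩
    · have := D.dim_of_fixed_of_two ht hp hV hc hfix
      rw [Nat.even_iff] at this
      omega
    · rcases D.dim_of_fixed_of_three ht hp hV hc hfix with h | ⟨R, h, h'⟩ <;> omega
    · have h4 : p ≠ 4 := fun h => absurd D.prime (by rw [h]; norm_num)
      have := D.dim_of_fixed_of_five_le ht (by omega) hV hc hfix
      omega

end CartanData

end BlockSystem

/-! ### Assembling the numerical data of a Hopf algebra -/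

namespace BlockSystem

open Coalgebra HopfAlgebra WithConv

section

variable {k H : Type*} [Field k] [IsAlgClosed k] [CharZero k] [Ring H] [HopfAlgebra k H]
  [FiniteDimensional k H]

theorem exists_cartanData (hncs : ¬ IsCosemisimple k H)
    (hskew : ∀ x : H, ¬ IsNontrivialSkewPrimitive k x) {p : ℕ} (hp : p.Prime)
    (hG : Nat.card (GroupLike k H) = p) :
    ∃ (n : ℕ) (D : CartanData (Fin n) p),
      Module.finrank k H = ∑ i, ∑ j, D.d i * D.d j * D.c i j := by
  obtain ⟨S⟩ := exists_splitSystem k (DualAlgebra k H)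
  obtain ⟨Λ, hΛ0, hΛ⟩ := exists_integral k H
  let φ : DualAlgebra k H →ₗ[k] k :=
    LinearMap.applyₗ Λ ∘ₗ (WithConv.linearEquiv k (H →ₗ[k] k)).toLinearMap
  have hφ : ∀ x, (∀ a, φ (a * x) = 0) → x = 0 := fun x hx => integral_nondegenerate hΛ0 hΛ x hx
  obtain ⟨σ, hσ⟩ := exists_nakayama hφ
  have hExt := splitsCharExtensions_of_skewPrimitive hskew
  have : Fact p.Prime := ⟨hp⟩
  have : Finite (GroupLike k H) := Nat.finite_of_card_ne_zero (hG ▸ hp.ne_zero)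
  have : Nontrivial (GroupLike k H) := Finite.one_lt_card_iff_nontrivial.1 (hG ▸ hp.one_lt)
  have hcyc : IsCyclic (GroupLike k H) := isCyclic_of_prime_card hG
  obtain ⟨g, hg⟩ := hcyc.exists_generator
  have hgo : orderOf g = p := (orderOf_eq_card_of_forall_mem_zpowers hg).trans hG
  obtain ⟨i₀, hi₀⟩ := S.exists_index (evalChar (k := k) (1 : GroupLike k H).2)
  have hi₀' : ∀ a : DualAlgebra k H, a 1 = 0 ↔ S.π a i₀ = 0 := hi₀
  set ρ := S.perm (translate g) with hρ
  -- The `m`-th translate of the trivial block is evaluation at `g ^ m`; since `g` generates, this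
  -- reaches every linear block.
  have hpow : ∀ (m : ℕ) (a : DualAlgebra k H), S.π a ((ρ ^ m) i₀) = 0 ↔ a (g ^ m).val = 0 := by
    intro m a
    rw [hρ, ← S.perm_pow, ← S.perm_spec, ← hi₀', translate_pow_apply, mul_one]
  have hdi : S.d i₀ = 1 := by
    have h := S.finrank_eq_sq (q := evalChar (k := k) (1 : GroupLike k H).2)
      (fun c => ⟨algebraMap k _ c, by simp⟩) hi₀
    rw [Module.finrank_self] at h
    exact Nat.eq_one_of_mul_eq_one_right h.symm
  -- The failure of cosemisimplicity enters here: the projective cover of the trivial module is not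
  -- simple.
  have hR : S.rad i₀ ≠ ⊥ := fun h =>
    hncs (S.isCosemisimple_of_jacobson_eq_bot (S.jacobson_eq_bot hi₀' h))
  have h2 := (S.cartan_eq_one_or_two_le hφ hσ i₀).resolve_left fun h => hR h.1
  rw [hdi] at h2
  refine ⟨S.n, {
    prime := hp
    d := S.d
    c := S.cartan
    ρ := ρ
    ν := (S.perm σ)⁻¹
    i₀ := i₀
    ρ_pow := ?_
    d_ρ := S.d_perm _
    c_ρ := S.cartan_perm _
    d_ν := fun i => ?_
    c_ν := S.cartan_nakayama hφ hσ
    d_pos := S.d_pos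
    d_i₀ := hdi
    linear := fun i hi => ?_
    ρ_i₀ := fun h => ?_
    proj_or := fun j => (S.cartan_eq_one_or_two_le hφ hσ j).imp_left And.right
    dvd_d := fun j hj => S.dvd_d_of_perm_eq hp hgo hj
    two_le_x := h2
    one_le_v := S.one_le_nonlinear hExt hdi hR
    loewy := fun h3 => S.two_le_nonlinear hExt hφ hσ hdi hR h3 }, ?_⟩
  · rw [hρ, ← S.perm_pow]
    have : translate g ^ p = 1 := by
      ext a x
      rw [translate_pow_apply, ← hgo, pow_orderOf_eq_one]
      simp
    rw [this, S.perm_one]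
  · rw [← S.d_perm σ, Equiv.Perm.inv_def, Equiv.apply_symm_apply]
  · obtain ⟨χ, hχ⟩ := S.exists_char hi
    obtain ⟨h, hh, hχh⟩ := exists_groupLike χ
    obtain ⟨m, hm⟩ := (mem_powers_iff_mem_zpowers.2 (hg ⟨h, hh⟩))
    refine ⟨m, S.index_unique fun a => ?_⟩
    rw [hpow, ← hχ, hχh, show g ^ m = ⟨h, hh⟩ from hm]
  · have h1 : (g ^ 1).val = (1 : H) := by
      have h3 : ∀ a : DualAlgebra k H, a (g ^ 1).val = 0 ↔ a 1 = 0 := fun a => by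
        rw [← hpow, hi₀', pow_one, h]
      have h4 := S.char_ext (l := i₀) hi₀ (χ' := evalChar (g ^ 1).2) fun a => by
        rw [evalChar_apply, h3, hi₀']
      refine eq_of_forall_dual (k := k) fun a => ?_
      exact (AlgHom.congr_fun h4 a).symm
    have h5 : g = 1 := GroupLike.ext (by rw [← pow_one g]; exact h1)
    rw [h5, orderOf_one] at hgo
    exact hp.one_lt.ne hgo
  · rw [← finrank_dualAlgebra]
    exact S.finrank_eq_sum_cartan

end

end BlockSystem

theorem corollary5 {k H : Type*} [Field k] [IsAlgClosed k] [CharZero k]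
    [Ring H] [HopfAlgebra k H] [FiniteDimensional k H]
    (hncs : ¬ BlockSystem.IsCosemisimple k H)
    (hskew : ∀ x : H, ¬ BlockSystem.IsNontrivialSkewPrimitive k x)
    (p t : ℕ) (hp : p.Prime) (hG : Nat.card (GroupLike k H) = p)
    (ht : 1 ≤ t) (hdim : Module.finrank k H = t * p) :
    (p = 2 → t ∉ ({1, 2, 3, 4, 5, 6, 7, 8, 9, 11, 13, 15} : Set ℕ)) ∧
    (p = 3 → t ∉ ({1, 2, 3, 4, 5, 6, 7, 8, 9, 10, 11, 12, 13, 15, 16, 19} : Set ℕ)) ∧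
    (3 < p →
      t ∉ ({1, 2, 3, 4, 5, 6, 7, 8, 9, 10, 11, 12, 13, 15, 16, 17, 20} : Set ℕ) ∧
      (p ≠ 5 → t ≠ 19) ∧ (p ≠ 7 → t ≠ 21)) := by
  obtain ⟨n, D, hD⟩ := BlockSystem.exists_cartanData hncs hskew hp hG
  exact D.not_mem (hdim.symm.trans hD)
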